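/- Let $\Omega\subset\mathbb R^2$ be a simply connected polygon, i.e. a bounded domain, lying locally on one side of its boundary $\Gamma$, where $\Gamma$ is a simple closed polygonal curve; its vertices (where consecutive sides are not aligned) are called corners. Let $\mathcal T$ be a partition of $\overline\Omega$ into finitely many nondegenerate closed triangles such that any two distinct triangles are disjoint or meet in exactly one common vertex or exactly one common edge. Assume that $\mathcal T$ is corner-split: every $K\in\mathcal T$ has at most one edge contained in $\Gamma$, and no corner $a$ of $\Omega$ is singular, i.e. the edges of $\mathcal T$ with endpoint $a$ do not all lie on two straight lines. Let $k\ge 4$ and $\nu>0$. For a piecewise polynomial $p$ and a vertex $a$, say that $p$ is $C^r$ at $a$ if the derivatives of order at most $r$ of $p|_K$ at $a$ are the same for all $K\in\mathcal T$ with vertex $a$. A vertex of the mesh is noncorner if it is not a corner of $\Omega$. Define $$\Sigma_0=\{\phi\in H^2_0(\Omega):\ \phi|_K\in\mathcal P_{k+1}(K)\ \forall K\in\mathcal T,\ \phi\text{ is }C^2\text{ at noncorner vertices}\},$$ $$V=\{v\in H^1(\Omega):\ v|_K\in\mathcal P_{k}(K)\ \forall K\in\mathcal T,\ v\text{ is }C^1\text{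 at noncorner vertices}\},$$ $$Q=\{q\in L^2(\Omega):\ q|_K\in\mathcal P_{k-1}(K)\ \forall K\in\mathcal T,\ q\text{ is }C^0\text{ at noncorner vertices}\},$$ $\mathbf V_0=(V\cap H^1_0(\Omega))^2$ and $Q_0=\{q\in Q:\int_\Omega q\,dx=0\}$. Let $(\cdot,\cdot)$ be the $L^2(\Omega)$ inner product, $a(\mathbf u,\mathbf v)=\nu(\nabla\mathbf u,\nabla\mathbf v)$ and $\mathbf{curl}\,\phi=(\partial_y\phi,-\partial_x\phi)^T$. Define the interior spaces $$\Sigma_I=\{\phi\in\Sigma_0:\ \phi|_{\partial K}=\partial_n\phi|_{\partial K}=0\ \ \forall K\in\mathcal T\},\qquad \mathbf V_I=\{\mathbf v\in\mathbf V_0:\ \mathbf v|_{\partial K}=\mathbf 0\ \ \forall K\in\mathcal T\},$$ $$Q_I=\Big\{q\in Q_0:\ \int_K q\,dx=0\text{ and } q|_K(a)=0\text{ for every vertex }a\text{ of }K,\ \ \forall K\in\mathcal T\Big\},$$ and the exterior spaces $$\tilde\Sigma_E=\{\phi\in\Sigma_0:\ a(\mathbf{curl}\,\phi,\mathbf{curl}\,\psi)=0\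 \ \forall\psi\in\Sigma_I\},\qquad \tilde Q_E=\{q\in Q_0:\ (q,r)=0\ \ \forall r\in Q_I\},$$ $$\tilde{\mathbf V}_E=\{\mathbf v\in\mathbf V_0:\ \operatorname{div}\mathbf v\in\tilde Q_E,\ a(\mathbf v,\mathbf{curl}\,\psi)=0\ \ \forall\psi\in\Sigma_I\}.$$ Then the following three sequences are well defined and exact: $$0\to\Sigma_0\xrightarrow{\ \mathbf{curl}\ }\mathbf V_0\xrightarrow{\ \operatorname{div}\ }Q_0\to0,\qquad 0\to\Sigma_I\xrightarrow{\ \mathbf{curl}\ }\mathbf V_I\xrightarrow{\ \operatorname{div}\ }Q_I\to0,\qquad 0\to\tilde\Sigma_E\xrightarrow{\ \mathbf{curl}\ }\tilde{\mathbf V}_E\xrightarrow{\ \operatorname{div}\ }\tilde Q_E\to0.$$ Moreover the first row is the direct sum of the other two: $\Sigma_0=\Sigma_I\oplus\tilde\Sigma_E$, $\mathbf V_0=\mathbf V_I\oplus\tilde{\mathbf V}_E$ and $Q_0=Q_I\oplus\tilde Q_E$. -/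

import Mathlib

open MeasureTheory Filter Topology
open scoped ContDiff

noncomputable section

namespace StokesFE

/-- The Euclidean plane. -/
abbrev Plane : Type := EuclideanSpace ℝ (Fin 2)

/-! ### Sobolev spaces on an open set of the plane -/

/-- The classical partial derivative `∂ᵢ u`. -/
def partialDeriv (i : Fin 2) (u : Plane → ℝ) : Plane → ℝ :=
  fun x => fderiv ℝ u x (EuclideanSpace.single i 1)

/-- `ψ ∈ C_c^∞(Ω)`. -/
structure IsTest (Ω : Set Plane) (ψ : Plane → ℝ) : Prop where
  smooth : ContDiff ℝ ∞ ψ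
  compact : HasCompactSupport ψ
  supp : tsupport ψ ⊆ Ω

/-- `g` is the weak partial derivative `∂ᵢ f` on `Ω`. It is only used for `f, g ∈ L²(Ω)`. -/
def HasWeakPartial (Ω : Set Plane) (i : Fin 2) (f g : Plane → ℝ) : Prop :=
  ∀ ψ, IsTest Ω ψ → ∫ x in Ω, f x * partialDeriv i ψ x = -∫ x in Ω, g x * ψ x

/-- `f ∈ H^m(Ω)`: all weak partial derivatives up to order `m` exist and lie in `L²(Ω)`. -/
def MemSobolev (Ω : Set Plane) : ℕ → (Plane → ℝ) → Prop
  | 0 => fun f => MemLp f 2 (volume.restrict Ω)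
  | m + 1 => fun f => MemLp f 2 (volume.restrict Ω) ∧
      ∀ i, ∃ g, HasWeakPartial Ω i f g ∧ MemSobolev Ω m g

/-- `f ∈ L²(Ω)` and `uₙ → f` in `L²(Ω)`. -/
def TendstoL2 (Ω : Set Plane) (u : ℕ → Plane → ℝ) (f : Plane → ℝ) : Prop :=
  MemLp f 2 (volume.restrict Ω) ∧
    Tendsto (fun n => eLpNorm (u n - f) 2 (volume.restrict Ω)) atTop (𝓝 0)

/-- For smooth `uₙ`: `f ∈ H^m(Ω)` and `uₙ → f` in `H^m(Ω)`, that is, the derivatives of `uₙ` of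
every order up to `m` converge in `L²(Ω)` to the corresponding weak derivatives of `f`. -/
def TendstoSobolev (Ω : Set Plane) : ℕ → (ℕ → Plane → ℝ) → (Plane → ℝ) → Prop
  | 0 => fun u f => TendstoL2 Ω u f
  | m + 1 => fun u f => TendstoL2 Ω u f ∧
      ∀ i, ∃ g, HasWeakPartial Ω i f g ∧ TendstoSobolev Ω m (fun n => partialDeriv i (u n)) g

/-- `f ∈ H^m_0(Ω)`, the closure of `C_c^∞(Ω)` in `H^m(Ω)`. -/
def MemSobolevZero (Ω : Set Plane) (m : ℕ) (f : Plane → ℝ) : Prop :=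
  ∃ u : ℕ → Plane → ℝ, (∀ n, IsTest Ω (u n)) ∧ TendstoSobolev Ω m u f

theorem IsTest.partialDeriv {Ω : Set Plane} {ψ : Plane → ℝ} (h : IsTest Ω ψ) (i : Fin 2) :
    IsTest Ω (partialDeriv i ψ) where
  smooth := (h.smooth.fderiv_right (m := ∞) (by simp)).clm_apply contDiff_const
  compact := h.compact.fderiv_apply (𝕜 := ℝ) _
  supp := (tsupport_fderiv_apply_subset ℝ _).trans h.supp

theorem IsTest.memLp {Ω : Set Plane} {ψ : Plane → ℝ} (h : IsTest Ω ψ) :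
    MemLp ψ 2 (volume.restrict Ω) :=
  (h.smooth.continuous.memLp_of_hasCompactSupport h.compact).restrict _

theorem IsTest.zero (Ω : Set Plane) : IsTest Ω 0 where
  smooth := contDiff_const
  compact := HasCompactSupport.zero
  supp := by simp [tsupport]

theorem IsTest.add {Ω : Set Plane} {ψ χ : Plane → ℝ} (h : IsTest Ω ψ) (h' : IsTest Ω χ) :
    IsTest Ω (ψ + χ) where
  smooth := h.smooth.add h'.smooth
  compact := h.compact.add h'.compact
  supp := (tsupport_add ψ χ).trans (Set.union_subset h.supp h'.supp)

theorem IsTest.smul {Ω : Set Plane} {ψ : Plane → ℝ} (c : ℝ) (h : IsTest Ω ψ) :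
    IsTest Ω (c • ψ) where
  smooth := contDiff_const.smul h.smooth
  compact := h.compact.smul_left (f := fun _ => c)
  supp := (tsupport_smul_subset_right (fun _ => c) ψ).trans h.supp

theorem partialDeriv_add {Ω : Set Plane} {ψ χ : Plane → ℝ} (h : IsTest Ω ψ) (h' : IsTest Ω χ)
    (i : Fin 2) : partialDeriv i (ψ + χ) = partialDeriv i ψ + partialDeriv i χ := by
  ext x
  simp only [partialDeriv, Pi.add_apply]
  rw [fderiv_add (h.smooth.differentiable (by simp) x) (h'.smooth.differentiable (by simp) x)]
  rfl

theorem partialDeriv_smul {Ω : Set Plane} {ψ : Plane → ℝ} (c : ℝ) (h : IsTest Ω ψ)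
    (i : Fin 2) : partialDeriv i (c • ψ) = c • partialDeriv i ψ := by
  ext x
  simp only [partialDeriv, Pi.smul_apply]
  rw [fderiv_const_smul (h.smooth.differentiable (by simp) x)]
  rfl

theorem HasWeakPartial.zero (Ω : Set Plane) (i : Fin 2) : HasWeakPartial Ω i 0 0 := by
  intro ψ _
  simp

theorem HasWeakPartial.add {Ω : Set Plane} {i : Fin 2} {f g f' g' : Plane → ℝ}
    (hf : MemLp f 2 (volume.restrict Ω)) (hg : MemLp g 2 (volume.restrict Ω))
    (hf' : MemLp f' 2 (volume.restrict Ω)) (hg' : MemLp g' 2 (volume.restrict Ω))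
    (h : HasWeakPartial Ω i f g) (h' : HasWeakPartial Ω i f' g') :
    HasWeakPartial Ω i (f + f') (g + g') := by
  intro ψ hψ
  have hd := (hψ.partialDeriv i).memLp
  have hp := hψ.memLp
  have e1 : ∫ x in Ω, (f x * partialDeriv i ψ x + f' x * partialDeriv i ψ x) =
      (∫ x in Ω, f x * partialDeriv i ψ x) + ∫ x in Ω, f' x * partialDeriv i ψ x :=
    integral_add (hf.integrable_mul hd) (hf'.integrable_mul hd)
  have e2 : ∫ x in Ω, (g x * ψ x + g' x * ψ x) =
      (∫ x in Ω, g x * ψ x) + ∫ x in Ω, g' x * ψ x :=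
    integral_add (hg.integrable_mul hp) (hg'.integrable_mul hp)
  simp only [Pi.add_apply, add_mul]
  rw [e1, e2, h ψ hψ, h' ψ hψ]
  ring

theorem HasWeakPartial.smul {Ω : Set Plane} {i : Fin 2} {f g : Plane → ℝ} (c : ℝ)
    (h : HasWeakPartial Ω i f g) : HasWeakPartial Ω i (c • f) (c • g) := by
  intro ψ hψ
  simp only [Pi.smul_apply, smul_eq_mul, mul_assoc, integral_const_mul]
  rw [h ψ hψ]
  ring

theorem MemSobolev.memLp {Ω : Set Plane} {m : ℕ} {f : Plane → ℝ} (h : MemSobolev Ω m f) :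
    MemLp f 2 (volume.restrict Ω) := by
  cases m with
  | zero => exact h
  | succ m => exact h.1

theorem TendstoSobolev.tendstoL2 {Ω : Set Plane} {m : ℕ} {u : ℕ → Plane → ℝ} {f : Plane → ℝ}
    (h : TendstoSobolev Ω m u f) : TendstoL2 Ω u f := by
  cases m with
  | zero => exact h
  | succ m => exact h.1

theorem MemSobolev.zero (Ω : Set Plane) (m : ℕ) : MemSobolev Ω m 0 := by
  induction m with
  | zero => exact MemLp.zero
  | succ m ih => exact ⟨MemLp.zero, fun i => ⟨0, HasWeakPartial.zero Ω i, ih⟩⟩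

theorem MemSobolev.add {Ω : Set Plane} {m : ℕ} : ∀ {f f' : Plane → ℝ}, MemSobolev Ω m f →
    MemSobolev Ω m f' → MemSobolev Ω m (f + f') := by
  induction m with
  | zero => exact fun h h' => MemLp.add h h'
  | succ m ih =>
    intro f f' h h'
    refine ⟨h.1.add h'.1, fun i => ?_⟩
    obtain ⟨g, hw, hg⟩ := h.2 i
    obtain ⟨g', hw', hg'⟩ := h'.2 i
    exact ⟨g + g', hw.add h.1 hg.memLp h'.1 hg'.memLp hw', ih hg hg'⟩

theorem MemSobolev.smul {Ω : Set Plane} {m : ℕ} (c : ℝ) : ∀ {f : Plane → ℝ}, MemSobolev Ω m f →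
    MemSobolev Ω m (c • f) := by
  induction m with
  | zero => exact fun h => MemLp.const_smul h c
  | succ m ih =>
    intro f h
    refine ⟨h.1.const_smul c, fun i => ?_⟩
    obtain ⟨g, hw, hg⟩ := h.2 i
    exact ⟨c • g, hw.smul c, ih hg⟩

theorem TendstoL2.add {Ω : Set Plane} {u u' : ℕ → Plane → ℝ} {f f' : Plane → ℝ}
    (hu : ∀ n, IsTest Ω (u n)) (hu' : ∀ n, IsTest Ω (u' n))
    (h : TendstoL2 Ω u f) (h' : TendstoL2 Ω u' f') :
    TendstoL2 Ω (fun n => u n + u' n) (f + f') := by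
  refine ⟨h.1.add h'.1, ?_⟩
  have hs := h.2.add h'.2
  rw [add_zero] at hs
  refine tendsto_of_tendsto_of_tendsto_of_le_of_le tendsto_const_nhds hs
    (fun n => zero_le) (fun n => ?_)
  have e : u n + u' n - (f + f') = (u n - f) + (u' n - f') := by abel
  simp only [e]
  exact eLpNorm_add_le ((hu n).memLp.sub h.1).1 ((hu' n).memLp.sub h'.1).1 (by norm_num)

theorem TendstoL2.smul {Ω : Set Plane} {u : ℕ → Plane → ℝ} {f : Plane → ℝ} (c : ℝ)
    (h : TendstoL2 Ω u f) : TendstoL2 Ω (fun n => c • u n) (c • f) := by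
  refine ⟨h.1.const_smul c, ?_⟩
  have hs := ENNReal.Tendsto.const_mul (a := ‖c‖ₑ) h.2 (Or.inr enorm_ne_top)
  rw [mul_zero] at hs
  refine hs.congr fun n => ?_
  rw [← smul_sub, eLpNorm_const_smul]

theorem TendstoSobolev.add {Ω : Set Plane} {m : ℕ} : ∀ {u u' : ℕ → Plane → ℝ} {f f' : Plane → ℝ},
    (∀ n, IsTest Ω (u n)) → (∀ n, IsTest Ω (u' n)) → TendstoSobolev Ω m u f →
    TendstoSobolev Ω m u' f' → TendstoSobolev Ω m (fun n => u n + u' n) (f + f') := by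
  induction m with
  | zero => exact fun hu hu' h h' => TendstoL2.add hu hu' h h'
  | succ m ih =>
    intro u u' f f' hu hu' h h'
    refine ⟨h.1.add hu hu' h'.1, fun i => ?_⟩
    obtain ⟨g, hw, hg⟩ := h.2 i
    obtain ⟨g', hw', hg'⟩ := h'.2 i
    refine ⟨g + g', hw.add h.1.1 hg.tendstoL2.1 h'.1.1 hg'.tendstoL2.1 hw', ?_⟩
    have e : (fun n => StokesFE.partialDeriv i (u n + u' n)) =
        fun n => StokesFE.partialDeriv i (u n) + StokesFE.partialDeriv i (u' n) :=
      funext fun n => partialDeriv_add (hu n) (hu' n) i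
    rw [e]
    exact ih (fun n => (hu n).partialDeriv i) (fun n => (hu' n).partialDeriv i) hg hg'

theorem TendstoSobolev.smul {Ω : Set Plane} {m : ℕ} (c : ℝ) :
    ∀ {u : ℕ → Plane → ℝ} {f : Plane → ℝ}, (∀ n, IsTest Ω (u n)) → TendstoSobolev Ω m u f →
    TendstoSobolev Ω m (fun n => c • u n) (c • f) := by
  induction m with
  | zero => exact fun _ h => TendstoL2.smul c h
  | succ m ih =>
    intro u f hu h
    refine ⟨h.1.smul c, fun i => ?_⟩
    obtain ⟨g, hw, hg⟩ := h.2 i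
    refine ⟨c • g, hw.smul c, ?_⟩
    have e : (fun n => StokesFE.partialDeriv i (c • u n)) =
        fun n => c • StokesFE.partialDeriv i (u n) :=
      funext fun n => partialDeriv_smul c (hu n) i
    rw [e]
    exact ih (fun n => (hu n).partialDeriv i) hg

/-- `H^m(Ω)`, as a space of functions (two functions that agree a.e. on `Ω` are both in it or
both not in it). -/
def sobolev (Ω : Set Plane) (m : ℕ) : Submodule ℝ (Plane → ℝ) where
  carrier := {f | MemSobolev Ω m f}
  zero_mem' := MemSobolev.zero Ω m
  add_mem' := MemSobolev.add
  smul_mem' c _ h := MemSobolev.smul c h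

theorem TendstoSobolev.zero (Ω : Set Plane) (m : ℕ) : TendstoSobolev Ω m (fun _ => 0) 0 := by
  have h0 : TendstoL2 Ω (fun _ => 0) 0 := ⟨MemLp.zero, by simp⟩
  induction m with
  | zero => exact h0
  | succ m ih =>
    refine ⟨h0, fun i => ⟨0, HasWeakPartial.zero Ω i, ?_⟩⟩
    have e : (fun _ : ℕ => partialDeriv i 0) = fun _ => 0 := by
      funext n x
      simp [partialDeriv]
    rw [e]
    exact ih

/-- `H^m_0(Ω)`, as a space of functions. -/
def sobolevZero (Ω : Set Plane) (m : ℕ) : Submodule ℝ (Plane → ℝ) where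
  carrier := {f | MemSobolevZero Ω m f}
  zero_mem' := ⟨fun _ => 0, fun _ => IsTest.zero Ω, TendstoSobolev.zero Ω m⟩
  add_mem' := by
    rintro f f' ⟨u, hu, h⟩ ⟨u', hu', h'⟩
    exact ⟨_, fun n => (hu n).add (hu' n), h.add hu hu' h'⟩
  smul_mem' := by
    rintro c f ⟨u, hu, h⟩
    exact ⟨_, fun n => (hu n).smul c, h.smul c hu⟩

/-! ### Polygons and triangulations -/

/-- A simply connected polygon: a bounded domain, lying locally on one side of its boundary, whose
boundary is a simple closed polygonal curve with vertices `vertex 0, …, vertex (n - 1)`. -/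
structure Polygon where
  /-- the open set `Ω` -/
  carrier : Set Plane
  /-- the number of vertices -/
  n : ℕ
  three_le : 3 ≤ n
  /-- the vertices in cyclic order -/
  vertex : ZMod n → Plane
  /-- consecutive sides are not aligned: every `vertex i` is a genuine corner -/
  corner : ∀ i, AffineIndependent ℝ ![vertex i, vertex (i + 1), vertex (i + 2)]
  adjacent : ∀ i, segment ℝ (vertex i) (vertex (i + 1)) ∩
    segment ℝ (vertex (i + 1)) (vertex (i + 2)) = {vertex (i + 1)}
  nonadjacent : ∀ i j, j ≠ i → j ≠ i + 1 → i ≠ j + 1 →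
    Disjoint (segment ℝ (vertex i) (vertex (i + 1))) (segment ℝ (vertex j) (vertex (j + 1)))
  isOpen : IsOpen carrier
  isConnected : IsConnected carrier
  isBounded : Bornology.IsBounded carrier
  interior_closure : interior (closure carrier) = carrier
  frontier_eq : frontier carrier = ⋃ i, segment ℝ (vertex i) (vertex (i + 1))

/-- A conforming triangulation of the polygon `P`. A triangle is given by its set of vertices. -/
structure Mesh (P : Polygon) where
  /-- the elements -/
  elems : Finset (Finset Plane)
  card_eq : ∀ K ∈ elems, K.card = 3
  indep : ∀ K ∈ elems, AffineIndependent ℝ ((↑) : K → Plane)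
  cover : ⋃ K ∈ elems, convexHull ℝ (K : Set Plane) = closure P.carrier
  /-- two distinct elements are disjoint, or meet in a common vertex or in a common edge -/
  conforming : ∀ K ∈ elems, ∀ L ∈ elems, K ≠ L →
    convexHull ℝ (K : Set Plane) ∩ convexHull ℝ (L : Set Plane) = ∅ ∨
    (∃ a, a ∈ K ∧ a ∈ L ∧ convexHull ℝ (K : Set Plane) ∩ convexHull ℝ (L : Set Plane) = {a}) ∨
    (∃ a b, a ∈ K ∧ a ∈ L ∧ b ∈ K ∧ b ∈ L ∧ a ≠ b ∧
      convexHull ℝ (K : Set Plane) ∩ convexHull ℝ (L : Set Plane) = segment ℝ a b)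

/-- `a` is a corner vertex, i.e. a vertex of the polygon. -/
def Polygon.IsCorner (P : Polygon) (a : Plane) : Prop := ∃ i, P.vertex i = a

variable {P : Polygon}

/-- The vertex `a` is singular: all mesh edges with endpoint `a` lie on two straight lines. -/
def Mesh.IsSingular (T : Mesh P) (a : Plane) : Prop :=
  ∃ d e : Plane, ∀ K ∈ T.elems, a ∈ K → ∀ b ∈ K,
    (∃ t : ℝ, b - a = t • d) ∨ (∃ t : ℝ, b - a = t • e)

/-- The mesh is corner-split: every element has at most one edge on the boundary of the polygon,
and no corner of the polygon is a singular vertex. -/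
structure Mesh.IsCornerSplit (T : Mesh P) : Prop where
  at_most_one : ∀ K ∈ T.elems, ∀ a ∈ K, ∀ b ∈ K, ∀ c ∈ K, a ≠ b → b ≠ c → a ≠ c →
    ¬ (segment ℝ a b ⊆ frontier P.carrier ∧ segment ℝ a c ⊆ frontier P.carrier)
  nonsingular : ∀ a, P.IsCorner a → ¬ T.IsSingular a

/-! ### Piecewise polynomials -/

/-- Polynomials in two variables. -/
abbrev Poly : Type := MvPolynomial (Fin 2) ℝ

/-- The value of a polynomial at a point of the plane. -/
def evalAt (x : Plane) (p : Poly) : ℝ := MvPolynomial.eval (fun i => x i) p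

@[simp] theorem evalAt_add (x : Plane) (p q : Poly) : evalAt x (p + q) = evalAt x p + evalAt x q :=
  map_add _ p q

@[simp] theorem evalAt_smul (x : Plane) (c : ℝ) (p : Poly) : evalAt x (c • p) = c * evalAt x p :=
  MvPolynomial.smul_eval _ p c

@[simp] theorem evalAt_zero (x : Plane) : evalAt x 0 = 0 := map_zero _

theorem continuous_evalAt (p : Poly) : Continuous fun x : Plane => evalAt x p :=
  (MvPolynomial.continuous_eval p).comp (by fun_prop)

/-- Piecewise polynomials on the mesh, represented by the family of the polynomials `p|_K`. -/
abbrev Broken (T : Mesh P) : Type := T.elems → Poly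

/-- The function on the plane that equals `p|_K` in the interior of each element `K` (and `0`
elsewhere: the edges are a null set). -/
def toFun (T : Mesh P) : Broken T →ₗ[ℝ] (Plane → ℝ) where
  toFun p := ∑ K : T.elems,
    (interior (convexHull ℝ (K.1 : Set Plane))).indicator (fun x => evalAt x (p K))
  map_add' p q := by
    ext x
    simp only [Finset.sum_apply, Pi.add_apply, ← Finset.sum_add_distrib]
    refine Finset.sum_congr rfl fun K _ => ?_
    by_cases h : x ∈ interior (convexHull ℝ (K.1 : Set Plane)) <;> simp [h]
  map_smul' c p := by
    ext x
    simp only [Finset.sum_apply, Pi.smul_apply, RingHom.id_apply, smul_eq_mul, Finset.mul_sum]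
    refine Finset.sum_congr rfl fun K _ => ?_
    by_cases h : x ∈ interior (convexHull ℝ (K.1 : Set Plane)) <;> simp [h]

instance (P : Polygon) : IsFiniteMeasure (volume.restrict P.carrier) :=
  ⟨by simpa using P.isBounded.measure_lt_top⟩

theorem memLp_toFun (T : Mesh P) (p : Broken T) :
    MemLp (toFun T p) 2 (volume.restrict P.carrier) := by
  refine memLp_finsetSum' _ fun K _ => ?_
  have hc : IsCompact (convexHull ℝ (K.1 : Set Plane)) := K.1.finite_toSet.isCompact_convexHull ℝ
  obtain ⟨C, hC⟩ := hc.exists_bound_of_continuousOn (continuous_evalAt (p K)).continuousOn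
  refine MemLp.of_bound ((continuous_evalAt (p K)).aestronglyMeasurable.indicator
    isOpen_interior.measurableSet) (max C 0) (ae_of_all _ fun x => ?_)
  by_cases h : x ∈ interior (convexHull ℝ (K.1 : Set Plane))
  · simpa [h] using Or.inl (hC x (interior_subset h))
  · simp [h]

/-- The elementwise partial derivative. -/
def pd (T : Mesh P) (i : Fin 2) : Broken T →ₗ[ℝ] Broken T :=
  LinearMap.pi fun K => (MvPolynomial.pderiv i).toLinearMap ∘ₗ LinearMap.proj K

/-- `curl φ = (∂_y φ, -∂_x φ)`. -/
def curl (T : Mesh P) : Broken T →ₗ[ℝ] (Fin 2 → Broken T) :=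
  LinearMap.pi ![pd T 1, -pd T 0]

/-- `div v = ∂_x v₁ + ∂_y v₂`. -/
def dive (T : Mesh P) : (Fin 2 → Broken T) →ₗ[ℝ] Broken T :=
  ∑ i, pd T i ∘ₗ LinearMap.proj i

/-- The `L²(Ω)` inner product `(p, q)`. -/
def l2 (T : Mesh P) (p q : Broken T) : ℝ := ∫ x in P.carrier, toFun T p x * toFun T q x

/-- `a(u, v) = ν (∇u, ∇v)`. -/
def aForm (T : Mesh P) (ν : ℝ) (u v : Fin 2 → Broken T) : ℝ :=
  ν * ∑ j, ∑ i, l2 T (pd T i (u j)) (pd T i (v j))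

theorem l2_add (T : Mesh P) (p p' q : Broken T) : l2 T (p + p') q = l2 T p q + l2 T p' q := by
  simp only [l2, map_add, Pi.add_apply, add_mul]
  exact integral_add ((memLp_toFun T p).integrable_mul (memLp_toFun T q))
    ((memLp_toFun T p').integrable_mul (memLp_toFun T q))

theorem l2_smul (T : Mesh P) (c : ℝ) (p q : Broken T) : l2 T (c • p) q = c * l2 T p q := by
  simp only [l2, map_smul, Pi.smul_apply, smul_eq_mul, mul_assoc, integral_const_mul]

theorem l2_zero (T : Mesh P) (q : Broken T) : l2 T 0 q = 0 := by simp [l2]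

theorem aForm_add (T : Mesh P) (ν : ℝ) (u u' v : Fin 2 → Broken T) :
    aForm T ν (u + u') v = aForm T ν u v + aForm T ν u' v := by
  simp only [aForm, Pi.add_apply, map_add, l2_add, Finset.sum_add_distrib, mul_add]

theorem aForm_smul (T : Mesh P) (ν c : ℝ) (u v : Fin 2 → Broken T) :
    aForm T ν (c • u) v = c * aForm T ν u v := by
  simp only [aForm, Pi.smul_apply, map_smul, l2_smul, ← Finset.mul_sum]
  ring

theorem aForm_zero (T : Mesh P) (ν : ℝ) (v : Fin 2 → Broken T) : aForm T ν 0 v = 0 := by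
  simp [aForm, l2_zero]

/-! ### The finite element spaces -/

/-- Piecewise polynomials of total degree at most `d`. -/
def brokenPoly (T : Mesh P) (d : ℕ) : Submodule ℝ (Broken T) :=
  Submodule.pi Set.univ fun _ => MvPolynomial.restrictTotalDegree (Fin 2) ℝ d

/-- The derivative `∂_{i₁} ⋯ ∂_{i_r} p` for a list `[i₁, …, i_r]` of directions. -/
def iterPd (l : List (Fin 2)) : Poly →ₗ[ℝ] Poly :=
  l.foldr (fun i D => (MvPolynomial.pderiv i).toLinearMap ∘ₗ D) LinearMap.id

/-- Piecewise polynomials that are `C^r` at noncorner vertices: at each such vertex `a`, the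
derivatives of order at most `r` of the restrictions to the elements that share `a` coincide. -/
def smoothAtNoncorner (T : Mesh P) (r : ℕ) : Submodule ℝ (Broken T) where
  carrier := {p | ∀ a, ¬ P.IsCorner a → ∀ K L : T.elems, a ∈ K.1 → a ∈ L.1 →
    ∀ l : List (Fin 2), l.length ≤ r → evalAt a (iterPd l (p K)) = evalAt a (iterPd l (p L))}
  zero_mem' := by
    intro a _ K L _ _ l _
    simp
  add_mem' := by
    intro p q hp hq a ha K L hK hL l hl
    simp [hp a ha K L hK hL l hl, hq a ha K L hK hL l hl]
  smul_mem' := by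
    intro c p hp a ha K L hK hL l hl
    simp [hp a ha K L hK hL l hl]

/-- `Σ₀`: piecewise polynomials of degree `k + 1` in `H²₀(Ω)`, `C²` at noncorner vertices. -/
def Sigma0 (T : Mesh P) (k : ℕ) : Submodule ℝ (Broken T) :=
  brokenPoly T (k + 1) ⊓ (sobolevZero P.carrier 2).comap (toFun T) ⊓ smoothAtNoncorner T 2

/-- `V`: piecewise polynomials of degree `k` in `H¹(Ω)`, `C¹` at noncorner vertices. -/
def VScalar (T : Mesh P) (k : ℕ) : Submodule ℝ (Broken T) :=
  brokenPoly T k ⊓ (sobolev P.carrier 1).comap (toFun T) ⊓ smoothAtNoncorner T 1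

/-- `𝐕₀ = V₀ × V₀` with `V₀ = V ∩ H¹₀(Ω)`. -/
def V0 (T : Mesh P) (k : ℕ) : Submodule ℝ (Fin 2 → Broken T) :=
  Submodule.pi Set.univ fun _ => VScalar T k ⊓ (sobolevZero P.carrier 1).comap (toFun T)

/-- `Q`: piecewise polynomials of degree `k - 1` in `L²(Ω)`, `C⁰` at noncorner vertices. -/
def QFull (T : Mesh P) (k : ℕ) : Submodule ℝ (Broken T) :=
  brokenPoly T (k - 1) ⊓ (sobolev P.carrier 0).comap (toFun T) ⊓ smoothAtNoncorner T 0

/-- `∫_S q dx` for a measurable set `S` contained in the closure of `Ω` (whose boundary is null). -/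
def integralOn (T : Mesh P) (S : Set Plane) (q : Broken T) : ℝ :=
  ∫ x in S ∩ P.carrier, toFun T q x

theorem integralOn_add (T : Mesh P) (S : Set Plane) (p q : Broken T) :
    integralOn T S (p + q) = integralOn T S p + integralOn T S q := by
  have h (p : Broken T) : Integrable (toFun T p) (volume.restrict (S ∩ P.carrier)) :=
    ((memLp_toFun T p).integrable (by norm_num)).mono_measure
      (Measure.restrict_mono Set.inter_subset_right le_rfl)
  simp only [integralOn, map_add, Pi.add_apply]
  exact integral_add (h p) (h q)

theorem integralOn_smul (T : Mesh P) (S : Set Plane) (c : ℝ) (p : Broken T) :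
    integralOn T S (c • p) = c * integralOn T S p := by
  simp only [integralOn, map_smul, Pi.smul_apply, smul_eq_mul, integral_const_mul]

theorem integralOn_zero (T : Mesh P) (S : Set Plane) : integralOn T S (0 : Broken T) = 0 := by
  simp [integralOn]

/-- `Q₀ = Q ∩ L²₀(Ω)`. -/
def Q0 (T : Mesh P) (k : ℕ) : Submodule ℝ (Broken T) where
  carrier := {q | q ∈ QFull T k ∧ integralOn T P.carrier q = 0}
  zero_mem' := ⟨zero_mem _, integralOn_zero T _⟩
  add_mem' := fun hp hq => ⟨add_mem hp.1 hq.1, by rw [integralOn_add, hp.2, hq.2, add_zero]⟩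
  smul_mem' := fun c _ hp => ⟨Submodule.smul_mem _ c hp.1, by rw [integralOn_smul, hp.2, mul_zero]⟩

/-! ### Interior spaces -/

/-- `Σ_I`: the functions of `Σ₀` with `φ = ∂ₙφ = 0` on `∂K` for every element `K`. -/
def SigmaI (T : Mesh P) (k : ℕ) : Submodule ℝ (Broken T) where
  carrier := {φ | φ ∈ Sigma0 T k ∧ ∀ K : T.elems, ∀ b ∈ K.1, ∀ c ∈ K.1, b ≠ c →
    ∀ x ∈ segment ℝ b c, evalAt x (φ K) = 0 ∧
      ∀ n : Plane, inner ℝ n (c - b) = 0 → ∑ i, n i * evalAt x (pd T i φ K) = 0}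
  zero_mem' := ⟨zero_mem _, by simp⟩
  add_mem' := by
    intro φ ψ hφ hψ
    refine ⟨add_mem hφ.1 hψ.1, fun K b hb c hc hbc x hx => ?_⟩
    obtain ⟨h1, h2⟩ := hφ.2 K b hb c hc hbc x hx
    obtain ⟨h3, h4⟩ := hψ.2 K b hb c hc hbc x hx
    refine ⟨by simp [h1, h3], fun n hn => ?_⟩
    simp only [map_add, Pi.add_apply, evalAt_add, mul_add, Finset.sum_add_distrib, h2 n hn, h4 n hn,
      add_zero]
  smul_mem' := by
    intro r φ hφ
    refine ⟨Submodule.smul_mem _ r hφ.1, fun K b hb c hc hbc x hx => ?_⟩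
    obtain ⟨h1, h2⟩ := hφ.2 K b hb c hc hbc x hx
    refine ⟨by simp [h1], fun n hn => ?_⟩
    simp only [map_smul, Pi.smul_apply, evalAt_smul, mul_left_comm _ r, ← Finset.mul_sum, h2 n hn,
      mul_zero]

/-- `𝐕_I`: the functions of `𝐕₀` with `v = 0` on `∂K` for every element `K`. -/
def VI (T : Mesh P) (k : ℕ) : Submodule ℝ (Fin 2 → Broken T) where
  carrier := {v | v ∈ V0 T k ∧ ∀ K : T.elems, ∀ b ∈ K.1, ∀ c ∈ K.1, b ≠ c →
    ∀ x ∈ segment ℝ b c, ∀ j, evalAt x (v j K) = 0}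
  zero_mem' := ⟨zero_mem _, by simp⟩
  add_mem' := by
    intro v w hv hw
    refine ⟨add_mem hv.1 hw.1, fun K b hb c hc hbc x hx j => ?_⟩
    simp [hv.2 K b hb c hc hbc x hx j, hw.2 K b hb c hc hbc x hx j]
  smul_mem' := by
    intro r v hv
    refine ⟨Submodule.smul_mem _ r hv.1, fun K b hb c hc hbc x hx j => ?_⟩
    simp [hv.2 K b hb c hc hbc x hx j]

/-- `Q_I`: the functions of `Q₀` with `∫_K q = 0` and `q|_K(a) = 0` at the vertices `a` of `K`, for
every element `K`. -/
def QI (T : Mesh P) (k : ℕ) : Submodule ℝ (Broken T) where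
  carrier := {q | q ∈ Q0 T k ∧ ∀ K : T.elems,
    integralOn T (convexHull ℝ (K.1 : Set Plane)) q = 0 ∧ ∀ a ∈ K.1, evalAt a (q K) = 0}
  zero_mem' := ⟨zero_mem _, fun K => ⟨integralOn_zero T _, by simp⟩⟩
  add_mem' := by
    intro p q hp hq
    refine ⟨add_mem hp.1 hq.1, fun K => ⟨?_, fun a ha => ?_⟩⟩
    · rw [integralOn_add, (hp.2 K).1, (hq.2 K).1, add_zero]
    · simp [(hp.2 K).2 a ha, (hq.2 K).2 a ha]
  smul_mem' := by
    intro r p hp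
    refine ⟨Submodule.smul_mem _ r hp.1, fun K => ⟨?_, fun a ha => ?_⟩⟩
    · rw [integralOn_smul, (hp.2 K).1, mul_zero]
    · simp [(hp.2 K).2 a ha]

/-! ### Exterior spaces -/

/-- `Σ̃_E = {φ ∈ Σ₀ : a(curl φ, curl ψ) = 0 for all ψ ∈ Σ_I}`. -/
def SigmaE (T : Mesh P) (ν : ℝ) (k : ℕ) : Submodule ℝ (Broken T) where
  carrier := {φ | φ ∈ Sigma0 T k ∧ ∀ ψ ∈ SigmaI T k, aForm T ν (curl T φ) (curl T ψ) = 0}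
  zero_mem' := ⟨zero_mem _, fun ψ _ => by rw [map_zero, aForm_zero]⟩
  add_mem' := fun h h' => ⟨add_mem h.1 h'.1, fun ψ hψ => by
    rw [map_add, aForm_add, h.2 ψ hψ, h'.2 ψ hψ, add_zero]⟩
  smul_mem' := fun c _ h => ⟨Submodule.smul_mem _ c h.1, fun ψ hψ => by
    rw [map_smul, aForm_smul, h.2 ψ hψ, mul_zero]⟩

/-- `Q̃_E = {q ∈ Q₀ : (q, r) = 0 for all r ∈ Q_I}`. -/
def QE (T : Mesh P) (k : ℕ) : Submodule ℝ (Broken T) where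
  carrier := {q | q ∈ Q0 T k ∧ ∀ r ∈ QI T k, l2 T q r = 0}
  zero_mem' := ⟨zero_mem _, fun r _ => l2_zero T r⟩
  add_mem' := fun h h' => ⟨add_mem h.1 h'.1, fun r hr => by
    rw [l2_add, h.2 r hr, h'.2 r hr, add_zero]⟩
  smul_mem' := fun c _ h => ⟨Submodule.smul_mem _ c h.1, fun r hr => by
    rw [l2_smul, h.2 r hr, mul_zero]⟩

/-- `𝐕̃_E = {v ∈ 𝐕₀ : div v ∈ Q̃_E, a(v, curl ψ) = 0 for all ψ ∈ Σ_I}`. -/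
def VE (T : Mesh P) (ν : ℝ) (k : ℕ) : Submodule ℝ (Fin 2 → Broken T) where
  carrier := {v | v ∈ V0 T k ∧ dive T v ∈ QE T k ∧ ∀ ψ ∈ SigmaI T k, aForm T ν v (curl T ψ) = 0}
  zero_mem' := ⟨zero_mem _, by rw [map_zero]; exact zero_mem _, fun ψ _ => aForm_zero T ν _⟩
  add_mem' := fun h h' => ⟨add_mem h.1 h'.1, by rw [map_add]; exact add_mem h.2.1 h'.2.1,
    fun ψ hψ => by rw [aForm_add, h.2.2 ψ hψ, h'.2.2 ψ hψ, add_zero]⟩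
  smul_mem' := fun c _ h => ⟨Submodule.smul_mem _ c h.1,
    by rw [map_smul]; exact Submodule.smul_mem _ c h.2.1,
    fun ψ hψ => by rw [aForm_smul, h.2.2 ψ hψ, mul_zero]⟩

/-! ### Rows and columns of the complex -/

/-- `curl` maps `S` to `W`, `div` maps `W` to `R`, and `0 → S → W → R → 0` is exact. -/
def IsExactRow (T : Mesh P) (S : Submodule ℝ (Broken T)) (W : Submodule ℝ (Fin 2 → Broken T))
    (R : Submodule ℝ (Broken T)) : Prop :=
  ∃ (hc : ∀ φ ∈ S, curl T φ ∈ W) (hd : ∀ v ∈ W, dive T v ∈ R),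
    Function.Injective ((curl T).restrict hc) ∧
    Function.Exact ((curl T).restrict hc) ((dive T).restrict hd) ∧
    Function.Surjective ((dive T).restrict hd)

/-- `X` is the internal direct sum of its subspaces `Y` and `Z`. -/
def IsDirectSum {E : Type*} [AddCommGroup E] [Module ℝ E] (X Y Z : Submodule ℝ E) : Prop :=
  Y ⊔ Z = X ∧ Y ⊓ Z = ⊥

end StokesFE

end

/-! For piecewise polynomials the Sobolev conditions are pointwise conditions: membership in H¹₀(Ω)
means that the pieces agree on common points and vanish on Γ (`IsConf`), and membership in H²₀(Ω)
means this for the function and its gradient (`memSobolevZero_one_iff`, `memSobolevZero_two_iff`).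
In one direction the function is cut off near Γ and mollified; the derivatives of the cut-off stay
bounded because the function is O(dist) or O(dist²) at Γ. In the other direction the extension by
zero has bounded weak derivatives on the plane, hence is Lipschitz, and comparing values across
edges and across Γ gives conformity.

A conforming function with zero gradient vanishes, so curl is injective. A divergence-free field in
𝐕₀, extended by zero, is Lipschitz and weakly divergence-free on the plane, so it has a global C¹
potential. This is polynomial on each element, and constant on Γ because Γ is a single closed curve;
subtracting the constant gives an element of Σ₀ (`exists_isConf_curl_eq`). If the field vanishes on
all edges, its potential is constant on the connected skeleton of the mesh, hence lies in Σ_I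
(`mem_SigmaI_of_curl_mem_VI`).

The divergence maps 𝐕₀ onto Q₀ by three successive corrections (`exists_dive_eq`). Vertex values: at
a noncorner vertex the boundary edges are aligned, and an affine function vanishing on them times
λ_a² does the job; at a corner the fields λ_b λ_a² suffice, since by duality a functional
annihilating their divergences would force all edges at the corner onto two lines
(`isSingular_of_annihilator`). Element means: fields λ_a² λ_b² on interior edges, of degree four,
move mean value between neighbours without touching vertex values, and the mesh is connected
(`exists_element_means`). The remainder lies in Q_I, where bubble fields suffice: modulo divergences
of bubbles all Bernstein monomials other than pure powers are proportional, and the mean value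
detects the one remaining dimension (`IsBarycentric.exists_bubble`).

The splittings of Σ₀ and Q₀ are orthogonal decompositions for definite forms on finite-dimensional
subspaces. In 𝐕₀ the splitting combines both: the Q_I part of div v is lifted to 𝐕_I, and what
remains is corrected by a curl from Σ_I (`isDirectSum_V`). The exterior row follows from the full
one by discarding interior components. -/

noncomputable section

namespace StokesFE

/-! ### Mollification on the plane. -/

section

/-! ### Convolution with test functions -/

/-- The convolution `χ * f` on the plane. -/
def conv (χ f : Plane → ℝ) : Plane → ℝ :=
  convolution f χ (ContinuousLinearMap.lsmul ℝ ℝ) volume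

theorem conv_apply_swap (χ f : Plane → ℝ) (x : Plane) : conv χ f x = ∫ z, χ (x - z) * f z := by
  rw [conv, convolution_def]
  simp only [ContinuousLinearMap.lsmul_apply, smul_eq_mul, mul_comm]

theorem conv_apply (χ f : Plane → ℝ) (x : Plane) : conv χ f x = ∫ t, χ t * f (x - t) := by
  rw [conv, convolution_eq_swap]
  simp only [ContinuousLinearMap.lsmul_apply, smul_eq_mul, mul_comm]

theorem IsTest.contDiff_conv {χ f : Plane → ℝ} (hχ : IsTest Set.univ χ)
    (hf : LocallyIntegrable f) : ContDiff ℝ ∞ (conv χ f) :=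
  hχ.compact.contDiff_convolution_right _ hf hχ.smooth

theorem IsTest.partialDeriv_conv {χ f : Plane → ℝ} (hχ : IsTest Set.univ χ)
    (hf : LocallyIntegrable f) (i : Fin 2) :
    StokesFE.partialDeriv i (conv χ f) = conv (StokesFE.partialDeriv i χ) f := by
  ext x
  have h : HasFDerivAt (conv χ f) _ x := hχ.compact.hasFDerivAt_convolution_right
    (ContinuousLinearMap.lsmul ℝ ℝ) hf (hχ.smooth.of_le (by simp)) x
  rw [StokesFE.partialDeriv, h.fderiv, convolution_precompR_apply _ hf (hχ.compact.fderiv ℝ)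
    (hχ.smooth.continuous_fderiv (by simp))]
  rfl

theorem IsTest.reflect {χ : Plane → ℝ} (hχ : IsTest Set.univ χ) (x : Plane) :
    IsTest Set.univ fun z => χ (x - z) where
  smooth := hχ.smooth.comp (contDiff_const.sub contDiff_id)
  compact := by
    have := hχ.compact.comp_homeomorph (Homeomorph.subLeft x)
    exact this
  supp := Set.subset_univ _

theorem partialDeriv_reflect {χ : Plane → ℝ} (hχ : IsTest Set.univ χ) (x z : Plane) (i : Fin 2) :
    partialDeriv i (fun z => χ (x - z)) z = -partialDeriv i χ (x - z) := by
  have h1 : HasFDerivAt χ (fderiv ℝ χ (x - z)) (x - z) :=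
    (hχ.smooth.differentiable (by simp) _).hasFDerivAt
  have h2 : HasFDerivAt (fun z : Plane => x - z) (-ContinuousLinearMap.id ℝ Plane) z :=
    (hasFDerivAt_id z).const_sub x
  have h3 := h1.comp z h2
  have h4 : HasFDerivAt (fun z => χ (x - z)) _ z := h3
  rw [partialDeriv, h4.fderiv]
  simp [partialDeriv]

/-- Derivatives may be moved from the kernel to the function. -/
theorem HasWeakPartial.conv_partialDeriv {χ f g : Plane → ℝ} {i : Fin 2}
    (h : HasWeakPartial Set.univ i f g) (hχ : IsTest Set.univ χ) :
    conv (partialDeriv i χ) f = conv χ g := by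
  ext x
  have := h _ (hχ.reflect x)
  simp only [Measure.restrict_univ, partialDeriv_reflect hχ, mul_neg, integral_neg, neg_inj] at this
  rw [conv_apply_swap, conv_apply_swap]
  simpa only [mul_comm] using this

/-! ### Mollifiers -/

/-- A fixed bump function on the unit ball. -/
def baseBump : ContDiffBump (0 : Plane) := ⟨1 / 2, 1, by norm_num, by norm_num⟩

/-- The standard mollifier on the unit ball. -/
def baseMollifier : Plane → ℝ := baseBump.normed volume

theorem isTest_baseMollifier : IsTest Set.univ baseMollifier where
  smooth := baseBump.contDiff_normed
  compact := baseBump.hasCompactSupport_normed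
  supp := Set.subset_univ _

/-- The mollifier on the ball of radius `ε`. -/
def mollifier (ε : ℝ) : Plane → ℝ := fun x => (ε ^ 2)⁻¹ * baseMollifier (ε⁻¹ • x)

/-- The iterated partial derivative along a list of directions. -/
def iterPartial (l : List (Fin 2)) (u : Plane → ℝ) : Plane → ℝ := l.foldr partialDeriv u

theorem IsTest.iterPartial {Ω : Set Plane} {ψ : Plane → ℝ} (h : IsTest Ω ψ) (l : List (Fin 2)) :
    IsTest Ω (iterPartial l ψ) := by
  induction l with
  | nil => exact h
  | cons i l ih => exact IsTest.partialDeriv ih i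

theorem IsTest.iterPartial_conv {χ f : Plane → ℝ} (hχ : IsTest Set.univ χ)
    (hf : LocallyIntegrable f) (l : List (Fin 2)) :
    StokesFE.iterPartial l (conv χ f) = conv (StokesFE.iterPartial l χ) f := by
  induction l with
  | nil => rfl
  | cons i l ih =>
    change StokesFE.partialDeriv i (StokesFE.iterPartial l _) = _
    rw [ih, (hχ.iterPartial l).partialDeriv_conv hf]
    rfl

theorem iterPartial_mollifier (l : List (Fin 2)) (ε : ℝ) :
    iterPartial l (mollifier ε) =
      fun x => ((ε ^ 2)⁻¹ * ε⁻¹ ^ l.length) * iterPartial l baseMollifier (ε⁻¹ • x) := by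
  induction l with
  | nil => ext x; simp [iterPartial, mollifier]
  | cons i l ih =>
    change partialDeriv i (iterPartial l _) = _
    rw [ih]
    ext x
    have h1 : HasFDerivAt (iterPartial l baseMollifier)
        (fderiv ℝ (iterPartial l baseMollifier) (ε⁻¹ • x)) (ε⁻¹ • x) :=
      ((isTest_baseMollifier.iterPartial l).smooth.differentiable (by simp) _).hasFDerivAt
    have h2 : HasFDerivAt (fun x : Plane => ε⁻¹ • x) (ε⁻¹ • ContinuousLinearMap.id ℝ Plane) x :=
      (hasFDerivAt_id x).const_smul ε⁻¹
    have h3 := (h1.comp x h2).const_mul ((ε ^ 2)⁻¹ * ε⁻¹ ^ l.length)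
    have h4 : HasFDerivAt (fun x => ((ε ^ 2)⁻¹ * ε⁻¹ ^ l.length) *
      iterPartial l baseMollifier (ε⁻¹ • x)) _ x := h3
    rw [partialDeriv, h4.fderiv]
    change _ = (ε ^ 2)⁻¹ * ε⁻¹ ^ (l.length + 1) *
      fderiv ℝ (iterPartial l baseMollifier) (ε⁻¹ • x) (EuclideanSpace.single i 1)
    simp
    ring

theorem isTest_mollifier {ε : ℝ} (hε : 0 < ε) : IsTest Set.univ (mollifier ε) where
  smooth := contDiff_const.mul (isTest_baseMollifier.smooth.comp (contDiff_const_smul _))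
  compact := by
    have := isTest_baseMollifier.compact.comp_smul (inv_ne_zero hε.ne')
    exact this.mul_left (f := fun _ => (ε ^ 2)⁻¹)
  supp := Set.subset_univ _

theorem integral_mollifier {ε : ℝ} (hε : 0 < ε) : ∫ x, mollifier ε x = 1 := by
  simp only [mollifier, integral_const_mul]
  rw [Measure.integral_comp_inv_smul]
  simp [baseMollifier, baseBump.integral_normed, abs_of_pos hε, hε.ne']

theorem support_iterPartial_mollifier {ε : ℝ} (hε : 0 < ε) (l : List (Fin 2)) :
    Function.support (iterPartial l (mollifier ε)) ⊆ Metric.closedBall 0 ε := by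
  have h0 : tsupport (mollifier ε) ⊆ Metric.closedBall 0 ε := by
    refine closure_minimal (fun x hx => ?_) Metric.isClosed_closedBall
    have h1 : ε⁻¹ • x ∈ Function.support baseMollifier := by
      intro h
      apply hx
      simp [mollifier, h]
    rw [baseMollifier, baseBump.support_normed_eq, mem_ball_zero_iff, norm_smul, norm_inv,
      Real.norm_of_nonneg hε.le] at h1
    have h2 : ε⁻¹ * ‖x‖ < 1 := h1
    rw [mem_closedBall_zero_iff]
    rw [inv_mul_lt_iff₀ hε] at h2
    linarith
  have h1 : ∀ l : List (Fin 2), tsupport (iterPartial l (mollifier ε)) ⊆ tsupport (mollifier ε) := by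
    intro l
    induction l with
    | nil => exact subset_rfl
    | cons i l ih => exact (tsupport_fderiv_apply_subset ℝ _).trans ih
  exact (subset_tsupport _).trans ((h1 l).trans h0)

/-- The Jacobian ε² of the rescaling cancels the prefactor, and each derivative costs a factor ε⁻¹.
The decay of a function near the boundary has to compensate exactly this growth. -/
theorem integral_norm_iterPartial_mollifier {ε : ℝ} (hε : 0 < ε) (l : List (Fin 2)) :
    ∫ x, ‖iterPartial l (mollifier ε) x‖ =
      ε⁻¹ ^ l.length * ∫ x, ‖iterPartial l baseMollifier x‖ := by
  simp only [iterPartial_mollifier, norm_mul, integral_const_mul]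
  rw [Measure.integral_comp_inv_smul volume fun x => ‖iterPartial l baseMollifier x‖]
  have : Module.finrank ℝ Plane = 2 := by simp
  rw [this]
  simp [abs_of_pos hε]
  field_simp

/-- Estimate of the derivatives of a mollified function. -/
theorem abs_conv_iterPartial_mollifier_le {ε : ℝ} (hε : 0 < ε) (l : List (Fin 2)) {g : Plane → ℝ}
    {x : Plane} {B : ℝ}
    (h : ∀ y, dist y x ≤ ε → |g y| ≤ B) :
    |conv (iterPartial l (mollifier ε)) g x| ≤
      (∫ x, ‖iterPartial l baseMollifier x‖) * ε⁻¹ ^ l.length * B := by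
  have hi : Integrable (iterPartial l (mollifier ε)) :=
    ((isTest_mollifier hε).iterPartial l).smooth.continuous.integrable_of_hasCompactSupport
      ((isTest_mollifier hε).iterPartial l).compact
  rw [conv_apply, ← Real.norm_eq_abs, mul_comm (∫ x, _), ← integral_norm_iterPartial_mollifier hε,
    ← integral_mul_const]
  refine norm_integral_le_of_norm_le (hi.norm.mul_const B) (ae_of_all _ fun t => ?_)
  by_cases ht : t ∈ Function.support (iterPartial l (mollifier ε))
  · have := support_iterPartial_mollifier hε l ht
    rw [norm_mul]
    gcongr
    refine h _ ?_
    rw [mem_closedBall_zero_iff] at this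
    simpa [dist_eq_norm] using this
  · rw [Function.notMem_support] at ht
    simp [ht]

/-- Mollified functions are close to the original ones. -/
theorem abs_conv_mollifier_sub_le {ε : ℝ} (hε : 0 < ε) {g : Plane → ℝ}
    (hg : AEStronglyMeasurable g volume) {x : Plane} {B z : ℝ}
    (h : ∀ y, dist y x ≤ ε → |g y - z| ≤ B) :
    |conv (mollifier ε) g x - z| ≤ B := by
  -- The mollifier is nonnegative with integral one, so its L¹ norm is one and constants are
  -- reproduced.
  have h1 : |conv (mollifier ε) (fun y => g y - z) x| ≤ B := by
    have := abs_conv_iterPartial_mollifier_le hε [] (g := fun y => g y - z) h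
    have hn : ∫ x, ‖iterPartial [] baseMollifier x‖ = 1 := by
      have : ∀ x, ‖iterPartial [] baseMollifier x‖ = baseMollifier x := fun x =>
        Real.norm_of_nonneg (baseBump.nonneg_normed _)
      simp only [this]
      exact baseBump.integral_normed
    rw [hn, List.length_nil, pow_zero, one_mul, one_mul] at this
    exact this
  by_cases hInt : Integrable (fun t => mollifier ε t * g (x - t))
  · have hi : Integrable (mollifier ε) :=
      (isTest_mollifier hε).smooth.continuous.integrable_of_hasCompactSupport
        (isTest_mollifier hε).compact
    have e : conv (mollifier ε) (fun y => g y - z) x = conv (mollifier ε) g x - z := by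
      simp only [conv_apply, mul_sub]
      rw [integral_sub hInt (hi.mul_const z), integral_mul_const, integral_mollifier hε, one_mul]
    rwa [← e]
  -- Integrability is automatic: on the support of the kernel the shifted function is bounded by |z|
  -- + B.
  · exfalso
    apply hInt
    have hi : Integrable (mollifier ε) :=
      (isTest_mollifier hε).smooth.continuous.integrable_of_hasCompactSupport
        (isTest_mollifier hε).compact
    refine (hi.norm.mul_const (|z| + B)).mono'
      (hi.aestronglyMeasurable.mul (hg.comp_quasiMeasurePreserving
        (quasiMeasurePreserving_sub_left volume x))) (ae_of_all _ fun t => ?_)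
    by_cases ht : t ∈ Function.support (mollifier ε)
    · have := support_iterPartial_mollifier hε [] ht
      rw [norm_mul]
      gcongr
      have h2 := h (x - t) (by
        rw [mem_closedBall_zero_iff] at this
        simpa [dist_eq_norm] using this)
      rw [Real.norm_eq_abs]
      have := abs_add_le (g (x - t) - z) z
      rw [sub_add_cancel] at this
      linarith
    · rw [Function.notMem_support] at ht
      simp [ht]

theorem tendsto_conv_mollifier {g : Plane → ℝ} (hg : AEStronglyMeasurable g volume) {x : Plane}
    (h : ContinuousAt g x) {ε : ℕ → ℝ} (hε : ∀ n, 0 < ε n) (hε0 : Tendsto ε atTop (𝓝 0)) :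
    Tendsto (fun n => conv (mollifier (ε n)) g x) atTop (𝓝 (g x)) := by
  rw [Metric.tendsto_nhds]
  intro δ hδ
  obtain ⟨r, hr, hr'⟩ := Metric.continuousAt_iff.1 h (δ / 2) (by positivity)
  filter_upwards [hε0.eventually (gt_mem_nhds hr)] with n hn
  rw [Real.dist_eq]
  refine (abs_conv_mollifier_sub_le (hε n) hg (B := δ / 2) fun y hy => ?_).trans_lt
    (by linarith)
  rw [← Real.dist_eq]
  exact (hr' (hy.trans_lt hn)).le

/-! ### Convergence in `L²` -/

/-- Dominated convergence for |uₙ - f|², with the constant (2C)² as majorant on a set of finite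
measure. -/
theorem tendstoL2_of_bounded {Ω : Set Plane} (hΩ : volume Ω ≠ ⊤) {u : ℕ → Plane → ℝ}
    {f : Plane → ℝ} (hu : ∀ n, AEStronglyMeasurable (u n) (volume.restrict Ω))
    (hf : AEStronglyMeasurable f (volume.restrict Ω)) {C : ℝ} (huC : ∀ n x, |u n x| ≤ C)
    (hfC : ∀ x, |f x| ≤ C)
    (h : ∀ᵐ x ∂volume.restrict Ω, Tendsto (fun n => u n x) atTop (𝓝 (f x))) :
    TendstoL2 Ω u f := by
  have : IsFiniteMeasure (volume.restrict Ω) := ⟨by simpa using hΩ.lt_top⟩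
  refine ⟨MemLp.of_bound hf C (ae_of_all _ hfC), ?_⟩
  have h2 : ∀ n, eLpNorm (u n - f) 2 (volume.restrict Ω) =
      (∫⁻ x in Ω, ‖u n x - f x‖ₑ ^ (2 : ℝ)) ^ (1 / 2 : ℝ) := fun n => by
    rw [eLpNorm_eq_lintegral_rpow_enorm_toReal (by norm_num) (by norm_num)]
    simp
  simp only [h2]
  have h3 : Tendsto (fun n => ∫⁻ x in Ω, ‖u n x - f x‖ₑ ^ (2 : ℝ)) atTop
      (𝓝 (∫⁻ x in Ω, 0)) := by
    refine tendsto_lintegral_of_dominated_convergence' (fun _ => ENNReal.ofReal (2 * C) ^ (2 : ℝ))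
      (fun n => ((hu n).sub hf).enorm.pow_const _) (fun n => ae_of_all _ fun x => ?_) ?_ ?_
    · have : ‖u n x - f x‖ₑ ≤ ENNReal.ofReal (2 * C) := by
        rw [← ofReal_norm]
        refine ENNReal.ofReal_le_ofReal ((norm_sub_le _ _).trans ?_)
        rw [Real.norm_eq_abs, Real.norm_eq_abs]
        linarith [huC n x, hfC x]
      exact ENNReal.rpow_le_rpow this (by norm_num)
    · simp only [lintegral_const, Measure.restrict_apply_univ]
      exact ENNReal.mul_ne_top (ENNReal.rpow_ne_top_of_nonneg (by norm_num) ENNReal.ofReal_ne_top) hΩ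
    · filter_upwards [h] with x hx
      have h4 : Tendsto (fun n => ‖u n x - f x‖ₑ) atTop (𝓝 0) := by
        have := (hx.sub_const (f x)).enorm
        simpa using this
      have := (ENNReal.continuous_rpow_const (y := 2)).tendsto 0 |>.comp h4
      simpa [Function.comp_def] using this
  have := (ENNReal.continuous_rpow_const (y := 1 / 2)).tendsto _ |>.comp h3
  simpa [Function.comp_def] using this

end

/-! ### Approximation in H^m₀ by cut-off and mollification, and Lipschitz bounds from weak
derivatives. -/

section

/-! ### Approximation by test functions -/

theorem IsTest.conv_sub {χ f g : Plane → ℝ} (hχ : IsTest Set.univ χ) (hf : LocallyIntegrable f)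
    (hg : LocallyIntegrable g) : conv χ (f - g) = conv χ f - conv χ g := by
  ext x
  have h1 := hχ.compact.convolutionExists_right (ContinuousLinearMap.lsmul ℝ ℝ) hf
    hχ.smooth.continuous x
  have h2 := hχ.compact.convolutionExists_right (ContinuousLinearMap.lsmul ℝ ℝ) hg
    hχ.smooth.continuous x
  simp only [conv, convolution_def, Pi.sub_apply]
  rw [← integral_sub h1 h2]
  simp

/-- The function `f`, cut off near the complement of `Ω` and mollified. -/
def cutoffSeq (Ω : Set Plane) (f : Plane → ℝ) (n : ℕ) : Plane → ℝ :=
  conv (mollifier (1 / ((n : ℝ) + 1)))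
    ({x | 2 * (1 / ((n : ℝ) + 1)) ≤ Metric.infDist x Ωᶜ}.indicator f)

theorem locallyIntegrable_of_bounded {f : Plane → ℝ} (hf : AEStronglyMeasurable f volume) {C : ℝ}
    (h : ∀ x, |f x| ≤ C) : LocallyIntegrable f :=
  (locallyIntegrable_const C).mono hf (ae_of_all _ fun x => by
    simpa using (h x).trans (le_abs_self C))

theorem measurableSet_cutoff (Ω : Set Plane) (δ : ℝ) :
    MeasurableSet {x : Plane | δ ≤ Metric.infDist x Ωᶜ} :=
  (isClosed_le continuous_const (Metric.continuous_infDist_pt _)).measurableSet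

/-- The cut-off keeps only points at distance at least 2ε from the complement, and mollification
spreads the support by at most ε, so a margin of width ε remains. -/
theorem isTest_cutoffSeq {Ω : Set Plane} (hb : Bornology.IsBounded Ω)
    {f : Plane → ℝ} (hf : LocallyIntegrable f) (n : ℕ) : IsTest Ω (cutoffSeq Ω f n) := by
  set ε : ℝ := 1 / ((n : ℝ) + 1) with hε'
  have hε : 0 < ε := by positivity
  have hli : LocallyIntegrable ({x | 2 * ε ≤ Metric.infDist x Ωᶜ}.indicator f) :=
    hf.indicator (measurableSet_cutoff Ω _)
  have hsub : tsupport (cutoffSeq Ω f n) ⊆ {x | ε ≤ Metric.infDist x Ωᶜ} := by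
    refine closure_minimal (fun x hx => ?_)
      (isClosed_le continuous_const (Metric.continuous_infDist_pt _))
    by_contra hx'
    apply hx
    rw [Set.mem_ofPred_eq, not_le] at hx'
    have := abs_conv_iterPartial_mollifier_le hε []
      (g := {x | 2 * ε ≤ Metric.infDist x Ωᶜ}.indicator f) (x := x) (B := 0) (fun y hy => by
        rw [Set.indicator_of_notMem, abs_zero]
        rw [Set.mem_ofPred_eq, not_le]
        have := Metric.infDist_le_infDist_add_dist (s := Ωᶜ) (x := y) (y := x)
        linarith)
    rw [mul_zero] at this
    exact abs_nonpos_iff.1 this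
  have hsub2 : {x | ε ≤ Metric.infDist x Ωᶜ} ⊆ Ω := by
    intro x hx
    by_contra hx'
    rw [Set.mem_ofPred_eq, Metric.infDist_zero_of_mem (show x ∈ Ωᶜ from hx')] at hx
    linarith
  exact ⟨(isTest_mollifier hε).contDiff_conv hli,
    Metric.isCompact_of_isClosed_isBounded (isClosed_tsupport _) (hb.subset (hsub.trans hsub2)),
    hsub.trans hsub2⟩

/-- `hconv` makes g play the role of the derivative of f along l on the whole plane. The derivative
of the cut-off function is the mollification of g minus an error carried by the strip where the
distance to the complement is below 2ε. The error is at most A ε^(-|l|) C (2ε)^m, bounded since |l|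
≤ m, and vanishes at each fixed point of Ω once ε is small; dominated convergence concludes. -/
theorem tendstoL2_cutoffSeq {Ω : Set Plane} (hΩ : IsOpen Ω) (hb : Bornology.IsBounded Ω)
    {f g : Plane → ℝ} {B C : ℝ} (hC : 0 ≤ C) {m : ℕ} (hf : LocallyIntegrable f)
    (hfC : ∀ x, |f x| ≤ C * Metric.infDist x Ωᶜ ^ m) (hg : AEStronglyMeasurable g volume)
    (hgC : ∀ x, |g x| ≤ B) (hgc : ∀ᵐ x ∂volume.restrict Ω, ContinuousAt g x)
    {l : List (Fin 2)} (hl : l.length ≤ m)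
    (hconv : ∀ ε, 0 < ε → conv (iterPartial l (mollifier ε)) f = conv (mollifier ε) g) :
    TendstoL2 Ω (fun n => iterPartial l (cutoffSeq Ω f n)) g := by
  set ε : ℕ → ℝ := fun n => 1 / ((n : ℝ) + 1) with hε'
  have hε : ∀ n, 0 < ε n := fun n => by positivity
  have hε1 : ∀ n, ε n ≤ 1 := fun n => by
    rw [hε', div_le_one (by positivity)]
    linarith [(Nat.cast_nonneg n : (0 : ℝ) ≤ n)]
  have hε0 : Tendsto ε atTop (𝓝 0) := tendsto_one_div_add_atTop_nhds_zero_nat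
  have hli : ∀ n, LocallyIntegrable ({x | 2 * ε n ≤ Metric.infDist x Ωᶜ}.indicator f) := fun n =>
    hf.indicator (measurableSet_cutoff Ω _)
  have hli2 : ∀ n, LocallyIntegrable ({x | 2 * ε n ≤ Metric.infDist x Ωᶜ}ᶜ.indicator f) := fun n =>
    hf.indicator (measurableSet_cutoff Ω _).compl
  have key : ∀ n, iterPartial l (cutoffSeq Ω f n) = conv (mollifier (ε n)) g -
      conv (iterPartial l (mollifier (ε n))) ({x | 2 * ε n ≤ Metric.infDist x Ωᶜ}ᶜ.indicator f) := by
    intro n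
    rw [cutoffSeq, (isTest_mollifier (hε n)).iterPartial_conv (hli n), ← hconv _ (hε n),
      ← ((isTest_mollifier (hε n)).iterPartial l).conv_sub hf (hli2 n)]
    congr 1
    rw [Set.indicator_compl, sub_sub_cancel]
  set A := ∫ x, ‖iterPartial l baseMollifier x‖ with hA
  have hA0 : 0 ≤ A := integral_nonneg fun _ => norm_nonneg _
  refine tendstoL2_of_bounded (C := B + A * (C * 2 ^ m)) hb.measure_lt_top.ne (fun n => ?_)
    hg.restrict (fun n x => ?_) (fun x => ?_) ?_
  · exact ((isTest_cutoffSeq hb hf n).iterPartial l).smooth.continuous.aestronglyMeasurable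
  · rw [key]
    refine (abs_sub _ _).trans (add_le_add ?_ ?_)
    · have := abs_conv_mollifier_sub_le (hε n) hg (x := x) (z := 0) (B := B)
        (fun y _ => by simpa using hgC y)
      simpa using this
    · refine (abs_conv_iterPartial_mollifier_le (hε n) l (B := C * (2 * ε n) ^ m)
        (fun y _ => ?_)).trans ?_
      · by_cases hy : y ∈ {x | 2 * ε n ≤ Metric.infDist x Ωᶜ}ᶜ
        · rw [Set.indicator_of_mem hy]
          rw [Set.mem_compl_iff, Set.mem_ofPred_eq, not_le] at hy
          refine (hfC y).trans ?_
          gcongr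
          exact Metric.infDist_nonneg
        · rw [Set.indicator_of_notMem hy, abs_zero]
          have := (hε n).le
          positivity
      · rw [mul_assoc]
        refine mul_le_mul_of_nonneg_left ?_ hA0
        obtain ⟨s, rfl⟩ := Nat.exists_eq_add_of_le hl
        have e : (ε n)⁻¹ ^ l.length * (C * (2 * ε n) ^ (l.length + s)) =
            C * 2 ^ (l.length + s) * ε n ^ s := by
          rw [mul_pow, pow_add (ε n), inv_pow]
          have := (hε n).ne'
          field_simp
        rw [e]
        have : ε n ^ s ≤ 1 := pow_le_one₀ (hε n).le (hε1 n)
        have h2 : 0 ≤ C * 2 ^ (l.length + s) := by positivity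
        nlinarith
  · have : 0 ≤ A * (C * 2 ^ m) := by positivity
    linarith [hgC x]
  · filter_upwards [hgc, ae_restrict_mem hΩ.measurableSet] with x hx hxΩ
    have hd : 0 < Metric.infDist x Ωᶜ := by
      have hne : (Ωᶜ).Nonempty := by
        by_contra h
        rw [Set.not_nonempty_iff_eq_empty, Set.compl_empty_iff] at h
        rw [h] at hb
        exact NormedSpace.unbounded_univ ℝ Plane hb
      exact (hΩ.isClosed_compl.notMem_iff_infDist_pos hne).1 (by simpa using hxΩ)
    refine (tendsto_conv_mollifier hg hx hε hε0).congr' ?_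
    -- If 3ε is below the distance of x to the complement, the whole ball of radius ε around x has
    -- distance at least 2ε and misses the strip.
    filter_upwards [hε0.eventually (gt_mem_nhds (show 0 < Metric.infDist x Ωᶜ / 3 by positivity))]
      with n hn
    rw [key]
    have := abs_conv_iterPartial_mollifier_le (hε n) l (x := x) (B := 0)
      (g := {x | 2 * ε n ≤ Metric.infDist x Ωᶜ}ᶜ.indicator f) (fun y hy => by
        rw [Set.indicator_of_notMem, abs_zero]
        rw [Set.mem_compl_iff, not_not, Set.mem_ofPred_eq]
        have := Metric.infDist_le_infDist_add_dist (s := Ωᶜ) (x := x) (y := y)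
        rw [dist_comm] at this
        linarith)
    rw [mul_zero] at this
    rw [Pi.sub_apply, abs_nonpos_iff.1 this, sub_zero]

theorem HasWeakPartial.mono {Ω Ω' : Set Plane} (hΩ : Ω ⊆ Ω') {i : Fin 2} {f g : Plane → ℝ}
    (h : HasWeakPartial Ω' i f g) : HasWeakPartial Ω i f g := by
  intro ψ hψ
  have hψ' : IsTest Ω' ψ := ⟨hψ.smooth, hψ.compact, hψ.supp.trans hΩ⟩
  have e : ∀ {Ω : Set Plane}, IsTest Ω ψ → ∀ f : Plane → ℝ, ∫ x in Ω, f x * ψ x = ∫ x, f x * ψ x := by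
    intro Ω hψ f
    refine setIntegral_eq_integral_of_forall_compl_eq_zero fun x hx => ?_
    rw [image_eq_zero_of_notMem_tsupport fun h => hx (hψ.supp h), mul_zero]
  have e' : ∀ {Ω : Set Plane}, IsTest Ω ψ → ∀ f : Plane → ℝ,
      ∫ x in Ω, f x * StokesFE.partialDeriv i ψ x = ∫ x, f x * StokesFE.partialDeriv i ψ x := by
    intro Ω hψ f
    refine setIntegral_eq_integral_of_forall_compl_eq_zero fun x hx => ?_
    rw [image_eq_zero_of_notMem_tsupport fun h => hx ((hψ.partialDeriv i).supp h), mul_zero]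
  have := h ψ hψ'
  rwa [e hψ', e' hψ', ← e hψ, ← e' hψ] at this

theorem HasWeakPartial.congr_ae {Ω : Set Plane} {i : Fin 2} {f f' g g' : Plane → ℝ}
    (h : HasWeakPartial Ω i f g) (hf : f =ᵐ[volume.restrict Ω] f')
    (hg : g =ᵐ[volume.restrict Ω] g') : HasWeakPartial Ω i f' g' := by
  intro ψ hψ
  have e1 : ∫ x in Ω, f' x * StokesFE.partialDeriv i ψ x =
      ∫ x in Ω, f x * StokesFE.partialDeriv i ψ x :=
    integral_congr_ae (by filter_upwards [hf] with x hx; rw [hx])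
  have e2 : ∫ x in Ω, g' x * ψ x = ∫ x in Ω, g x * ψ x :=
    integral_congr_ae (by filter_upwards [hg] with x hx; rw [hx])
  rw [e1, e2, h ψ hψ]

theorem IsTest.lipschitz {Ω : Set Plane} {ψ : Plane → ℝ} (hψ : IsTest Ω ψ) :
    ∃ C, LipschitzWith C ψ :=
  ContDiff.lipschitzWith_of_hasCompactSupport hψ.compact hψ.smooth (by simp)

/-- Integration by parts for Lipschitz functions against compactly supported ones. It makes the line
derivative, although defined everywhere with default value zero, the weak derivative. -/
theorem lipschitz_hasWeakPartial {F : Plane → ℝ} {C : NNReal} (hF : LipschitzWith C F) (i : Fin 2) :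
    HasWeakPartial Set.univ i F fun x => lineDeriv ℝ F x (EuclideanSpace.single i 1) := by
  intro ψ hψ
  obtain ⟨D, hD⟩ := hψ.lipschitz
  have := hF.integral_lineDeriv_mul_eq (μ := volume) hD hψ.compact (EuclideanSpace.single i 1)
  simp only [Measure.restrict_univ]
  rw [this, ← integral_neg]
  refine integral_congr_ae (ae_of_all _ fun x => ?_)
  have h2 : lineDeriv ℝ ψ x (-EuclideanSpace.single i 1) = -StokesFE.partialDeriv i ψ x := by
    rw [(hψ.smooth.differentiable (by simp) x).lineDeriv_eq_fderiv, map_neg]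
    rfl
  simp only [h2]
  ring

/-- The mean value inequality for a mollified function. -/
theorem abs_conv_mollifier_sub_conv_le {f : Plane → ℝ} {g : Fin 2 → Plane → ℝ}
    (hf : LocallyIntegrable f) (hg : ∀ i, AEStronglyMeasurable (g i) volume)
    (h : ∀ i, HasWeakPartial Set.univ i f (g i)) {C ε : ℝ} (hε : 0 < ε) {s : Set Plane}
    (hs : Convex ℝ s) (hC : ∀ i, ∀ z ∈ s, ∀ w, dist w z ≤ ε → |g i w| ≤ C) {x y : Plane}
    (hx : x ∈ s) (hy : y ∈ s) :
    |conv (mollifier ε) f x - conv (mollifier ε) f y| ≤ 2 * C * ‖x - y‖ := by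
  have hd := (isTest_mollifier hε).contDiff_conv hf
  have hC0 : 0 ≤ C := (abs_nonneg _).trans (hC 0 x hx x (by simpa using hε.le))
  -- Each of the two partial derivatives of the mollified function is an average of `g i` over a
  -- ball of radius ε, hence at most C; two of them give the factor 2.
  have hb : ∀ z ∈ s, ‖fderiv ℝ (conv (mollifier ε) f) z‖ ≤ 2 * C := by
    intro z hz
    refine ContinuousLinearMap.opNorm_le_bound _ (by positivity) fun w => ?_
    have hw : w = ∑ i, w i • EuclideanSpace.single i (1 : ℝ) := by
      ext j; fin_cases j <;> simp
    have hd : ∀ i, |fderiv ℝ (conv (mollifier ε) f) z (EuclideanSpace.single i 1)| ≤ C := by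
      intro i
      change |partialDeriv i (conv (mollifier ε) f) z| ≤ C
      rw [(isTest_mollifier hε).partialDeriv_conv hf, (h i).conv_partialDeriv (isTest_mollifier hε)]
      have := abs_conv_mollifier_sub_le hε (hg i) (x := z) (z := 0) (B := C)
        (fun y hy => by simpa using hC i z hz y hy)
      simpa using this
    have hwi : ∀ i, |w i| ≤ ‖w‖ := fun i => EuclideanSpace.norm_eq w ▸ by
      refine Real.abs_le_sqrt ?_
      simp only [Real.norm_eq_abs, sq_abs]
      exact Finset.single_le_sum (f := fun i => w i ^ 2) (fun _ _ => sq_nonneg _)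
        (Finset.mem_univ i)
    conv_lhs => rw [hw]
    rw [map_sum]
    refine (norm_sum_le _ _).trans ?_
    rw [Fin.sum_univ_two]
    simp only [map_smul, smul_eq_mul, norm_mul, Real.norm_eq_abs]
    nlinarith [mul_le_mul (hwi 0) (hd 0) (abs_nonneg _) (norm_nonneg w),
      mul_le_mul (hwi 1) (hd 1) (abs_nonneg _) (norm_nonneg w)]
  have := Convex.norm_image_sub_le_of_norm_fderiv_le (𝕜 := ℝ)
    (fun z _ => hd.differentiable (by simp) z) hb hs hy hx
  simpa using this

/-- A bounded function with bounded weak derivatives is Lipschitz on its points of continuity. -/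
theorem abs_sub_le_of_hasWeakPartial {f : Plane → ℝ} {g : Fin 2 → Plane → ℝ}
    (hf : LocallyIntegrable f) (hg : ∀ i, AEStronglyMeasurable (g i) volume)
    (h : ∀ i, HasWeakPartial Set.univ i f (g i)) {C : ℝ} (hC : ∀ i w, |g i w| ≤ C) {x y : Plane}
    (hx : ContinuousAt f x) (hy : ContinuousAt f y) : |f x - f y| ≤ 2 * C * ‖x - y‖ := by
  have hε : ∀ n : ℕ, 0 < 1 / ((n : ℝ) + 1) := fun n => by positivity
  have h1 := tendsto_conv_mollifier hf.aestronglyMeasurable hx hε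
    tendsto_one_div_add_atTop_nhds_zero_nat
  have h2 := tendsto_conv_mollifier hf.aestronglyMeasurable hy hε
    tendsto_one_div_add_atTop_nhds_zero_nat
  exact le_of_tendsto (h1.sub h2).abs (Eventually.of_forall fun n =>
    abs_conv_mollifier_sub_conv_le hf hg h (hε n) convex_univ (fun i _ _ w _ => hC i w)
      (Set.mem_univ x) (Set.mem_univ y))

theorem tendsto_integral_mul_of_tendstoL2 {Ω : Set Plane} {u : ℕ → Plane → ℝ} {f w : Plane → ℝ}
    (h : TendstoL2 Ω u f) (hu : ∀ n, MemLp (u n) 2 (volume.restrict Ω))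
    (hw : MemLp w 2 (volume.restrict Ω)) :
    Tendsto (fun n => ∫ x in Ω, u n x * w x) atTop (𝓝 (∫ x in Ω, f x * w x)) := by
  have h2 := ENNReal.Tendsto.mul_const (b := eLpNorm w 2 (volume.restrict Ω)) h.2
    (Or.inr hw.eLpNorm_ne_top)
  rw [zero_mul] at h2
  have h3 : ∀ n, eLpNorm ((fun x => u n x * w x) - fun x => f x * w x) 1 (volume.restrict Ω) ≤
      eLpNorm (u n - f) 2 (volume.restrict Ω) * eLpNorm w 2 (volume.restrict Ω) := by
    intro n
    have e : ((fun x => u n x * w x) - fun x => f x * w x) = (u n - f) • w := by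
      ext x; simp [sub_mul]
    rw [e]
    exact eLpNorm_smul_le_mul_eLpNorm hw.1 ((hu n).sub h.1).1
  have hi : ∀ {v : Plane → ℝ}, MemLp v 2 (volume.restrict Ω) →
      Integrable (fun x => v x * w x) (volume.restrict Ω) := fun hv => hv.integrable_mul hw
  exact tendsto_integral_of_L1' (fun x => f x * w x) (hi h.1).aestronglyMeasurable
    (F := fun n x => u n x * w x) (Eventually.of_forall fun n => hi (hu n))
    (tendsto_of_tendsto_of_tendsto_of_le_of_le tendsto_const_nhds h2 (fun n => zero_le) h3)

theorem IsTest.integral_mul_partialDeriv {Ω Ω' : Set Plane} {u ψ : Plane → ℝ} (hu : IsTest Ω u)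
    (hψ : IsTest Ω' ψ) (i : Fin 2) :
    ∫ x, u x * StokesFE.partialDeriv i ψ x = -∫ x, StokesFE.partialDeriv i u x * ψ x := by
  refine integral_mul_fderiv_eq_neg_fderiv_mul_of_integrable ?_ ?_ ?_
    (fun x _ => hu.smooth.differentiable (by simp) x)
    (fun x _ => hψ.smooth.differentiable (by simp) x)
  · exact ((hu.partialDeriv i).smooth.continuous.mul hψ.smooth.continuous
      ).integrable_of_hasCompactSupport (hψ.compact.mul_left)
  · exact (hu.smooth.continuous.mul (hψ.partialDeriv i).smooth.continuous
      ).integrable_of_hasCompactSupport (hu.compact.mul_right)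
  · exact (hu.smooth.continuous.mul hψ.smooth.continuous
      ).integrable_of_hasCompactSupport (hu.compact.mul_right)

/-- The weak derivatives of a function in `H¹₀(Ω)`, extended by zero, are weak derivatives on the
whole plane. -/
theorem hasWeakPartial_univ_of_tendsto {Ω : Set Plane} {u : ℕ → Plane → ℝ} {f g : Plane → ℝ}
    {i : Fin 2} (hu : ∀ n, IsTest Ω (u n)) (hf : TendstoL2 Ω u f)
    (hg : TendstoL2 Ω (fun n => partialDeriv i (u n)) g) (hf0 : ∀ x ∉ Ω, f x = 0)
    (hg0 : ∀ x ∉ Ω, g x = 0) : HasWeakPartial Set.univ i f g := by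
  intro ψ hψ
  have hm : ∀ {w : Plane → ℝ}, IsTest Set.univ w → MemLp w 2 (volume.restrict Ω) := fun h =>
    (h.smooth.continuous.memLp_of_hasCompactSupport h.compact).restrict _
  have h1 := tendsto_integral_mul_of_tendstoL2 hf (fun n => (hu n).memLp) (hm (hψ.partialDeriv i))
  have h2 := tendsto_integral_mul_of_tendstoL2 hg (fun n => ((hu n).partialDeriv i).memLp) (hm hψ)
  have e : ∀ {v w : Plane → ℝ}, (∀ x ∉ Ω, v x = 0) → ∫ x in Ω, v x * w x = ∫ x, v x * w x := by
    intro v w hv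
    refine setIntegral_eq_integral_of_forall_compl_eq_zero fun x hx => ?_
    rw [hv x hx, zero_mul]
  have e0 : ∀ {v : Plane → ℝ}, IsTest Ω v → ∀ x ∉ Ω, v x = 0 := fun hv x hx =>
    image_eq_zero_of_notMem_tsupport fun h => hx (hv.supp h)
  simp only [e (e0 (hu _)), e (e0 ((hu _).partialDeriv i)), e hf0, e hg0] at h1 h2
  simp only [Measure.restrict_univ]
  refine tendsto_nhds_unique h1 (h2.neg.congr fun n => ?_)
  rw [(hu n).integral_mul_partialDeriv hψ]

end

/-! ### Barycentric coordinates and the combinatorics of a conforming mesh. -/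

section

variable {P : Polygon}

/-! ### Values of polynomials -/

@[simp] theorem evalAt_mul (x : Plane) (p q : Poly) : evalAt x (p * q) = evalAt x p * evalAt x q :=
  map_mul _ p q

@[simp] theorem evalAt_pow (x : Plane) (p : Poly) (n : ℕ) : evalAt x (p ^ n) = evalAt x p ^ n :=
  map_pow _ p n

@[simp] theorem evalAt_C (x : Plane) (c : ℝ) : evalAt x (MvPolynomial.C c) = c :=
  MvPolynomial.eval_C c

@[simp] theorem evalAt_X (x : Plane) (i : Fin 2) : evalAt x (MvPolynomial.X i) = x i :=
  MvPolynomial.eval_X i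

@[simp] theorem evalAt_one (x : Plane) : evalAt x 1 = 1 := map_one _

@[simp] theorem evalAt_neg (x : Plane) (p : Poly) : evalAt x (-p) = -evalAt x p := map_neg _ p

@[simp] theorem evalAt_sub (x : Plane) (p q : Poly) : evalAt x (p - q) = evalAt x p - evalAt x q :=
  map_sub _ p q

theorem evalAt_sum {ι : Type*} (s : Finset ι) (x : Plane) (p : ι → Poly) :
    evalAt x (∑ i ∈ s, p i) = ∑ i ∈ s, evalAt x (p i) := map_sum _ p s

theorem evalAt_ext {p q : Poly} (h : ∀ x, evalAt x p = evalAt x q) : p = q :=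
  MvPolynomial.funext fun x => h (WithLp.toLp 2 x)

/-- A polynomial that vanishes on a nonempty open set is zero. -/
theorem poly_eq_zero_of_isOpen {U : Set Plane} (hU : IsOpen U) (hne : U.Nonempty) {p : Poly}
    (h : ∀ x ∈ U, evalAt x p = 0) : p = 0 := by
  obtain ⟨x, hx⟩ := hne
  have hcont : Continuous fun y : Fin 2 → ℝ => (WithLp.toLp 2 y : Plane) :=
    PiLp.continuous_toLp 2 _
  have hU' : IsOpen ((fun y : Fin 2 → ℝ => (WithLp.toLp 2 y : Plane)) ⁻¹' U) := hU.preimage hcont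
  obtain ⟨r, hr, hball⟩ := Metric.isOpen_iff.1 hU' (fun i => x i) (by simpa using hx)
  refine MvPolynomial.funext_set (fun i => Metric.ball (x i) r)
    (fun i => (infinite_of_mem_nhds (x i) (Metric.ball_mem_nhds _ hr))) fun y hy => ?_
  have hy' : y ∈ Metric.ball (fun i => x i) r := by
    rw [ball_pi _ hr]
    exact hy
  simpa [evalAt] using h _ (hball hy')

/-- The polynomial of an affine function. -/
def affinePoly (f : Plane →ᵃ[ℝ] ℝ) : Poly :=
  MvPolynomial.C (f 0) + ∑ i, MvPolynomial.C (f.linear (EuclideanSpace.single i 1)) *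
    MvPolynomial.X i

@[simp] theorem evalAt_affinePoly (f : Plane →ᵃ[ℝ] ℝ) (x : Plane) :
    evalAt x (affinePoly f) = f x := by
  have hx : x = ∑ i, x i • EuclideanSpace.single i (1 : ℝ) := by
    ext j; fin_cases j <;> simp
  have h1 : f x = f.linear x + f 0 := by
    have := f.decomp
    exact congrFun this x
  have h2 : f.linear x = ∑ i, x i * f.linear (EuclideanSpace.single i 1) := by
    conv_lhs => rw [hx]
    rw [map_sum]
    simp
  simp only [affinePoly, evalAt_add, evalAt_C, evalAt_sum, evalAt_mul, evalAt_X]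
  rw [h1, h2, add_comm]
  simp only [mul_comm]

theorem totalDegree_affinePoly_le (f : Plane →ᵃ[ℝ] ℝ) : (affinePoly f).totalDegree ≤ 1 := by
  refine (MvPolynomial.totalDegree_add _ _).trans (max_le (by simp) ?_)
  refine (MvPolynomial.totalDegree_finsetSum _ _).trans (Finset.sup_le fun i _ => ?_)
  refine (MvPolynomial.totalDegree_mul _ _).trans ?_
  simp

/-! ### Barycentric coordinates -/

/-- The element `K` as a closed subset of the plane. -/
abbrev hull {T : Mesh P} (K : T.elems) : Set Plane := convexHull ℝ (K.1 : Set Plane)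

/-- The vertices of an element as an affine basis. -/
def triBasis (T : Mesh P) (K : T.elems) : AffineBasis K.1 ℝ Plane where
  toFun := (↑)
  ind' := T.indep K.1 K.2
  tot' := by
    rw [(T.indep K.1 K.2).affineSpan_eq_top_iff_card_eq_finrank_add_one]
    simp [T.card_eq K.1 K.2]

theorem range_triBasis (T : Mesh P) (K : T.elems) : Set.range (triBasis T K) = (K.1 : Set Plane) := by
  change Set.range ((↑) : K.1 → Plane) = _
  simp

open Classical in
/-- The barycentric coordinate of the vertex `a` on `K`, zero if `a` is not a vertex of `K`. -/
def bary (T : Mesh P) (K : T.elems) (a : Plane) : Poly :=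
  if h : a ∈ K.1 then affinePoly ((triBasis T K).coord ⟨a, h⟩) else 0

variable {T : Mesh P}

theorem evalAt_bary {K : T.elems} {a : Plane} (h : a ∈ K.1) (x : Plane) :
    evalAt x (bary T K a) = (triBasis T K).coord ⟨a, h⟩ x := by
  rw [bary, dif_pos h, evalAt_affinePoly]

theorem bary_of_notMem {K : T.elems} {a : Plane} (h : a ∉ K.1) : bary T K a = 0 := dif_neg h

theorem totalDegree_bary_le (K : T.elems) (a : Plane) : (bary T K a).totalDegree ≤ 1 := by
  by_cases h : a ∈ K.1
  · rw [bary, dif_pos h]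
    exact totalDegree_affinePoly_le _
  · simp [bary_of_notMem h]

theorem mem_of_evalAt_bary_ne_zero {K : T.elems} {a x : Plane} (h : evalAt x (bary T K a) ≠ 0) :
    a ∈ K.1 := by
  by_contra h'
  exact h (by simp [bary_of_notMem h'])

open Classical in
theorem evalAt_bary_vertex {K : T.elems} {b : Plane} (hb : b ∈ K.1) (a : Plane) :
    evalAt b (bary T K a) = if a = b then 1 else 0 := by
  by_cases h : a ∈ K.1
  · rw [evalAt_bary h]
    have : b = triBasis T K ⟨b, hb⟩ := rfl
    conv_lhs => rw [this]
    rw [AffineBasis.coord_apply]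
    simp
  · rw [bary_of_notMem h, evalAt_zero, if_neg]
    rintro rfl
    exact h hb

theorem mem_hull_iff {K : T.elems} {x : Plane} :
    x ∈ hull K ↔ ∀ a, 0 ≤ evalAt x (bary T K a) := by
  have := (triBasis T K).convexHull_eq_nonneg_coord
  rw [range_triBasis] at this
  rw [hull, this]
  refine ⟨fun h a => ?_, fun h a => ?_⟩
  · by_cases ha : a ∈ K.1
    · rw [evalAt_bary ha]; exact h _
    · simp [bary_of_notMem ha]
  · have := h a.1
    rwa [evalAt_bary a.2] at this

theorem mem_interior_hull_iff {K : T.elems} {x : Plane} :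
    x ∈ interior (hull K) ↔ ∀ a ∈ K.1, 0 < evalAt x (bary T K a) := by
  have := (triBasis T K).interior_convexHull
  rw [range_triBasis] at this
  rw [hull, this]
  refine ⟨fun h a ha => ?_, fun h a => ?_⟩
  · rw [evalAt_bary ha]; exact h _
  · have := h a.1 a.2
    rwa [evalAt_bary a.2] at this

theorem sum_evalAt_bary (K : T.elems) (x : Plane) : ∑ a ∈ K.1, evalAt x (bary T K a) = 1 := by
  rw [← Finset.sum_coe_sort, ← (triBasis T K).sum_coord_apply_eq_one x]
  exact Finset.sum_congr rfl fun a _ => evalAt_bary a.2 x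

theorem sum_bary (K : T.elems) : ∑ a ∈ K.1, bary T K a = 1 :=
  evalAt_ext fun x => by rw [evalAt_sum, sum_evalAt_bary, evalAt_one]

theorem sum_evalAt_bary_smul (K : T.elems) (x : Plane) :
    ∑ a ∈ K.1, evalAt x (bary T K a) • a = x := by
  have h := (triBasis T K).linear_combination_coord_eq_self x
  conv_rhs => rw [← h]
  rw [← Finset.sum_coe_sort]
  exact Finset.sum_congr rfl fun a _ => by rw [evalAt_bary a.2 x]; rfl

/-- An affine function is determined by its values at the vertices. -/
theorem affineMap_eq_sum_bary (K : T.elems) (f : Plane →ᵃ[ℝ] ℝ) (x : Plane) :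
    f x = ∑ a ∈ K.1, evalAt x (bary T K a) * f a := by
  have h0 : ∀ y, f y = f.linear y + f 0 := fun y => congrFun f.decomp y
  have h1 : ∑ a ∈ K.1, evalAt x (bary T K a) * f a =
      ∑ a ∈ K.1, (evalAt x (bary T K a) * f.linear a + evalAt x (bary T K a) * f 0) :=
    Finset.sum_congr rfl fun a _ => by rw [h0 a, mul_add]
  rw [h1, Finset.sum_add_distrib, ← Finset.sum_mul, sum_evalAt_bary, one_mul, h0 x]
  conv_lhs => rw [← sum_evalAt_bary_smul K x]
  simp only [map_sum, map_smul, smul_eq_mul]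

theorem exists_affineMap_bary (K : T.elems) (a : Plane) :
    ∃ f : Plane →ᵃ[ℝ] ℝ, ∀ x, evalAt x (bary T K a) = f x := by
  by_cases h : a ∈ K.1
  · exact ⟨_, evalAt_bary h⟩
  · exact ⟨0, fun x => by simp [bary_of_notMem h]⟩

theorem evalAt_bary_combo (K : T.elems) (a x y : Plane) {s t : ℝ} (h : s + t = 1) :
    evalAt (s • x + t • y) (bary T K a) =
      s * evalAt x (bary T K a) + t * evalAt y (bary T K a) := by
  obtain ⟨f, hf⟩ := exists_affineMap_bary K a
  simp only [hf]
  exact Convex.combo_affine_apply h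

theorem exists_third {K : T.elems} {a b : Plane} (ha : a ∈ K.1) (hb : b ∈ K.1) (hab : a ≠ b) :
    ∃ c ∈ K.1, c ≠ a ∧ c ≠ b ∧ ∀ v ∈ K.1, v = a ∨ v = b ∨ v = c := by
  classical
  obtain ⟨x, y, z, hxy, hxz, hyz, h⟩ := Finset.card_eq_three.1 (T.card_eq K.1 K.2)
  simp only [h, Finset.mem_insert, Finset.mem_singleton] at *
  rcases ha with rfl | rfl | rfl <;> rcases hb with rfl | rfl | rfl <;> first
    | exact absurd rfl hab
    | exact ⟨x, by simp, by tauto, by tauto, by tauto⟩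
    | exact ⟨y, by simp, by tauto, by tauto, by tauto⟩
    | exact ⟨z, by simp, by tauto, by tauto, by tauto⟩

theorem sum_vertices {E : Type*} [AddCommMonoid E] {K : T.elems} {a b c : Plane} (ha : a ∈ K.1)
    (hb : b ∈ K.1) (hc : c ∈ K.1) (hab : a ≠ b) (hca : c ≠ a) (hcb : c ≠ b)
    (h : ∀ v ∈ K.1, v = a ∨ v = b ∨ v = c) (f : Plane → E) :
    ∑ v ∈ K.1, f v = f a + f b + f c := by
  classical
  have : K.1 = {a, b, c} := by
    ext v
    simp only [Finset.mem_insert, Finset.mem_singleton]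
    refine ⟨h v, ?_⟩
    rintro (rfl | rfl | rfl) <;> assumption
  rw [this, Finset.sum_insert (by simp [hab, hca.symm]), Finset.sum_insert (by simp [hcb.symm]),
    Finset.sum_singleton, add_assoc]

theorem isCompact_hull (K : T.elems) : IsCompact (hull K) := K.1.finite_toSet.isCompact_convexHull ℝ

theorem isClosed_hull (K : T.elems) : IsClosed (hull K) := (isCompact_hull K).isClosed

theorem interior_hull_nonempty (K : T.elems) : (interior (hull K)).Nonempty := by
  have := (triBasis T K).centroid_mem_interior_convexHull
  rw [range_triBasis] at this
  exact ⟨_, this⟩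

theorem hull_subset_closure_interior (K : T.elems) : hull K ⊆ closure (interior (hull K)) := by
  rw [(convex_convexHull ℝ _).closure_interior_eq_closure_of_nonempty_interior
    (interior_hull_nonempty K)]
  exact subset_closure

theorem hull_subset (K : T.elems) : hull K ⊆ closure P.carrier := by
  rw [← T.cover]
  exact Set.subset_biUnion_of_mem (u := fun K : Finset Plane => convexHull ℝ (K : Set Plane)) K.2

theorem interior_hull_subset (K : T.elems) : interior (hull K) ⊆ P.carrier := by
  conv_rhs => rw [← P.interior_closure]
  exact interior_mono (hull_subset K)

theorem vertex_mem_hull {K : T.elems} {a : Plane} (ha : a ∈ K.1) : a ∈ hull K :=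
  subset_convexHull ℝ _ ha

theorem exists_mem_hull {x : Plane} (hx : x ∈ closure P.carrier) : ∃ K : T.elems, x ∈ hull K := by
  rw [← T.cover] at hx
  simp only [Set.mem_iUnion] at hx
  obtain ⟨K, hK, h⟩ := hx
  exact ⟨⟨K, hK⟩, h⟩

/-- Barycentric coordinates of neighbouring elements agree on the intersection. -/
theorem evalAt_bary_eq {K L : T.elems} {x : Plane} (hK : x ∈ hull K) (hL : x ∈ hull L) (a : Plane) :
    evalAt x (bary T K a) = evalAt x (bary T L a) := by
  by_cases hKL : K = L
  · rw [hKL]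
  have hx : x ∈ hull K ∩ hull L := ⟨hK, hL⟩
  -- The intersection is spanned by common vertices, where both families of coordinates take the
  -- same values 0 and 1; affinity does the rest.
  rcases T.conforming K.1 K.2 L.1 L.2 (fun h => hKL (Subtype.ext h)) with h | ⟨b, hbK, hbL, h⟩ |
    ⟨b, c, hbK, hbL, hcK, hcL, -, h⟩
  · rw [h] at hx
    exact hx.elim
  · rw [h, Set.mem_singleton_iff] at hx
    rw [hx, evalAt_bary_vertex hbK, evalAt_bary_vertex hbL]
  · rw [h] at hx
    obtain ⟨s, t, -, -, hst, rfl⟩ := hx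
    rw [evalAt_bary_combo K a b c hst, evalAt_bary_combo L a b c hst, evalAt_bary_vertex hbK,
      evalAt_bary_vertex hbL, evalAt_bary_vertex hcK, evalAt_bary_vertex hcL]

/-- The coordinates of x in K and L agree, and `bary T L a` is zero unless a belongs to L. This
turns geometric incidence into incidence of vertices. -/
theorem mem_of_bary_pos {K L : T.elems} {x : Plane} (hK : x ∈ hull K) (hL : x ∈ hull L) {a : Plane}
    (h : 0 < evalAt x (bary T K a)) : a ∈ L.1 := by
  rw [evalAt_bary_eq hK hL] at h
  exact mem_of_evalAt_bary_ne_zero h.ne'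

/-- All three coordinates of an interior point of K are positive, so all three vertices of K belong
to L. -/
theorem eq_of_mem_interior {K L : T.elems} {x : Plane} (hK : x ∈ interior (hull K))
    (hL : x ∈ hull L) : K = L := by
  have : K.1 ⊆ L.1 := fun a ha =>
    mem_of_bary_pos (interior_subset hK) hL (mem_interior_hull_iff.1 hK a ha)
  exact Subtype.ext (Finset.eq_of_subset_of_card_le this
    (by rw [T.card_eq K.1 K.2, T.card_eq L.1 L.2]))

theorem vertex_mem_of_mem_hull {K L : T.elems} {a : Plane} (ha : a ∈ K.1) (hL : a ∈ hull L) :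
    a ∈ L.1 :=
  mem_of_bary_pos (vertex_mem_hull ha) hL (by simp [evalAt_bary_vertex ha])

/-! ### Edges -/

/-- Otherwise the affine coordinate of d would vanish at the three vertices of K, hence everywhere,
although it is 1 at d. -/
theorem opposite_ne_zero {K L : T.elems} {a b c d : Plane} (haK : a ∈ K.1) (hbK : b ∈ K.1)
    (hcK : c ∈ K.1) (hab : a ≠ b) (hca : c ≠ a) (hcb : c ≠ b)
    (hK : ∀ v ∈ K.1, v = a ∨ v = b ∨ v = c) (haL : a ∈ L.1) (hbL : b ∈ L.1) (hd : d ∈ L.1)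
    (hda : d ≠ a) (hdb : d ≠ b) : evalAt c (bary T L d) ≠ 0 := by
  intro h
  obtain ⟨f, hf⟩ := exists_affineMap_bary L d
  have h1 := affineMap_eq_sum_bary K f d
  rw [sum_vertices haK hbK hcK hab hca hcb hK, ← hf, ← hf, ← hf, ← hf, h,
    evalAt_bary_vertex haL, evalAt_bary_vertex hbL, evalAt_bary_vertex hd] at h1
  simp [hda, hdb] at h1

/-- Two elements with a common edge lie on opposite sides of it. -/
theorem opposite_neg {K L : T.elems} (hKL : K ≠ L) {a b c d : Plane} (haK : a ∈ K.1) (hbK : b ∈ K.1)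
    (hcK : c ∈ K.1) (hab : a ≠ b) (hca : c ≠ a) (hcb : c ≠ b)
    (hK : ∀ v ∈ K.1, v = a ∨ v = b ∨ v = c) (haL : a ∈ L.1) (hbL : b ∈ L.1) (hd : d ∈ L.1)
    (hda : d ≠ a) (hdb : d ≠ b) (hL : ∀ v ∈ L.1, v = a ∨ v = b ∨ v = d) :
    evalAt c (bary T L d) < 0 := by
  by_contra hneg
  have hpos : 0 < evalAt c (bary T L d) := lt_of_le_of_ne (not_lt.1 hneg)
    (opposite_ne_zero haK hbK hcK hab hca hcb hK haL hbL hd hda hdb).symm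
  -- The path from the midpoint of the common edge towards c. If c lay on the same side as d, the
  -- path would start in the interior of both elements.
  set x : ℝ → Plane := fun t => (1 - t) • ((1 / 2 : ℝ) • a + (1 / 2 : ℝ) • b) + t • c with hx
  have hev : ∀ (M : T.elems) (v : Plane) (t : ℝ), evalAt (x t) (bary T M v) = (1 - t) *
      (1 / 2 * evalAt a (bary T M v) + 1 / 2 * evalAt b (bary T M v)) +
        t * evalAt c (bary T M v) := by
    intro M v t
    rw [hx, evalAt_bary_combo M v _ _ (by ring), evalAt_bary_combo M v _ _ (by norm_num)]
  have hlim : ∀ v ∈ ({a, b} : Set Plane), ∀ᶠ t in 𝓝[>] (0 : ℝ), 0 < evalAt (x t) (bary T L v) := by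
    intro v hv
    have hc : Continuous fun t => evalAt (x t) (bary T L v) := by
      simp only [hev]
      fun_prop
    have h0 : 0 < evalAt (x 0) (bary T L v) := by
      rw [hev, evalAt_bary_vertex haL, evalAt_bary_vertex hbL]
      rcases hv with rfl | rfl <;> simp [hab, hab.symm]
    exact (hc.tendsto 0).eventually (lt_mem_nhds h0) |>.filter_mono nhdsWithin_le_nhds
  have ht1 : ∀ᶠ t in 𝓝[>] (0 : ℝ), t < 1 :=
    (gt_mem_nhds one_pos).filter_mono nhdsWithin_le_nhds
  obtain ⟨t, hta, htb, ht1, ht0⟩ := ((hlim a (by simp)).and ((hlim b (by simp)).and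
    (ht1.and self_mem_nhdsWithin))).exists
  have ht0 : 0 < t := ht0
  refine hKL (eq_of_mem_interior (x := x t) ?_ (interior_subset ?_))
  · rw [mem_interior_hull_iff]
    intro v hv
    rw [hev, evalAt_bary_vertex haK, evalAt_bary_vertex hbK, evalAt_bary_vertex hcK]
    rcases hK v hv with rfl | rfl | rfl
    · simp [hab, hca.symm]; linarith
    · simp [hab.symm, hcb.symm]; linarith
    · simp [hca, hcb]; linarith
  · rw [mem_interior_hull_iff]
    intro v hv
    rcases hL v hv with rfl | rfl | rfl
    · exact hta
    · exact htb
    · rw [hev, evalAt_bary_vertex haL, evalAt_bary_vertex hbL]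
      simp only [hda, hdb, if_false]
      have := mul_pos ht0 hpos
      linarith

/-- For elements `L = abd` and `M ∋ a, b`: the coordinate of `e ≠ a, b` in `M` is a multiple of the
coordinate of `d` in `L`. -/
theorem bary_eq_mul_of_common_edge {L M : T.elems} {a b d e : Plane} (haL : a ∈ L.1) (hbL : b ∈ L.1)
    (hdL : d ∈ L.1) (hab : a ≠ b) (hda : d ≠ a) (hdb : d ≠ b)
    (hL : ∀ v ∈ L.1, v = a ∨ v = b ∨ v = d) (haM : a ∈ M.1) (hbM : b ∈ M.1)
    (hea : e ≠ a) (heb : e ≠ b) (x : Plane) :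
    evalAt x (bary T M e) = evalAt x (bary T L d) * evalAt d (bary T M e) := by
  obtain ⟨f, hf⟩ := exists_affineMap_bary M e
  have h1 := affineMap_eq_sum_bary L f x
  rw [sum_vertices haL hbL hdL hab hda hdb hL, ← hf, ← hf, ← hf, ← hf, evalAt_bary_vertex haM,
    evalAt_bary_vertex hbM] at h1
  simpa [hea, heb] using h1

/-- An edge belongs to at most two elements. -/
theorem eq_or_eq_of_common_edge {K L M : T.elems} {a b : Plane} (hab : a ≠ b) (hKL : K ≠ L)
    (haK : a ∈ K.1) (hbK : b ∈ K.1) (haL : a ∈ L.1) (hbL : b ∈ L.1) (haM : a ∈ M.1)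
    (hbM : b ∈ M.1) : M = K ∨ M = L := by
  by_contra! h
  obtain ⟨c, hcK, hca, hcb, hK⟩ := exists_third haK hbK hab
  obtain ⟨d, hdL, hda, hdb, hL⟩ := exists_third haL hbL hab
  obtain ⟨e, heM, hea, heb, hM⟩ := exists_third haM hbM hab
  have h1 := opposite_neg hKL haK hbK hcK hab hca hcb hK haL hbL hdL hda hdb hL
  have h2 := opposite_neg h.1.symm haK hbK hcK hab hca hcb hK haM hbM heM hea heb hM
  have h3 := opposite_neg h.2.symm haL hbL hdL hab hda hdb hL haM hbM heM hea heb hM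
  -- Three elements on one edge would be pairwise on opposite sides; the coordinate of e at c is
  -- then negative, yet also a product of two negative numbers.
  have h4 := bary_eq_mul_of_common_edge haL hbL hdL hab hda hdb hL haM hbM hea heb c
  nlinarith

/-- The relative interior of an edge that belongs to two elements lies in the domain. -/
theorem mem_carrier_of_common_edge {K L : T.elems} (hKL : K ≠ L) {a b x : Plane} (hab : a ≠ b)
    (haK : a ∈ K.1) (hbK : b ∈ K.1) (haL : a ∈ L.1) (hbL : b ∈ L.1) (hx : x ∈ hull K)
    (hxa : 0 < evalAt x (bary T K a)) (hxb : 0 < evalAt x (bary T K b)) : x ∈ P.carrier := by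
  obtain ⟨c, hcK, hca, hcb, hK⟩ := exists_third haK hbK hab
  obtain ⟨d, hdL, hda, hdb, hL⟩ := exists_third haL hbL hab
  by_cases hxc : 0 < evalAt x (bary T K c)
  · refine interior_hull_subset K (mem_interior_hull_iff.2 fun v hv => ?_)
    rcases hK v hv with rfl | rfl | rfl <;> assumption
  have hxc0 : evalAt x (bary T K c) = 0 := le_antisymm (not_lt.1 hxc) (mem_hull_iff.1 hx c)
  have h1 := opposite_neg hKL haK hbK hcK hab hca hcb hK haL hbL hdL hda hdb hL
  have hxL : x ∈ hull L := by
    have hs : x = evalAt x (bary T K a) • a + evalAt x (bary T K b) • b := by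
      conv_lhs => rw [← sum_evalAt_bary_smul K x, sum_vertices haK hbK hcK hab hca hcb hK, hxc0,
        zero_smul, add_zero]
    have hs1 := sum_evalAt_bary K x
    rw [sum_vertices haK hbK hcK hab hca hcb hK, hxc0, add_zero] at hs1
    rw [hs]
    exact (convex_convexHull ℝ _) (vertex_mem_hull haL) (vertex_mem_hull hbL) hxa.le hxb.le hs1
  -- K and L together cover a neighbourhood of x: the sign of the coordinate of c decides which of
  -- the two contains a nearby point.
  rw [← P.interior_closure, mem_interior_iff_mem_nhds]
  have hpos : ∀ (M : T.elems) (v : Plane), 0 < evalAt x (bary T M v) →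
      ∀ᶠ y in 𝓝 x, 0 < evalAt y (bary T M v) := fun M v h =>
    (continuous_evalAt (bary T M v)).continuousAt.eventually (lt_mem_nhds h)
  filter_upwards [hpos K a hxa, hpos K b hxb, hpos L a (by rwa [← evalAt_bary_eq hx hxL]),
    hpos L b (by rwa [← evalAt_bary_eq hx hxL])] with y h2 h3 h4 h5
  rcases le_or_gt 0 (evalAt y (bary T K c)) with h6 | h6
  · refine hull_subset K (mem_hull_iff.2 fun v => ?_)
    by_cases hv : v ∈ K.1
    · rcases hK v hv with rfl | rfl | rfl
      exacts [h2.le, h3.le, h6]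
    · simp [bary_of_notMem hv]
  · refine hull_subset L (mem_hull_iff.2 fun v => ?_)
    by_cases hv : v ∈ L.1
    · rcases hL v hv with rfl | rfl | rfl
      · exact h4.le
      · exact h5.le
      · rw [bary_eq_mul_of_common_edge haK hbK hcK hab hca hcb hK haL hbL hda hdb]
        nlinarith
    · simp [bary_of_notMem hv]

theorem frontier_carrier : frontier P.carrier = closure P.carrier \ P.carrier := by
  rw [frontier, P.isOpen.interior_eq]

/-- An edge that belongs to one element only lies on the boundary. -/
theorem segment_subset_frontier {K : T.elems} {a b : Plane} (hab : a ≠ b)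
    (haK : a ∈ K.1) (hbK : b ∈ K.1) (h : ∀ L : T.elems, a ∈ L.1 → b ∈ L.1 → L = K) :
    segment ℝ a b ⊆ frontier P.carrier := by
  obtain ⟨c, hcK, hca, hcb, hK⟩ := exists_third haK hbK hab
  have hopen : openSegment ℝ a b ⊆ frontier P.carrier := by
    rintro x ⟨s, t, hs, ht, hst, rfl⟩
    set x := s • a + t • b with hx
    have hxa : evalAt x (bary T K a) = s := by
      rw [hx, evalAt_bary_combo K _ _ _ hst, evalAt_bary_vertex haK, evalAt_bary_vertex hbK]
      simp [hab]
    have hxb : evalAt x (bary T K b) = t := by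
      rw [hx, evalAt_bary_combo K _ _ _ hst, evalAt_bary_vertex haK, evalAt_bary_vertex hbK]
      simp [hab.symm]
    have hxc : evalAt x (bary T K c) = 0 := by
      rw [hx, evalAt_bary_combo K _ _ _ hst, evalAt_bary_vertex haK, evalAt_bary_vertex hbK]
      simp [hca, hcb]
    have hxK : x ∈ hull K :=
      (convex_convexHull ℝ _) (vertex_mem_hull haK) (vertex_mem_hull hbK) hs.le ht.le hst
    rw [frontier_carrier]
    refine ⟨hull_subset K hxK, fun hxΩ => ?_⟩
    -- No other element contains x. If x were in the domain, a neighbourhood of x would be covered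
    -- by K alone, and x would be interior to K although its third coordinate is zero.
    have hev : ∀ L : T.elems, L ≠ K → ∀ᶠ y in 𝓝 x, y ∉ hull L := by
      intro L hL
      refine (isClosed_hull L).isOpen_compl.mem_nhds fun hxL => hL (h L ?_ ?_)
      · exact mem_of_bary_pos hxK hxL (by rw [hxa]; exact hs)
      · exact mem_of_bary_pos hxK hxL (by rw [hxb]; exact ht)
    have hInt : x ∈ interior (hull K) := by
      rw [mem_interior_iff_mem_nhds]
      have hall : ∀ᶠ y in 𝓝 x, ∀ L : T.elems, L ≠ K → y ∉ hull L := by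
        rw [eventually_all]
        intro L
        by_cases hL : L = K
        · simp [hL]
        · filter_upwards [hev L hL] with y hy _ using hy
      filter_upwards [hall, P.isOpen.mem_nhds hxΩ] with y hy hyΩ
      obtain ⟨L, hL⟩ := exists_mem_hull (T := T) (subset_closure hyΩ)
      by_cases hLK : L = K
      · rwa [hLK] at hL
      · exact absurd hL (hy L hLK)
    have := mem_interior_hull_iff.1 hInt c hcK
    rw [hxc] at this
    exact lt_irrefl _ this
  have h2 := closure_minimal hopen isClosed_frontier
  exact (segment_subset_closure_openSegment).trans h2

/-- A boundary point in the interior of an edge forces the edge to lie on the boundary. -/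
theorem segment_subset_frontier_of_mem {K : T.elems} {a b x : Plane} (hab : a ≠ b)
    (haK : a ∈ K.1) (hbK : b ∈ K.1) (hx : x ∈ hull K) (hxΓ : x ∈ frontier P.carrier)
    (hxa : 0 < evalAt x (bary T K a)) (hxb : 0 < evalAt x (bary T K b)) :
    segment ℝ a b ⊆ frontier P.carrier := by
  refine segment_subset_frontier hab haK hbK fun L haL hbL => ?_
  by_contra hL
  have := mem_carrier_of_common_edge (fun h => hL h.symm) hab haK hbK haL hbL hx hxa hxb
  rw [frontier_carrier] at hxΓ
  exact hxΓ.2 this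

end

/-! ### Polynomial potentials and divergences of bubble fields on one triangle. -/

section

/-! ### Derivatives and primitives of polynomials -/

-- The commutator of two derivations is a derivation, and it vanishes on the variables.
open MvPolynomial in
theorem pderiv_comm (i j : Fin 2) (p : Poly) : pderiv i (pderiv j p) = pderiv j (pderiv i p) := by
  have h : ⁅(pderiv i : Derivation ℝ Poly Poly), (pderiv j : Derivation ℝ Poly Poly)⁆ = 0 := by
    refine MvPolynomial.derivation_ext fun k => ?_
    simp only [Derivation.commutator_apply, pderiv_X, Pi.single_apply, Derivation.coe_zero,
      Pi.zero_apply]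
    split_ifs <;> simp
  have := DFunLike.congr_fun h p
  rw [Derivation.commutator_apply] at this
  exact sub_eq_zero.1 this

open MvPolynomial in
theorem totalDegree_pderiv_le {p : Poly} {d : ℕ} (h : p.totalDegree ≤ d + 1) (i : Fin 2) :
    (pderiv i p).totalDegree ≤ d := by
  refine Finset.sup_le fun m hm => ?_
  rw [mem_support_iff, coeff_pderiv] at hm
  have h1 : m + Finsupp.single i 1 ∈ p.support := by
    rw [mem_support_iff]
    intro h
    simp [h] at hm
  have h2 := (le_totalDegree h1).trans h
  rw [Finsupp.sum_add_index' (fun _ => rfl) (fun _ _ _ => rfl), Finsupp.sum_single_index rfl] at h2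
  exact Nat.le_of_succ_le_succ h2

/-- The primitive of a polynomial with respect to one variable. -/
def primitive (i : Fin 2) : Poly →ₗ[ℝ] Poly :=
  (MvPolynomial.basisMonomials (Fin 2) ℝ).constr ℝ fun m =>
    MvPolynomial.monomial (m + Finsupp.single i 1) (((m i : ℝ) + 1)⁻¹)

theorem primitive_monomial (i : Fin 2) (m : Fin 2 →₀ ℕ) (c : ℝ) :
    primitive i (MvPolynomial.monomial m c) =
      MvPolynomial.monomial (m + Finsupp.single i 1) (c * ((m i : ℝ) + 1)⁻¹) := by
  have h1 : MvPolynomial.monomial m c = c • MvPolynomial.monomial m (1 : ℝ) := by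
    rw [MvPolynomial.smul_monomial, smul_eq_mul, mul_one]
  have h2 : primitive i (MvPolynomial.monomial m (1 : ℝ)) =
      MvPolynomial.monomial (m + Finsupp.single i 1) (((m i : ℝ) + 1)⁻¹) := by
    have := (MvPolynomial.basisMonomials (Fin 2) ℝ).constr_basis ℝ (fun m =>
      MvPolynomial.monomial (m + Finsupp.single i 1) (((m i : ℝ) + 1)⁻¹)) m
    rwa [MvPolynomial.coe_basisMonomials] at this
  rw [h1, map_smul, h2, MvPolynomial.smul_monomial, smul_eq_mul]

theorem pderiv_primitive_self (i : Fin 2) (p : Poly) :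
    MvPolynomial.pderiv i (primitive i p) = p := by
  induction p using MvPolynomial.induction_on' with
  | add p q hp hq => rw [map_add, map_add, hp, hq]
  | monomial m c =>
    rw [primitive_monomial, MvPolynomial.pderiv_monomial]
    have : (m i : ℝ) + 1 ≠ 0 := by positivity
    simp [this]

theorem pderiv_primitive_of_ne {i j : Fin 2} (h : j ≠ i) (p : Poly) :
    MvPolynomial.pderiv j (primitive i p) = primitive i (MvPolynomial.pderiv j p) := by
  induction p using MvPolynomial.induction_on' with
  | add p q hp hq => rw [map_add, map_add, hp, hq, map_add, map_add]
  | monomial m c =>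
    rw [primitive_monomial, MvPolynomial.pderiv_monomial, MvPolynomial.pderiv_monomial,
      primitive_monomial]
    have e1 : (m + Finsupp.single i 1 : Fin 2 →₀ ℕ) j = m j := by simp [h.symm]
    have e2 : (m - Finsupp.single j 1 : Fin 2 →₀ ℕ) i = m i := by simp [h]
    rw [e1, e2]
    by_cases hm : m j = 0
    · simp [hm]
    · congr 1
      · congr 1
        ext l
        simp only [Finsupp.coe_tsub, Finsupp.coe_add, Pi.sub_apply, Pi.add_apply,
          Finsupp.single_apply]
        split_ifs <;> omega
      · ring

theorem totalDegree_primitive_le (i : Fin 2) {p : Poly} {d : ℕ} (h : p.totalDegree ≤ d) :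
    (primitive i p).totalDegree ≤ d + 1 := by
  rw [p.as_sum, map_sum]
  refine (MvPolynomial.totalDegree_finsetSum _ _).trans (Finset.sup_le fun m hm => ?_)
  rw [primitive_monomial]
  refine (MvPolynomial.totalDegree_monomial_le _ _).trans ?_
  rw [Finsupp.sum_add_index' (fun _ => rfl) (fun _ _ _ => rfl), Finsupp.sum_single_index rfl]
  exact Nat.add_le_add_right ((MvPolynomial.le_totalDegree hm).trans h) 1

/-- A divergence-free polynomial vector field is the curl of a polynomial. -/
theorem exists_potential {v : Fin 2 → Poly} {d : ℕ} (hd : ∀ j, (v j).totalDegree ≤ d)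
    (h : MvPolynomial.pderiv 0 (v 0) + MvPolynomial.pderiv 1 (v 1) = 0) :
    ∃ φ : Poly, φ.totalDegree ≤ d + 1 ∧ MvPolynomial.pderiv 1 φ = v 0 ∧
      -MvPolynomial.pderiv 0 φ = v 1 := by
  -- After integrating the first component in y, this is the part of ∂ₓφ still missing; by the
  -- divergence condition it does not depend on y, so integrating it in x leaves ∂_yφ unchanged.
  set r := -v 1 - MvPolynomial.pderiv 0 (primitive 1 (v 0)) with hr
  have h1 : MvPolynomial.pderiv 1 r = 0 := by
    rw [hr, map_sub, map_neg, pderiv_comm, pderiv_primitive_self]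
    linear_combination -h
  have hrd : r.totalDegree ≤ d := by
    refine (MvPolynomial.totalDegree_sub _ _).trans (max_le ?_ ?_)
    · rw [MvPolynomial.totalDegree_neg]; exact hd 1
    · exact totalDegree_pderiv_le (totalDegree_primitive_le _ (hd 0)) _
  refine ⟨primitive 1 (v 0) + primitive 0 r, ?_, ?_, ?_⟩
  · exact (MvPolynomial.totalDegree_add _ _).trans (max_le (totalDegree_primitive_le _ (hd 0))
      (totalDegree_primitive_le _ hrd))
  · rw [map_add, pderiv_primitive_self, pderiv_primitive_of_ne (by decide), h1, map_zero, add_zero]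
  · rw [map_add, pderiv_primitive_self, hr]
    ring

/-! ### The divergence of bubble functions on a triangle -/

/-- The span of the products of three polynomials with a given total exponent. -/
def bernstein (x y z : Poly) (n : ℕ) : Submodule ℝ Poly :=
  Submodule.span ℝ {p | ∃ a b c : ℕ, a + b + c = n ∧ p = x ^ a * y ^ b * z ^ c}

theorem mul_mem_bernstein {x y z : Poly} {n : ℕ} {p : Poly} (hp : p ∈ bernstein x y z n)
    (α β γ : ℝ) : (α • x + β • y + γ • z) * p ∈ bernstein x y z (n + 1) := by
  induction hp using Submodule.span_induction with
  | mem p hp =>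
    obtain ⟨a, b, c, h, rfl⟩ := hp
    have e : (α • x + β • y + γ • z) * (x ^ a * y ^ b * z ^ c) = α • (x ^ (a + 1) * y ^ b * z ^ c) +
        β • (x ^ a * y ^ (b + 1) * z ^ c) + γ • (x ^ a * y ^ b * z ^ (c + 1)) := by
      simp only [MvPolynomial.smul_eq_C_mul]
      ring
    rw [e]
    refine add_mem (add_mem ?_ ?_) ?_ <;> refine Submodule.smul_mem _ _ (Submodule.subset_span ?_)
    · exact ⟨a + 1, b, c, by omega, rfl⟩
    · exact ⟨a, b + 1, c, by omega, rfl⟩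
    · exact ⟨a, b, c + 1, by omega, rfl⟩
  | zero => simp
  | add p q _ _ hp hq => rw [mul_add]; exact add_mem hp hq
  | smul r p _ hp => rw [mul_smul_comm]; exact Submodule.smul_mem _ _ hp

/-- Each variable is a linear form in x, y, z, and multiplying by 1 = x + y + z raises lower-degree
terms to total exponent exactly n. -/
theorem mem_bernstein {x y z : Poly} (hsum : x + y + z = 1)
    (hX : ∀ i, ∃ α β γ : ℝ, (MvPolynomial.X i : Poly) = α • x + β • y + γ • z) {n : ℕ} {p : Poly}
    (hp : p.totalDegree ≤ n) : p ∈ bernstein x y z n := by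
  have hmono : ∀ n p, p ∈ bernstein x y z n → p ∈ bernstein x y z (n + 1) := by
    intro n p hp
    have := mul_mem_bernstein hp 1 1 1
    rwa [one_smul, one_smul, one_smul, hsum, one_mul] at this
  have hle : ∀ m n p, p ∈ bernstein x y z m → p ∈ bernstein x y z (m + n) := by
    intro m n p hp
    induction n with
    | zero => exact hp
    | succ n ih => exact hmono _ _ ih
  have hXpow : ∀ (i : Fin 2) (e n : ℕ) (p : Poly), p ∈ bernstein x y z n →
      MvPolynomial.X i ^ e * p ∈ bernstein x y z (n + e) := by
    intro i e n p hp
    induction e with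
    | zero => simpa using hp
    | succ e ih =>
      obtain ⟨α, β, γ, h⟩ := hX i
      have := mul_mem_bernstein ih α β γ
      rwa [← h, ← mul_assoc, ← pow_succ'] at this
  have h1 : (1 : Poly) ∈ bernstein x y z 0 := Submodule.subset_span ⟨0, 0, 0, rfl, by simp⟩
  rw [p.as_sum]
  refine Submodule.sum_mem _ fun m hm => ?_
  have hdeg := (MvPolynomial.le_totalDegree hm).trans hp
  rw [Finsupp.sum_fintype _ _ (fun _ => rfl), Fin.sum_univ_two] at hdeg
  have h2 := hXpow 0 (m 0) _ _ (hXpow 1 (m 1) _ _ h1)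
  have e : MvPolynomial.monomial m (MvPolynomial.coeff m p) = MvPolynomial.coeff m p •
      (MvPolynomial.X 0 ^ m 0 * (MvPolynomial.X 1 ^ m 1 * 1) : Poly) := by
    rw [MvPolynomial.monomial_eq, Finsupp.prod_fintype _ _ (fun _ => pow_zero _),
      Fin.prod_univ_two, MvPolynomial.smul_eq_C_mul, mul_one]
  rw [e]
  refine Submodule.smul_mem _ _ ?_
  obtain ⟨t, rfl⟩ := Nat.exists_eq_add_of_le hdeg
  have := hle _ t _ h2
  convert this using 2
  omega

/-- Divergences of polynomial vector fields of degree at most `d` that are multiples of `w`. -/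
def bubbleDiv (w : Poly) (d : ℕ) : Submodule ℝ Poly where
  carrier := {q | ∃ v : Fin 2 → Poly, (∀ j, (v j).totalDegree ≤ d) ∧ (∀ j, w ∣ v j) ∧
    MvPolynomial.pderiv 0 (v 0) + MvPolynomial.pderiv 1 (v 1) = q}
  zero_mem' := ⟨0, by simp, by simp, by simp⟩
  add_mem' := by
    rintro _ _ ⟨v, hv, hv', rfl⟩ ⟨u, hu, hu', rfl⟩
    refine ⟨v + u, fun j => (MvPolynomial.totalDegree_add _ _).trans (max_le (hv j) (hu j)),
      fun j => dvd_add (hv' j) (hu' j), ?_⟩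
    simp only [Pi.add_apply, map_add]
    ring
  smul_mem' := by
    rintro c _ ⟨v, hv, hv', rfl⟩
    refine ⟨c • v, fun j => (MvPolynomial.totalDegree_smul_le _ _).trans (hv j),
      fun j => ?_, ?_⟩
    · rw [Pi.smul_apply, MvPolynomial.smul_eq_C_mul]
      exact (hv' j).mul_left _
    · simp only [Pi.smul_apply, Derivation.map_smul, smul_add]

/-- The directional derivative of polynomials. -/
def dirDeriv (τ : Fin 2 → ℝ) : Derivation ℝ Poly Poly :=
  τ 0 • MvPolynomial.pderiv 0 + τ 1 • MvPolynomial.pderiv 1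

theorem dirDeriv_apply (τ : Fin 2 → ℝ) (p : Poly) :
    dirDeriv τ p = τ 0 • MvPolynomial.pderiv 0 p + τ 1 • MvPolynomial.pderiv 1 p := rfl

/-- The derivative of p in the direction τ is the divergence of the field p τ. -/
theorem dirDeriv_mem_bubbleDiv {w p : Poly} {d : ℕ} (hd : p.totalDegree ≤ d) (hw : w ∣ p)
    (τ : Fin 2 → ℝ) : dirDeriv τ p ∈ bubbleDiv w d := by
  refine ⟨fun j => τ j • p, fun j => (MvPolynomial.totalDegree_smul_le _ _).trans hd,
    fun j => ?_, by simp only [Derivation.map_smul, dirDeriv_apply]⟩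
  change w ∣ τ j • p
  rw [MvPolynomial.smul_eq_C_mul]
  exact hw.mul_left _

/-- The algebraic properties of the three barycentric coordinates of a triangle. -/
structure IsBarycentric (x y z : Poly) : Prop where
  deg_x : x.totalDegree ≤ 1
  deg_y : y.totalDegree ≤ 1
  deg_z : z.totalDegree ≤ 1
  sum : x + y + z = 1
  X_mem : ∀ i, ∃ α β γ : ℝ, (MvPolynomial.X i : Poly) = α • x + β • y + γ • z
  dir_xy : ∃ τ, dirDeriv τ x = 1 ∧ dirDeriv τ y = -1 ∧ dirDeriv τ z = 0
  dir_xz : ∃ τ, dirDeriv τ x = 1 ∧ dirDeriv τ y = 0 ∧ dirDeriv τ z = -1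

/-- The product of divided powers `xᵃ yᵇ zᶜ / (a! b! c!)`. -/
def divPow (x y z : Poly) (a b c : ℕ) : Poly :=
  ((a.factorial : ℝ) * b.factorial * c.factorial)⁻¹ • (x ^ a * y ^ b * z ^ c)

theorem totalDegree_monomial_le {x y z : Poly} (hx : x.totalDegree ≤ 1) (hy : y.totalDegree ≤ 1)
    (hz : z.totalDegree ≤ 1) (a b c : ℕ) : (x ^ a * y ^ b * z ^ c).totalDegree ≤ a + b + c := by
  have h : ∀ {u : Poly} (n : ℕ), u.totalDegree ≤ 1 → (u ^ n).totalDegree ≤ n := fun n hu =>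
    (MvPolynomial.totalDegree_pow _ _).trans (by nlinarith)
  exact (MvPolynomial.totalDegree_mul _ _).trans (add_le_add
    ((MvPolynomial.totalDegree_mul _ _).trans (add_le_add (h a hx) (h b hy))) (h c hz))

/-- Divided powers are normalised so that differentiation lowers an exponent without producing a
numerical factor. -/
theorem dirDeriv_divPow {x y z : Poly} {τ : Fin 2 → ℝ} {r s t : ℝ}
    (hx : dirDeriv τ x = MvPolynomial.C r) (hy : dirDeriv τ y = MvPolynomial.C s)
    (hz : dirDeriv τ z = MvPolynomial.C t) (a b c : ℕ) :
    dirDeriv τ (divPow x y z (a + 1) (b + 1) (c + 1)) = r • divPow x y z a (b + 1) (c + 1) +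
      s • divPow x y z (a + 1) b (c + 1) + t • divPow x y z (a + 1) (b + 1) c := by
  have hD : dirDeriv τ (x ^ (a + 1) * y ^ (b + 1) * z ^ (c + 1)) =
      ((a : ℝ) + 1) • r • (x ^ a * y ^ (b + 1) * z ^ (c + 1)) +
      ((b : ℝ) + 1) • s • (x ^ (a + 1) * y ^ b * z ^ (c + 1)) +
      ((c : ℝ) + 1) • t • (x ^ (a + 1) * y ^ (b + 1) * z ^ c) := by
    simp only [Derivation.leibniz, Derivation.leibniz_pow, hx, hy, hz, smul_eq_mul,
      MvPolynomial.smul_eq_C_mul, nsmul_eq_mul, Nat.add_sub_cancel, Nat.cast_add, Nat.cast_one,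
      map_add, map_natCast, map_one]
    ring
  have ha : (a.factorial : ℝ) ≠ 0 := by positivity
  have hb : (b.factorial : ℝ) ≠ 0 := by positivity
  have hc : (c.factorial : ℝ) ≠ 0 := by positivity
  have ha' : (a : ℝ) + 1 ≠ 0 := by positivity
  have hb' : (b : ℝ) + 1 ≠ 0 := by positivity
  have hc' : (c : ℝ) + 1 ≠ 0 := by positivity
  simp only [divPow, Derivation.map_smul, hD, smul_add, smul_smul, Nat.factorial_succ,
    Nat.cast_mul, Nat.cast_add, Nat.cast_one]
  congr 1
  · congr 1
    · congr 1
      field_simp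
    · congr 1
      field_simp
  · congr 1
    field_simp

variable {x y z : Poly}

/-- Differentiating a bubble along an edge of the triangle raises one coordinate and lowers another,
so the result is a difference of two neighbouring divided powers. Neighbours in the lattice of
exponents are therefore congruent modulo divergences of bubbles. -/
theorem IsBarycentric.step (h : IsBarycentric x y z) {s a b c : ℕ} (habc : a + b + c = s) :
    divPow x y z a (b + 1) (c + 1) - divPow x y z (a + 1) b (c + 1) ∈
      bubbleDiv (x * y * z) (s + 3) ∧
    divPow x y z a (b + 1) (c + 1) - divPow x y z (a + 1) (b + 1) c ∈
      bubbleDiv (x * y * z) (s + 3) := by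
  have hmem : ∀ τ, dirDeriv τ (divPow x y z (a + 1) (b + 1) (c + 1)) ∈
      bubbleDiv (x * y * z) (s + 3) := by
    intro τ
    refine dirDeriv_mem_bubbleDiv ((MvPolynomial.totalDegree_smul_le _ _).trans
      ((totalDegree_monomial_le h.deg_x h.deg_y h.deg_z _ _ _).trans (by omega))) ?_ τ
    rw [MvPolynomial.smul_eq_C_mul]
    refine Dvd.dvd.mul_left ⟨x ^ a * y ^ b * z ^ c, by ring⟩ _
  constructor
  · obtain ⟨τ, h1, h2, h3⟩ := h.dir_xy
    have := hmem τ
    rw [dirDeriv_divPow (r := 1) (s := -1) (t := 0) (by simpa using h1) (by simpa using h2)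
      (by simpa using h3)] at this
    simpa [sub_eq_add_neg] using this
  · obtain ⟨τ, h1, h2, h3⟩ := h.dir_xz
    have := hmem τ
    rw [dirDeriv_divPow (r := 1) (s := 0) (t := -1) (by simpa using h1) (by simpa using h2)
      (by simpa using h3)] at this
    simpa [sub_eq_add_neg] using this

/-- Factors z, and then factors y, are traded one at a time for factors x, until only one of each is
left. -/
theorem IsBarycentric.divPow_sub_mem (h : IsBarycentric x y z) {s : ℕ} : ∀ b c a : ℕ, a + b + c = s →
    divPow x y z a (b + 1) (c + 1) - divPow x y z s 1 1 ∈ bubbleDiv (x * y * z) (s + 3) := by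
  intro b
  induction b with
  | zero =>
    intro c
    induction c with
    | zero =>
      intro a ha
      obtain rfl : a = s := by omega
      simp
    | succ c ih =>
      intro a ha
      have h1 := (h.step (s := s) (a := a) (b := 0) (c := c + 1) ha).2
      have h2 := ih (a + 1) (by omega)
      have := add_mem h1 h2
      simpa using this
  | succ b ih =>
    intro c a ha
    have h1 := (h.step (s := s) (a := a) (b := b + 1) (c := c) ha).1
    have h2 := ih c (a + 1) (by omega)
    have := add_mem h1 h2
    simpa using this

/-- A mixed monomial missing y or z is one lattice step away from those already treated. Hence the
mixed monomials span at most one dimension modulo divergences of bubbles. -/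
theorem IsBarycentric.monomial_mem (h : IsBarycentric x y z) {s a b c : ℕ}
    (habc : a + b + c = s + 2) (h2 : a ≠ s + 2) (h3 : b ≠ s + 2) (h4 : c ≠ s + 2) :
    x ^ a * y ^ b * z ^ c ∈ bubbleDiv (x * y * z) (s + 3) ⊔ Submodule.span ℝ {x ^ s * y * z} := by
  have hbase : divPow x y z s 1 1 ∈
      bubbleDiv (x * y * z) (s + 3) ⊔ Submodule.span ℝ {x ^ s * y * z} := by
    refine Submodule.mem_sup_right (Submodule.smul_mem _ _ ?_)
    rw [pow_one, pow_one]
    exact Submodule.subset_span rfl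
  have hdp : divPow x y z a b c ∈
      bubbleDiv (x * y * z) (s + 3) ⊔ Submodule.span ℝ {x ^ s * y * z} := by
    rw [← sub_add_cancel (divPow x y z a b c) (divPow x y z s 1 1)]
    refine add_mem (Submodule.mem_sup_left ?_) hbase
    rcases b with _ | b
    · obtain ⟨a, rfl⟩ : ∃ a', a = a' + 1 := ⟨a - 1, by omega⟩
      obtain ⟨c, rfl⟩ : ∃ c', c = c' + 1 := ⟨c - 1, by omega⟩
      have h1 := (h.step (s := s) (a := a) (b := 0) (c := c) (by omega)).1
      have := sub_mem (h.divPow_sub_mem (s := s) 0 c a (by omega)) h1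
      simpa using this
    · rcases c with _ | c
      · obtain ⟨a, rfl⟩ : ∃ a', a = a' + 1 := ⟨a - 1, by omega⟩
        have h1 := (h.step (s := s) (a := a) (b := b) (c := 0) (by omega)).2
        have := sub_mem (h.divPow_sub_mem (s := s) b 0 a (by omega)) h1
        simpa using this
      · exact h.divPow_sub_mem (s := s) b c a (by omega)
  have e : x ^ a * y ^ b * z ^ c =
      ((a.factorial : ℝ) * b.factorial * c.factorial) • divPow x y z a b c := by
    rw [divPow, smul_smul, mul_inv_cancel₀ (by positivity), one_smul]
  rw [e]
  exact Submodule.smul_mem _ _ hdp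

/-- Surjectivity of the divergence from bubble functions onto the polynomials that vanish at the
vertices and in the kernel of a functional that vanishes on divergences of bubbles. -/
theorem IsBarycentric.exists_bubble (h : IsBarycentric x y z) {s : ℕ} {q : Poly}
    (hq : q.totalDegree ≤ s + 2) {A B C : Plane} (hA : evalAt A q = 0) (hB : evalAt B q = 0)
    (hC : evalAt C q = 0) (hxA : evalAt A x = 1) (hyA : evalAt A y = 0) (hzA : evalAt A z = 0)
    (hxB : evalAt B x = 0) (hyB : evalAt B y = 1) (hzB : evalAt B z = 0)
    (hxC : evalAt C x = 0) (hyC : evalAt C y = 0) (hzC : evalAt C z = 1) (I : Poly →ₗ[ℝ] ℝ)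
    (hI : ∀ p ∈ bubbleDiv (x * y * z) (s + 3), I p = 0) (hI' : I (x ^ s * y * z) ≠ 0)
    (hIq : I q = 0) : q ∈ bubbleDiv (x * y * z) (s + 3) := by
  -- Up to divergences of bubbles and multiples of x^s y z, only the three pure powers remain. The
  -- values at the vertices eliminate these, and the functional I eliminates x^s y z.
  have hmem : ∀ p ∈ bernstein x y z (s + 2), ∃ α β γ : ℝ, p - (α • x ^ (s + 2) + β • y ^ (s + 2) +
      γ • z ^ (s + 2)) ∈ bubbleDiv (x * y * z) (s + 3) ⊔ Submodule.span ℝ {x ^ s * y * z} := by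
    intro p hp
    induction hp using Submodule.span_induction with
    | mem p hp =>
      obtain ⟨a, b, c, habc, rfl⟩ := hp
      by_cases h2 : a = s + 2
      · exact ⟨1, 0, 0, by simp [h2, show b = 0 by omega, show c = 0 by omega]⟩
      by_cases h3 : b = s + 2
      · exact ⟨0, 1, 0, by simp [h3, show a = 0 by omega, show c = 0 by omega]⟩
      by_cases h4 : c = s + 2
      · exact ⟨0, 0, 1, by simp [h4, show a = 0 by omega, show b = 0 by omega]⟩
      exact ⟨0, 0, 0, by simpa using h.monomial_mem habc h2 h3 h4⟩
    | zero => exact ⟨0, 0, 0, by simp⟩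
    | add p q _ _ hp hq =>
      obtain ⟨α, β, γ, h1⟩ := hp
      obtain ⟨α', β', γ', h2⟩ := hq
      refine ⟨α + α', β + β', γ + γ', ?_⟩
      convert add_mem h1 h2 using 1
      module
    | smul r p _ hp =>
      obtain ⟨α, β, γ, h1⟩ := hp
      refine ⟨r * α, r * β, r * γ, ?_⟩
      convert Submodule.smul_mem _ r h1 using 1
      module
  obtain ⟨α, β, γ, hαβγ⟩ := hmem q (mem_bernstein h.sum h.X_mem hq)
  obtain ⟨u, hu, w, hw, hsum⟩ := Submodule.mem_sup.1 hαβγ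
  obtain ⟨t, rfl⟩ := Submodule.mem_span_singleton.1 hw
  -- At a vertex two of the three coordinates vanish, so xyz vanishes there to second order and
  -- divergences of its multiples are zero.
  have hvan : ∀ V : Plane, evalAt V (x * y) = 0 → evalAt V (y * z) = 0 → evalAt V (x * z) = 0 →
      evalAt V u = 0 := by
    rintro V h1 h2 h3
    obtain ⟨v, -, hv, rfl⟩ := hu
    have hd : ∀ j, evalAt V (MvPolynomial.pderiv j (v j)) = 0 := by
      intro j
      obtain ⟨r, hr⟩ := hv j
      rw [hr]
      have e := fun p q : Poly => (MvPolynomial.pderiv j).leibniz p q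
      have hm : ∀ p q : Poly, evalAt V (p * q) = evalAt V p * evalAt V q := fun p q => map_mul _ p q
      simp only [e, smul_eq_mul, evalAt_add, hm] at h1 h2 h3 ⊢
      linear_combination (evalAt V z * evalAt V (MvPolynomial.pderiv j r) +
        evalAt V r * evalAt V (MvPolynomial.pderiv j z)) * h1 +
        evalAt V r * evalAt V (MvPolynomial.pderiv j x) * h2 +
        evalAt V r * evalAt V (MvPolynomial.pderiv j y) * h3
    rw [evalAt_add, hd, hd, add_zero]
  have hm : ∀ (V : Plane) (p q : Poly), evalAt V (p * q) = evalAt V p * evalAt V q :=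
    fun V p q => map_mul _ p q
  have hpw : ∀ (V : Plane) (p : Poly) (n : ℕ), evalAt V (p ^ n) = evalAt V p ^ n :=
    fun V p n => map_pow _ p n
  have hval : ∀ V : Plane, evalAt V (x * y) = 0 → evalAt V (y * z) = 0 → evalAt V (x * z) = 0 →
      evalAt V q = 0 → α * evalAt V x ^ (s + 2) + β * evalAt V y ^ (s + 2) +
        γ * evalAt V z ^ (s + 2) = 0 := by
    intro V h1 h2 h3 h4
    have h5 := congrArg (evalAt V) hsum
    have e : ∀ p q : Poly, evalAt V (p - q) = evalAt V p - evalAt V q := fun p q => map_sub _ p q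
    rw [mul_assoc, evalAt_add, hvan V h1 h2 h3, evalAt_smul, hm V (x ^ s), h2, e, h4] at h5
    simp only [evalAt_add, evalAt_smul, hpw] at h5
    linarith
  have hα := hval A (by simp [hm, hyA]) (by simp [hm, hyA]) (by simp [hm, hzA]) hA
  have hβ := hval B (by simp [hm, hxB]) (by simp [hm, hzB]) (by simp [hm, hxB]) hB
  have hγ := hval C (by simp [hm, hxC]) (by simp [hm, hyC]) (by simp [hm, hxC]) hC
  simp only [hxA, hyA, hzA, hxB, hyB, hzB, hxC, hyC, hzC, one_pow, mul_one,
    ne_eq, Nat.add_eq_zero_iff, OfNat.ofNat_ne_zero, and_false, not_false_eq_true, zero_pow,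
    mul_zero, add_zero, zero_add] at hα hβ hγ
  rw [hα, hβ, hγ, zero_smul, zero_smul, zero_smul, add_zero, add_zero, sub_zero] at hsum
  have ht : t = 0 := by
    have := congrArg I hsum
    rw [map_add, hI u hu, map_smul, hIq, zero_add, smul_eq_mul] at this
    exact (mul_eq_zero.1 this).resolve_right hI'
  rw [ht, zero_smul, add_zero] at hsum
  rwa [← hsum]

end

/-! ### Sobolev membership of piecewise polynomials as pointwise conformity. -/

section

variable {P : Polygon} {T : Mesh P}

/-! ### Piecewise polynomials as functions on the plane -/

theorem contDiff_evalAt (p : Poly) : ContDiff ℝ ∞ fun x : Plane => evalAt x p := by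
  induction p using MvPolynomial.induction_on with
  | C c => simpa using contDiff_const
  | add p q hp hq => simpa using hp.add hq
  | mul_X p i hp =>
    simp only [evalAt_mul, evalAt_X]
    exact hp.mul ((EuclideanSpace.proj i : Plane →L[ℝ] ℝ).contDiff)

theorem partialDeriv_evalAt (p : Poly) (i : Fin 2) :
    partialDeriv i (fun x : Plane => evalAt x p) = fun x => evalAt x (MvPolynomial.pderiv i p) := by
  have hd : ∀ (p : Poly) x, DifferentiableAt ℝ (fun x : Plane => evalAt x p) x := fun p x =>
    (contDiff_evalAt p).differentiable (by simp) x
  ext x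
  induction p using MvPolynomial.induction_on with
  | C c => simp [partialDeriv]
  | add p q hp hq =>
    simp only [partialDeriv, evalAt_add, map_add] at *
    rw [fderiv_fun_add (hd p x) (hd q x), add_apply, hp, hq]
  | mul_X p j hp =>
    have hX : HasFDerivAt (fun x : Plane => x j) (EuclideanSpace.proj j : Plane →L[ℝ] ℝ) x :=
      (EuclideanSpace.proj j : Plane →L[ℝ] ℝ).hasFDerivAt
    simp only [partialDeriv, evalAt_mul, evalAt_X, Derivation.leibniz, smul_eq_mul,
      evalAt_add] at *
    rw [((hd p x).hasFDerivAt.fun_mul hX).fderiv]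
    simp only [add_apply, smul_apply, smul_eq_mul, hp,
      MvPolynomial.pderiv_X]
    rcases eq_or_ne i j with rfl | hij
    · simp
    · simp [hij]

theorem toFun_of_mem {p : Broken T} {K : T.elems} {x : Plane} (hx : x ∈ interior (hull K)) :
    toFun T p x = evalAt x (p K) := by
  change (∑ K : T.elems, (interior (hull K)).indicator (fun x => evalAt x (p K))) x = _
  rw [Finset.sum_apply, Finset.sum_eq_single K]
  · rw [Set.indicator_of_mem hx]
  · intro L _ hL
    exact Set.indicator_of_notMem (fun h => hL (eq_of_mem_interior hx (interior_subset h)).symm) _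
  · simp

theorem toFun_of_forall_notMem {p : Broken T} {x : Plane}
    (hx : ∀ K : T.elems, x ∉ interior (hull K)) : toFun T p x = 0 := by
  change (∑ K : T.elems, (interior (hull K)).indicator (fun x => evalAt x (p K))) x = _
  rw [Finset.sum_apply]
  exact Finset.sum_eq_zero fun K _ => Set.indicator_of_notMem (hx K) _

theorem toFun_of_notMem_carrier {p : Broken T} {x : Plane} (hx : x ∉ P.carrier) :
    toFun T p x = 0 :=
  toFun_of_forall_notMem fun K h => hx (interior_hull_subset K h)

theorem measurable_toFun (p : Broken T) : Measurable (toFun T p) := by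
  change Measurable (∑ K : T.elems, (interior (hull K)).indicator (fun x => evalAt x (p K)))
  rw [Finset.sum_fn]
  exact Finset.measurable_fun_sum _ fun K _ =>
    (continuous_evalAt (p K)).measurable.indicator isOpen_interior.measurableSet

theorem exists_bound_evalAt (p : Broken T) : ∃ C, ∀ (K : T.elems), ∀ x ∈ hull K,
    |evalAt x (p K)| ≤ C := by
  have h : ∀ K : T.elems, ∃ C, ∀ x ∈ hull K, |evalAt x (p K)| ≤ C := fun K =>
    (isCompact_hull K).exists_bound_of_continuousOn (continuous_evalAt (p K)).continuousOn
  choose C hC using h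
  refine ⟨∑ K, |C K|, fun K x hx => (hC K x hx).trans ((le_abs_self _).trans ?_)⟩
  exact Finset.single_le_sum (f := fun K => |C K|) (fun _ _ => abs_nonneg _) (Finset.mem_univ K)

theorem exists_bound_toFun (p : Broken T) : ∃ C, ∀ x, |toFun T p x| ≤ C := by
  obtain ⟨C, hC⟩ := exists_bound_evalAt p
  refine ⟨|C|, fun x => ?_⟩
  by_cases h : ∃ K : T.elems, x ∈ interior (hull K)
  · obtain ⟨K, hK⟩ := h
    rw [toFun_of_mem hK]
    exact (hC K x (interior_subset hK)).trans (le_abs_self C)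
  · rw [toFun_of_forall_notMem (not_exists.1 h)]
    simp

theorem locallyIntegrable_toFun (p : Broken T) : LocallyIntegrable (toFun T p) := by
  obtain ⟨C, hC⟩ := exists_bound_toFun p
  exact locallyIntegrable_of_bounded (measurable_toFun p).aestronglyMeasurable hC

/-- Boundaries of convex sets are null sets, so the values assigned by `toFun` on edges play no
role. -/
theorem ae_mem_interior (T : Mesh P) :
    ∀ᵐ x : Plane, (∃ K : T.elems, x ∈ interior (hull K)) ∨ x ∉ closure P.carrier := by
  have h : ∀ᵐ x : Plane, ∀ K : T.elems, x ∉ frontier (hull K) := by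
    rw [ae_all_iff]
    intro K
    exact measure_eq_zero_iff_ae_notMem.1 ((convex_convexHull ℝ _).addHaar_frontier volume)
  filter_upwards [h] with x hx
  by_cases hx' : x ∈ closure P.carrier
  · obtain ⟨K, hK⟩ := exists_mem_hull (T := T) hx'
    refine Or.inl ⟨K, ?_⟩
    by_contra h
    exact hx K ⟨subset_closure hK, h⟩
  · exact Or.inr hx'

theorem ae_restrict_mem_interior (T : Mesh P) :
    ∀ᵐ x ∂volume.restrict P.carrier, ∃ K : T.elems, x ∈ interior (hull K) := by
  filter_upwards [ae_restrict_of_ae (ae_mem_interior T), ae_restrict_mem P.isOpen.measurableSet]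
    with x hx hx'
  exact hx.resolve_right fun h => h (subset_closure hx')

theorem toFun_eventuallyEq {p : Broken T} {K : T.elems} {x : Plane} (hx : x ∈ interior (hull K)) :
    toFun T p =ᶠ[𝓝 x] fun y => evalAt y (p K) := by
  filter_upwards [isOpen_interior.mem_nhds hx] with y hy using toFun_of_mem hy

theorem continuousAt_toFun {p : Broken T} {K : T.elems} {x : Plane} (hx : x ∈ interior (hull K)) :
    ContinuousAt (toFun T p) x :=
  (continuous_evalAt (p K)).continuousAt.congr (toFun_eventuallyEq hx).symm

theorem continuousAt_toFun_of_notMem {p : Broken T} {x : Plane} (hx : x ∉ closure P.carrier) :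
    ContinuousAt (toFun T p) x := by
  refine (continuousAt_const (y := (0 : ℝ))).congr ?_
  filter_upwards [isClosed_closure.isOpen_compl.mem_nhds hx] with y hy
  exact (toFun_of_notMem_carrier fun h => hy (subset_closure h)).symm

/-! ### Conforming piecewise polynomials -/

/-- The piecewise polynomial is continuous and vanishes on the boundary of the polygon. -/
structure IsConf (p : Broken T) : Prop where
  eq : ∀ (K L : T.elems) (x : Plane), x ∈ hull K → x ∈ hull L → evalAt x (p K) = evalAt x (p L)
  zero : ∀ (K : T.elems) (x : Plane), x ∈ hull K → x ∈ frontier P.carrier → evalAt x (p K) = 0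

open Classical in
/-- The continuous representative of a conforming piecewise polynomial, extended by zero. -/
def confFun (p : Broken T) (x : Plane) : ℝ :=
  if h : ∃ K : T.elems, x ∈ hull K then evalAt x (p h.choose) else 0

theorem IsConf.confFun_of_mem {p : Broken T} (hp : IsConf p) {K : T.elems} {x : Plane}
    (hx : x ∈ hull K) : confFun p x = evalAt x (p K) := by
  have h : ∃ K : T.elems, x ∈ hull K := ⟨K, hx⟩
  rw [confFun, dif_pos h]
  exact hp.eq _ _ x h.choose_spec hx

theorem IsConf.confFun_of_notMem {p : Broken T} (hp : IsConf p) {x : Plane}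
    (hx : x ∉ P.carrier) : confFun p x = 0 := by
  by_cases h : ∃ K : T.elems, x ∈ hull K
  · rw [confFun, dif_pos h]
    refine hp.zero _ x h.choose_spec ?_
    rw [frontier_carrier]
    exact ⟨hull_subset _ h.choose_spec, hx⟩
  · rw [confFun, dif_neg h]

theorem IsConf.confFun_ae_eq {p : Broken T} (hp : IsConf p) :
    confFun p =ᵐ[volume] toFun T p := by
  filter_upwards [ae_mem_interior T] with x hx
  rcases hx with ⟨K, hK⟩ | hx
  · rw [hp.confFun_of_mem (interior_subset hK), toFun_of_mem hK]
  · have hx' : x ∉ P.carrier := fun h => hx (subset_closure h)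
    rw [hp.confFun_of_notMem hx', toFun_of_notMem_carrier hx']

theorem IsConf.abs_toFun_le {p : Broken T} (hp : IsConf p) (x : Plane) :
    |toFun T p x| ≤ |confFun p x| := by
  by_cases h : ∃ K : T.elems, x ∈ interior (hull K)
  · obtain ⟨K, hK⟩ := h
    rw [hp.confFun_of_mem (interior_subset hK), toFun_of_mem hK]
  · rw [toFun_of_forall_notMem (not_exists.1 h), abs_zero]
    exact abs_nonneg _

/-- A function that is Lipschitz on each set of a finite closed cover is Lipschitz. -/
theorem abs_sub_le_of_closed_cover {ι : Type*} (A : ι → Set Plane) (hA : ∀ i, IsClosed (A i))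
    {F : Plane → ℝ} {C : ℝ} (hF : ∀ i, ∀ x ∈ A i, ∀ y ∈ A i, |F x - F y| ≤ C * ‖x - y‖)
    (s : Finset ι) : ∀ x y : Plane, (∀ t ∈ Set.Icc (0 : ℝ) 1, ∃ i ∈ s, x + t • (y - x) ∈ A i) →
      |F x - F y| ≤ C * ‖x - y‖ := by
  classical
  induction hn : s.card generalizing s with
  | zero =>
    intro x y h
    rw [Finset.card_eq_zero] at hn
    obtain ⟨i, hi, -⟩ := h 0 (by simp)
    simp [hn] at hi
  | succ n ih =>
    intro x y h
    obtain ⟨j, hj, hxj⟩ := h 0 (by simp)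
    have hc : Continuous fun t : ℝ => x + t • (y - x) := by fun_prop
    have hcomp : IsCompact (Set.Icc (0 : ℝ) 1 ∩ (fun t : ℝ => x + t • (y - x)) ⁻¹' A j) :=
      isCompact_Icc.inter_right ((hA j).preimage hc)
    -- The last parameter at which the segment is in `A j`. Up to it the bound on `A j` applies;
    -- beyond it the other sets suffice, and they contain the splitting point as well because they
    -- are closed.
    obtain ⟨t, ⟨ht, htj⟩, hmax⟩ := hcomp.exists_isGreatest ⟨0, by simp, hxj⟩
    have htj : x + t • (y - x) ∈ A j := htj
    set z := x + t • (y - x) with hz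
    have h1 : |F x - F z| ≤ C * (t * ‖x - y‖) := by
      have := hF j x (by simpa using hxj) z htj
      have e : x - z = t • (x - y) := by rw [hz]; module
      rwa [e, norm_smul, Real.norm_of_nonneg ht.1] at this
    rcases eq_or_lt_of_le ht.2 with h1' | hlt
    · have : z = y := by rw [hz, h1']; module
      rw [this, h1', one_mul] at h1
      exact h1
    have h2 : |F z - F y| ≤ C * ‖z - y‖ := by
      refine ih (s.erase j) (by rw [Finset.card_erase_of_mem hj, hn]; rfl) z y ?_
      have hcl : IsClosed (⋃ i ∈ s.erase j, A i) := by
        exact (s.erase j).finite_toSet.isClosed_biUnion fun i _ => hA i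
      have hIoo : Set.Ioc t 1 ⊆ (fun t : ℝ => x + t • (y - x)) ⁻¹' (⋃ i ∈ s.erase j, A i) := by
        intro r hr
        obtain ⟨i, hi, hri⟩ := h r ⟨ht.1.trans hr.1.le, hr.2⟩
        simp only [Set.mem_preimage, Set.mem_iUnion]
        refine ⟨i, Finset.mem_erase.2 ⟨?_, hi⟩, hri⟩
        rintro rfl
        exact absurd (hmax ⟨⟨ht.1.trans hr.1.le, hr.2⟩, hri⟩) (not_le.2 hr.1)
      have hIcc : Set.Icc t 1 ⊆ (fun t : ℝ => x + t • (y - x)) ⁻¹' (⋃ i ∈ s.erase j, A i) := by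
        rw [← closure_Ioc hlt.ne]
        exact closure_minimal hIoo (hcl.preimage hc)
      intro r hr
      have hmem : t + r * (1 - t) ∈ Set.Icc t 1 := by
        constructor <;> nlinarith [hr.1, hr.2]
      have := hIcc hmem
      simp only [Set.mem_preimage, Set.mem_iUnion] at this
      obtain ⟨i, hi, h3⟩ := this
      refine ⟨i, hi, ?_⟩
      convert h3 using 1
      rw [hz]
      module
    have e : z - y = (1 - t) • (x - y) := by rw [hz]; module
    rw [e, norm_smul, Real.norm_of_nonneg (by linarith)] at h2
    calc |F x - F y| = |(F x - F z) + (F z - F y)| := by ring_nf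
      _ ≤ |F x - F z| + |F z - F y| := abs_add_le _ _
      _ ≤ C * (t * ‖x - y‖) + C * ((1 - t) * ‖x - y‖) := add_le_add h1 h2
      _ = C * ‖x - y‖ := by ring

/-- Each polynomial is Lipschitz on its compact convex element. The complement of the domain, on
which the representative vanishes, is added as a further closed set (`none`), and every segment of
the plane is then covered. -/
theorem IsConf.exists_lipschitz {p : Broken T} (hp : IsConf p) :
    ∃ C : NNReal, LipschitzWith C (confFun p) := by
  have h : ∀ K : T.elems, ∃ C : NNReal, LipschitzOnWith C (fun x => evalAt x (p K)) (hull K) :=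
    fun K => ((contDiff_evalAt (p K)).contDiffOn).exists_lipschitzOnWith (by simp)
      (convex_convexHull ℝ _) (isCompact_hull K)
  choose C hC using h
  refine ⟨∑ K, C K, LipschitzWith.of_dist_le_mul fun x y => ?_⟩
  rw [Real.dist_eq, dist_eq_norm]
  refine abs_sub_le_of_closed_cover (fun o : Option T.elems => o.elim P.carrierᶜ hull) ?_ ?_
    Finset.univ x y ?_
  · rintro (_ | K)
    · exact P.isOpen.isClosed_compl
    · exact isClosed_hull K
  · rintro (_ | K) x hx y hy
    · rw [hp.confFun_of_notMem hx, hp.confFun_of_notMem hy]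
      simp only [sub_self, abs_zero]
      positivity
    · have hx : x ∈ hull K := hx
      have hy : y ∈ hull K := hy
      rw [hp.confFun_of_mem hx, hp.confFun_of_mem hy]
      have := (hC K).dist_le_mul x hx y hy
      rw [Real.dist_eq, dist_eq_norm] at this
      refine this.trans (mul_le_mul_of_nonneg_right ?_ (norm_nonneg _))
      exact_mod_cast Finset.single_le_sum (f := C) (fun _ _ => zero_le) (Finset.mem_univ K)
  · intro t _
    by_cases h : x + t • (y - x) ∈ P.carrier
    · obtain ⟨K, hK⟩ := exists_mem_hull (T := T) (subset_closure h)
      exact ⟨some K, Finset.mem_univ _, hK⟩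
    · exact ⟨none, Finset.mem_univ _, h⟩

/-- The representative is Lipschitz on the plane, so its line derivatives are its weak derivatives,
and almost everywhere they can be read off from a single polynomial or from zero. -/
theorem IsConf.hasWeakPartial {p : Broken T} (hp : IsConf p) (i : Fin 2) :
    HasWeakPartial Set.univ i (toFun T p) (toFun T (pd T i p)) := by
  obtain ⟨C, hC⟩ := hp.exists_lipschitz
  refine (lipschitz_hasWeakPartial hC i).congr_ae (by simpa using hp.confFun_ae_eq) ?_
  rw [Measure.restrict_univ]
  filter_upwards [ae_mem_interior T] with x hx
  rcases hx with ⟨K, hK⟩ | hx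
  · rw [toFun_of_mem hK]
    have h : confFun p =ᶠ[𝓝 x] fun y => evalAt y (p K) := by
      filter_upwards [isOpen_interior.mem_nhds hK] with y hy
        using hp.confFun_of_mem (interior_subset hy)
    have hd : DifferentiableAt ℝ (fun y => evalAt y (p K)) x :=
      (contDiff_evalAt (p K)).differentiable (by simp) x
    rw [h.lineDeriv_eq, hd.lineDeriv_eq_fderiv]
    exact congrFun (partialDeriv_evalAt (p K) i) x
  · have hx' : x ∉ P.carrier := fun h => hx (subset_closure h)
    have h : confFun p =ᶠ[𝓝 x] fun _ => 0 := by
      filter_upwards [isClosed_closure.isOpen_compl.mem_nhds hx] with y hy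
        using hp.confFun_of_notMem fun h => hy (subset_closure h)
    rw [h.lineDeriv_eq, toFun_of_notMem_carrier hx']
    simp [lineDeriv]

theorem compl_carrier_nonempty : (P.carrierᶜ).Nonempty := by
  by_contra h
  rw [Set.not_nonempty_iff_eq_empty, Set.compl_empty_iff] at h
  exact NormedSpace.unbounded_univ ℝ Plane (h ▸ P.isBounded)

/-- The Lipschitz estimate is applied between x and the nearest point of the complement, where the
function is zero. -/
theorem IsConf.exists_abs_le_infDist {p : Broken T} (hp : IsConf p) :
    ∃ C : ℝ, 0 ≤ C ∧ ∀ x, |confFun p x| ≤ C * Metric.infDist x P.carrierᶜ := by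
  obtain ⟨C, hC⟩ := hp.exists_lipschitz
  refine ⟨C, C.2, fun x => ?_⟩
  obtain ⟨y, hy, hxy⟩ := P.isOpen.isClosed_compl.exists_infDist_eq_dist compl_carrier_nonempty x
  have := hC.dist_le_mul x y
  rwa [hp.confFun_of_notMem hy, Real.dist_eq, sub_zero, ← hxy] at this

theorem IsConf.locallyIntegrable {p : Broken T} (hp : IsConf p) : LocallyIntegrable (confFun p) := by
  obtain ⟨C, hC⟩ := hp.exists_lipschitz
  exact hC.continuous.locallyIntegrable

theorem IsConf.hasWeakPartial_confFun {p : Broken T} (hp : IsConf p) {i : Fin 2}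
    (hpi : IsConf (pd T i p)) : HasWeakPartial Set.univ i (confFun p) (confFun (pd T i p)) :=
  (hp.hasWeakPartial i).congr_ae (by simpa using hp.confFun_ae_eq.symm)
    (by simpa using hpi.confFun_ae_eq.symm)

/-- The gradient is bounded by a multiple of the distance to the complement, and the function
vanishes at the nearest point y. The mean value inequality on the ball around y through x then
yields a second factor of the distance. It is applied to mollifications, since only weak derivatives
are at hand. -/
theorem IsConf.exists_abs_le_infDist_sq {p : Broken T} (hp : IsConf p)
    (hp' : ∀ i, IsConf (pd T i p)) :
    ∃ C : ℝ, 0 ≤ C ∧ ∀ x, |confFun p x| ≤ C * Metric.infDist x P.carrierᶜ ^ 2 := by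
  choose D hD0 hD using fun i => (hp' i).exists_abs_le_infDist
  set C := D 0 + D 1 with hCdef
  have hC0 : 0 ≤ C := add_nonneg (hD0 0) (hD0 1)
  have hC : ∀ i x, |confFun (pd T i p) x| ≤ C * Metric.infDist x P.carrierᶜ := by
    intro i x
    refine (hD i x).trans (mul_le_mul_of_nonneg_right ?_ Metric.infDist_nonneg)
    fin_cases i
    · exact le_add_of_nonneg_right (hD0 1)
    · exact le_add_of_nonneg_left (hD0 0)
  refine ⟨2 * C, by positivity, fun x => ?_⟩
  obtain ⟨y, hy, hxy⟩ := P.isOpen.isClosed_compl.exists_infDist_eq_dist compl_carrier_nonempty x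
  rw [hxy]
  obtain ⟨L, hL⟩ := hp.exists_lipschitz
  have hε : ∀ n : ℕ, 0 < 1 / ((n : ℝ) + 1) := fun n => by positivity
  have hε0 := tendsto_one_div_add_atTop_nhds_zero_nat (𝕜 := ℝ)
  have h1 := tendsto_conv_mollifier hp.locallyIntegrable.aestronglyMeasurable
    (hL.continuous.continuousAt (x := x)) hε hε0
  have h2 := tendsto_conv_mollifier hp.locallyIntegrable.aestronglyMeasurable
    (hL.continuous.continuousAt (x := y)) hε hε0
  -- The summand 0 is the limit of the mollification radius, by which the ball has to be enlarged.
  have h3 : |confFun p x - confFun p y| ≤ 2 * (C * (dist x y + 0)) * ‖x - y‖ := by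
    refine le_of_tendsto_of_tendsto (h1.sub h2).abs
      (((tendsto_const_nhds.add hε0).const_mul C |>.const_mul 2).mul_const ‖x - y‖)
      (Eventually.of_forall fun n => ?_)
    refine abs_conv_mollifier_sub_conv_le hp.locallyIntegrable
      (fun i => (hp' i).locallyIntegrable.aestronglyMeasurable)
      (fun i => hp.hasWeakPartial_confFun (hp' i)) (hε n)
      (convex_closedBall y (dist x y)) (fun i z hz w hw => ?_) (by simp) (by simp)
    refine (hC i w).trans (mul_le_mul_of_nonneg_left ?_ hC0)
    have h4 := Metric.infDist_le_dist_of_mem (x := w) hy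
    have h5 := dist_triangle w z y
    rw [Metric.mem_closedBall] at hz
    linarith
  rw [hp.confFun_of_notMem hy, sub_zero, add_zero, ← dist_eq_norm] at h3
  calc _ ≤ _ := h3
    _ = _ := by ring

theorem ae_continuousAt_toFun (p : Broken T) :
    ∀ᵐ x ∂volume.restrict P.carrier, ContinuousAt (toFun T p) x := by
  filter_upwards [ae_restrict_mem_interior T] with x ⟨K, hK⟩ using continuousAt_toFun hK

/-- Conforming piecewise polynomials lie in `H¹₀(Ω)`. -/
theorem IsConf.memSobolevZero_one {p : Broken T} (hp : IsConf p) :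
    MemSobolevZero P.carrier 1 (toFun T p) := by
  obtain ⟨C, hC0, hC⟩ := hp.exists_abs_le_infDist
  have hf : ∀ x, |toFun T p x| ≤ C * Metric.infDist x P.carrierᶜ ^ 1 := fun x => by
    rw [pow_one]
    exact (hp.abs_toFun_le x).trans (hC x)
  have key : ∀ (q : Broken T) (l : List (Fin 2)), l.length ≤ 1 →
      (∀ ε, 0 < ε → conv (iterPartial l (mollifier ε)) (toFun T p) =
        conv (mollifier ε) (toFun T q)) →
      TendstoL2 P.carrier (fun n => iterPartial l (cutoffSeq P.carrier (toFun T p) n))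
        (toFun T q) := fun q l hl h =>
    tendstoL2_cutoffSeq P.isOpen P.isBounded hC0 (locallyIntegrable_toFun p) hf
      (measurable_toFun q).aestronglyMeasurable (exists_bound_toFun q).choose_spec
      (ae_continuousAt_toFun q) hl h
  refine ⟨_, fun n => isTest_cutoffSeq P.isBounded (locallyIntegrable_toFun p) n,
    key p [] (by simp) fun ε _ => rfl, fun i => ⟨toFun T (pd T i p),
      (hp.hasWeakPartial i).mono (Set.subset_univ _), key (pd T i p) [i] (by simp) fun ε hε => ?_⟩⟩
  exact (hp.hasWeakPartial i).conv_partialDeriv (isTest_mollifier hε)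

theorem pd_comm (i j : Fin 2) (p : Broken T) : pd T i (pd T j p) = pd T j (pd T i p) := by
  ext1 K
  exact pderiv_comm i j (p K)

/-- Conforming piecewise polynomials with conforming gradient lie in `H²₀(Ω)`. -/
theorem IsConf.memSobolevZero_two {p : Broken T} (hp : IsConf p) (hp' : ∀ i, IsConf (pd T i p)) :
    MemSobolevZero P.carrier 2 (toFun T p) := by
  obtain ⟨C, hC0, hC⟩ := hp.exists_abs_le_infDist_sq hp'
  have hf : ∀ x, |toFun T p x| ≤ C * Metric.infDist x P.carrierᶜ ^ 2 := fun x =>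
    (hp.abs_toFun_le x).trans (hC x)
  have key : ∀ (q : Broken T) (l : List (Fin 2)), l.length ≤ 2 →
      (∀ ε, 0 < ε → conv (iterPartial l (mollifier ε)) (toFun T p) =
        conv (mollifier ε) (toFun T q)) →
      TendstoL2 P.carrier (fun n => iterPartial l (cutoffSeq P.carrier (toFun T p) n))
        (toFun T q) := fun q l hl h =>
    tendstoL2_cutoffSeq P.isOpen P.isBounded hC0 (locallyIntegrable_toFun p) hf
      (measurable_toFun q).aestronglyMeasurable (exists_bound_toFun q).choose_spec
      (ae_continuousAt_toFun q) hl h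
  refine ⟨_, fun n => isTest_cutoffSeq P.isBounded (locallyIntegrable_toFun p) n,
    key p [] (by simp) fun ε _ => rfl, fun i => ⟨toFun T (pd T i p),
      (hp.hasWeakPartial i).mono (Set.subset_univ _), key (pd T i p) [i] (by simp) fun ε hε => ?_,
      fun j => ⟨toFun T (pd T j (pd T i p)), ((hp' i).hasWeakPartial j).mono (Set.subset_univ _),
        key (pd T j (pd T i p)) [j, i] (by simp) fun ε hε => ?_⟩⟩⟩
  · exact (hp.hasWeakPartial i).conv_partialDeriv (isTest_mollifier hε)
  -- The kernel carries ∂ⱼ outermost, so ∂ⱼ moves to p first and ∂ᵢ to ∂ⱼp afterwards; commuting the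
  -- elementwise derivatives matches this order.
  · rw [pd_comm, ← ((hp' j).hasWeakPartial i).conv_partialDeriv (isTest_mollifier hε)]
    exact (hp.hasWeakPartial j).conv_partialDeriv ((isTest_mollifier hε).partialDeriv i)

/-! ### Traces of functions in `H¹₀` -/

theorem integral_evalAt_mul_partialDeriv (p : Poly) {Ω : Set Plane} {ψ : Plane → ℝ}
    (hψ : IsTest Ω ψ) (i : Fin 2) :
    ∫ x, evalAt x p * partialDeriv i ψ x = -∫ x, evalAt x (MvPolynomial.pderiv i p) * ψ x := by
  have h := integral_mul_fderiv_eq_neg_fderiv_mul_of_integrable (μ := volume)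
    (f := fun x => evalAt x p) (g := ψ) (v := EuclideanSpace.single i (1 : ℝ)) ?_ ?_ ?_
    (fun x _ => (contDiff_evalAt p).differentiable (by simp) x)
    (fun x _ => hψ.smooth.differentiable (by simp) x)
  · have e : ∀ x, fderiv ℝ (fun x => evalAt x p) x (EuclideanSpace.single i 1) =
        evalAt x (MvPolynomial.pderiv i p) := fun x => congrFun (partialDeriv_evalAt p i) x
    simp only [e] at h
    exact h
  · have e : ∀ x, fderiv ℝ (fun x => evalAt x p) x (EuclideanSpace.single i 1) =
        evalAt x (MvPolynomial.pderiv i p) := fun x => congrFun (partialDeriv_evalAt p i) x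
    simp only [e]
    exact ((continuous_evalAt _).mul hψ.smooth.continuous).integrable_of_hasCompactSupport
      hψ.compact.mul_left
  · exact ((continuous_evalAt _).mul (hψ.partialDeriv i).smooth.continuous
      ).integrable_of_hasCompactSupport (hψ.partialDeriv i).compact.mul_left
  · exact ((continuous_evalAt _).mul hψ.smooth.continuous).integrable_of_hasCompactSupport
      hψ.compact.mul_left

/-- Weak derivatives of piecewise polynomials are computed elementwise. -/
theorem HasWeakPartial.ae_eq_toFun {p : Broken T} {i : Fin 2} {g : Plane → ℝ}
    (h : HasWeakPartial P.carrier i (toFun T p) g) (hg : MemLp g 2 (volume.restrict P.carrier)) :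
    g =ᵐ[volume.restrict P.carrier] toFun T (pd T i p) := by
  have hgi : IntegrableOn g P.carrier := hg.integrable (by norm_num)
  have key : ∀ K : T.elems, ∀ᵐ x, x ∈ interior (hull K) →
      g x - evalAt x (MvPolynomial.pderiv i (p K)) = 0 := by
    intro K
    have hi : IntegrableOn (fun x => g x - evalAt x (MvPolynomial.pderiv i (p K)))
        (interior (hull K)) := by
      refine (hgi.mono_set (interior_hull_subset K)).sub ?_
      exact ((continuous_evalAt _).continuousOn.integrableOn_compact (isCompact_hull K)).mono_set
        interior_subset
    -- Test functions supported inside one element see a single polynomial, for which integration by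
    -- parts is classical.
    refine isOpen_interior.ae_eq_zero_of_integral_contDiff_smul_eq_zero hi.locallyIntegrableOn
      fun ψ h1 h2 h3 => ?_
    have hψ : IsTest P.carrier ψ := ⟨h1, h2, h3.trans (interior_hull_subset K)⟩
    have hz : ∀ x ∉ interior (hull K), ψ x = 0 := fun x hx =>
      image_eq_zero_of_notMem_tsupport fun h => hx (h3 h)
    have hz' : ∀ x ∉ interior (hull K), StokesFE.partialDeriv i ψ x = 0 := fun x hx =>
      image_eq_zero_of_notMem_tsupport fun h => hx (h3 (tsupport_fderiv_apply_subset ℝ _ h))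
    have e1 : ∫ x in P.carrier, toFun T p x * StokesFE.partialDeriv i ψ x =
        ∫ x, evalAt x (p K) * StokesFE.partialDeriv i ψ x := by
      rw [setIntegral_eq_integral_of_forall_compl_eq_zero]
      · refine integral_congr_ae (ae_of_all _ fun x => ?_)
        by_cases hx : x ∈ interior (hull K)
        · simp only [toFun_of_mem hx]
        · simp only [hz' x hx, mul_zero]
      · intro x hx
        rw [toFun_of_notMem_carrier hx, zero_mul]
    have e2 : ∫ x in P.carrier, g x * ψ x = ∫ x, g x * ψ x := by
      rw [setIntegral_eq_integral_of_forall_compl_eq_zero]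
      intro x hx
      rw [hz x fun h => hx (interior_hull_subset K h), mul_zero]
    have h4 := h ψ hψ
    rw [e1, e2, integral_evalAt_mul_partialDeriv _ hψ, neg_inj] at h4
    have i1 : Integrable fun x => g x * ψ x := by
      have : IntegrableOn (fun x => g x * ψ x) P.carrier := hg.integrable_mul hψ.memLp
      refine (integrableOn_iff_integrable_of_support_subset fun x hx => ?_).1 this
      by_contra hx'
      exact hx (by simp [hz x fun h => hx' (interior_hull_subset K h)])
    have i2 : Integrable fun x => evalAt x (MvPolynomial.pderiv i (p K)) * ψ x :=
      ((continuous_evalAt _).mul hψ.smooth.continuous).integrable_of_hasCompactSupport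
        hψ.compact.mul_left
    have e3 : ∀ x, ψ x • (g x - evalAt x (MvPolynomial.pderiv i (p K))) =
        g x * ψ x - evalAt x (MvPolynomial.pderiv i (p K)) * ψ x := fun x => by
      rw [smul_eq_mul]; ring
    simp only [e3]
    rw [integral_sub i1 i2, h4, sub_self]
  have hall := ae_all_iff.2 key
  filter_upwards [ae_restrict_of_ae hall, ae_restrict_mem_interior T] with x hx ⟨K, hK⟩
  rw [toFun_of_mem hK]
  exact sub_eq_zero.1 (hx K hK)

theorem TendstoL2.congr_ae {Ω : Set Plane} {u : ℕ → Plane → ℝ} {f f' : Plane → ℝ}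
    (h : TendstoL2 Ω u f) (hf : f =ᵐ[volume.restrict Ω] f') : TendstoL2 Ω u f' := by
  refine ⟨(memLp_congr_ae hf).1 h.1, h.2.congr fun n => eLpNorm_congr_ae ?_⟩
  filter_upwards [hf] with x hx
  simp [hx]

theorem TendstoSobolev.congr_ae {Ω : Set Plane} {m : ℕ} {u : ℕ → Plane → ℝ} {f f' : Plane → ℝ}
    (h : TendstoSobolev Ω m u f) (hf : f =ᵐ[volume.restrict Ω] f') : TendstoSobolev Ω m u f' := by
  cases m with
  | zero => exact TendstoL2.congr_ae h hf
  | succ m =>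
    refine ⟨h.1.congr_ae hf, fun i => ?_⟩
    obtain ⟨g, hg, hg'⟩ := h.2 i
    exact ⟨g, hg.congr_ae hf ae_eq_rfl, hg'⟩

theorem TendstoSobolev.memSobolev {Ω : Set Plane} {m : ℕ} : ∀ {u : ℕ → Plane → ℝ} {f : Plane → ℝ},
    TendstoSobolev Ω m u f → MemSobolev Ω m f := by
  induction m with
  | zero => exact fun h => h.1
  | succ m ih =>
    intro u f h
    refine ⟨h.1.1, fun i => ?_⟩
    obtain ⟨g, hg, hg'⟩ := h.2 i
    exact ⟨g, hg, ih hg'⟩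

theorem MemSobolevZero.memSobolev {Ω : Set Plane} {m : ℕ} {f : Plane → ℝ}
    (h : MemSobolevZero Ω m f) : MemSobolev Ω m f :=
  h.choose_spec.2.memSobolev

/-- Piecewise polynomials in `H¹₀(Ω)` have elementwise weak derivatives on the whole plane. -/
theorem MemSobolevZero.hasWeakPartial_toFun {p : Broken T}
    (h : MemSobolevZero P.carrier 1 (toFun T p)) (i : Fin 2) :
    HasWeakPartial Set.univ i (toFun T p) (toFun T (pd T i p)) := by
  obtain ⟨u, hu, h0, h1⟩ := h
  obtain ⟨g, hg, hg'⟩ := h1 i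
  have hg' : TendstoL2 P.carrier (fun n => StokesFE.partialDeriv i (u n)) g := hg'
  exact hasWeakPartial_univ_of_tendsto hu h0 (hg'.congr_ae (hg.ae_eq_toFun hg'.1))
    (fun x hx => toFun_of_notMem_carrier hx) (fun x hx => toFun_of_notMem_carrier hx)

theorem MemSobolevZero.pd {p : Broken T} (h : MemSobolevZero P.carrier 2 (toFun T p)) (i : Fin 2) :
    MemSobolevZero P.carrier 1 (toFun T (pd T i p)) := by
  obtain ⟨u, hu, h0, h1⟩ := h
  obtain ⟨g, hg, hg'⟩ := h1 i
  exact ⟨_, fun n => (hu n).partialDeriv i, hg'.congr_ae (hg.ae_eq_toFun hg'.tendstoL2.1)⟩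

theorem MemSobolevZero.one_of_two {f : Plane → ℝ} {Ω : Set Plane} (h : MemSobolevZero Ω 2 f) :
    MemSobolevZero Ω 1 f := by
  obtain ⟨u, hu, h0, h1⟩ := h
  refine ⟨u, hu, h0, fun i => ?_⟩
  obtain ⟨g, hg, hg'⟩ := h1 i
  exact ⟨g, hg, hg'.tendstoL2⟩

theorem abs_toFun_sub_le {p : Broken T}
    (h : ∀ i, HasWeakPartial Set.univ i (toFun T p) (toFun T (pd T i p))) {C : ℝ}
    (hC : ∀ i w, |toFun T (pd T i p) w| ≤ C) {x y : Plane} (hx : ContinuousAt (toFun T p) x)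
    (hy : ContinuousAt (toFun T p) y) : |toFun T p x - toFun T p y| ≤ 2 * C * ‖x - y‖ :=
  abs_sub_le_of_hasWeakPartial (locallyIntegrable_toFun p)
    (fun i => (measurable_toFun (pd T i p)).aestronglyMeasurable) h hC hx hy

/-- The domain lies on one side of its boundary: there are no slits, so every point outside it is a
limit of exterior points. -/
theorem mem_closure_exterior {x : Plane} (hx : x ∉ P.carrier) :
    x ∈ closure (closure P.carrier)ᶜ := by
  rw [closure_compl, P.interior_closure]
  exact hx

/-- Piecewise polynomials in `H¹₀(Ω)` are conforming. -/
theorem MemSobolevZero.isConf {p : Broken T} (h : MemSobolevZero P.carrier 1 (toFun T p)) :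
    IsConf p := by
  choose D hD using fun i => exists_bound_toFun (StokesFE.pd T i p)
  have hC : ∀ i w, |toFun T (StokesFE.pd T i p) w| ≤ |D 0| + |D 1| := by
    intro i w
    refine (hD i w).trans ((le_abs_self _).trans ?_)
    fin_cases i
    · exact le_add_of_nonneg_right (abs_nonneg _)
    · exact le_add_of_nonneg_left (abs_nonneg _)
  have hlip := fun x y => abs_toFun_sub_le (x := x) (y := y) h.hasWeakPartial_toFun hC
  set C := 2 * (|D 0| + |D 1|)
  constructor
  · intro K L x hxK hxL
    -- The Lipschitz bound between interior points of K and L is a closed condition, hence extends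
    -- to K × L, where both arguments can be set equal to x.
    have hcl : IsClosed {z : Plane × Plane |
        |evalAt z.1 (p K) - evalAt z.2 (p L)| ≤ C * ‖z.1 - z.2‖} :=
      isClosed_le (((continuous_evalAt (p K)).comp continuous_fst).sub
        ((continuous_evalAt (p L)).comp continuous_snd)).abs (by fun_prop)
    have hsub : interior (hull K) ×ˢ interior (hull L) ⊆ {z : Plane × Plane |
        |evalAt z.1 (p K) - evalAt z.2 (p L)| ≤ C * ‖z.1 - z.2‖} := by
      rintro ⟨y, z⟩ ⟨hy, hz⟩
      have := hlip y z (continuousAt_toFun hy) (continuousAt_toFun hz)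
      rwa [toFun_of_mem hy, toFun_of_mem hz] at this
    have h2 := closure_minimal hsub hcl
    rw [closure_prod_eq] at h2
    have := h2 (Set.mk_mem_prod (hull_subset_closure_interior K hxK)
      (hull_subset_closure_interior L hxL))
    simp only [Set.mem_ofPred_eq, sub_self, norm_zero, mul_zero, abs_nonpos_iff] at this
    exact sub_eq_zero.1 this
  · intro K x hxK hxΓ
    -- The same argument with exterior points, where the function vanishes, in place of the second
    -- element.
    have hcl : IsClosed {z : Plane × Plane | |evalAt z.1 (p K)| ≤ C * ‖z.1 - z.2‖} :=
      isClosed_le ((continuous_evalAt (p K)).comp continuous_fst).abs (by fun_prop)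
    have hsub : interior (hull K) ×ˢ (closure P.carrier)ᶜ ⊆ {z : Plane × Plane |
        |evalAt z.1 (p K)| ≤ C * ‖z.1 - z.2‖} := by
      rintro ⟨y, z⟩ ⟨hy, hz⟩
      have := hlip y z (continuousAt_toFun hy) (continuousAt_toFun_of_notMem hz)
      rwa [toFun_of_mem hy, toFun_of_notMem_carrier fun h => hz (subset_closure h), sub_zero] at this
    have h2 := closure_minimal hsub hcl
    rw [closure_prod_eq] at h2
    rw [frontier_carrier] at hxΓ
    have := h2 (Set.mk_mem_prod (hull_subset_closure_interior K hxK) (mem_closure_exterior hxΓ.2))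
    simpa only [Set.mem_ofPred_eq, sub_self, norm_zero, mul_zero, abs_nonpos_iff] using this

theorem memSobolevZero_one_iff {p : Broken T} :
    MemSobolevZero P.carrier 1 (toFun T p) ↔ IsConf p :=
  ⟨MemSobolevZero.isConf, IsConf.memSobolevZero_one⟩

theorem memSobolevZero_two_iff {p : Broken T} :
    MemSobolevZero P.carrier 2 (toFun T p) ↔ IsConf p ∧ ∀ i, IsConf (pd T i p) :=
  ⟨fun h => ⟨h.one_of_two.isConf, fun i => (h.pd i).isConf⟩,
    fun h => h.1.memSobolevZero_two h.2⟩

/-- A conforming piecewise polynomial with vanishing gradient is zero. -/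
theorem IsConf.eq_zero_of_pd_eq_zero {p : Broken T} (hp : IsConf p) (h : ∀ i, pd T i p = 0) :
    p = 0 := by
  ext1 K
  refine poly_eq_zero_of_isOpen isOpen_interior (interior_hull_nonempty K) fun x hx => ?_
  obtain ⟨y, hy⟩ : (closure P.carrier)ᶜ.Nonempty := by
    obtain ⟨z, hz⟩ := compl_carrier_nonempty (P := P)
    exact closure_nonempty_iff.1 ⟨z, mem_closure_exterior hz⟩
  -- With Lipschitz constant zero, the values inside K equal the value zero at an exterior point.
  have := abs_toFun_sub_le hp.hasWeakPartial (C := 0) (fun i w => by simp [h i])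
    (continuousAt_toFun hx) (continuousAt_toFun_of_notMem hy)
  rw [toFun_of_mem hx, toFun_of_notMem_carrier fun h => hy (subset_closure h)] at this
  simpa using this

/-- The integral of a derivative of a conforming piecewise polynomial vanishes. -/
theorem IsConf.integral_pd {p : Broken T} (hp : IsConf p) (i : Fin 2) :
    ∫ x in P.carrier, toFun T (pd T i p) x = 0 := by
  obtain ⟨r, hr, hball⟩ := P.isBounded.subset_ball_lt 0 0
  -- A bump equal to 1 on the polygon: testing against it produces the integral on one side, and
  -- zero on the other because its derivative vanishes there.
  let b : ContDiffBump (0 : Plane) := ⟨r, r + 1, hr, by linarith⟩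
  have hb : IsTest Set.univ b := ⟨b.contDiff, b.hasCompactSupport, Set.subset_univ _⟩
  have h := hp.hasWeakPartial i b hb
  simp only [Measure.restrict_univ] at h
  have e1 : ∫ x, toFun T p x * partialDeriv i b x = 0 := by
    refine integral_eq_zero_of_ae (ae_of_all _ fun x => ?_)
    by_cases hx : x ∈ P.carrier
    · have : b =ᶠ[𝓝 x] fun _ => (1 : ℝ) := by
        filter_upwards [Metric.isOpen_ball.mem_nhds (hball hx)] with y hy
        exact b.one_of_mem_closedBall (Metric.ball_subset_closedBall hy)
      simp [partialDeriv, this.fderiv_eq]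
    · simp [toFun_of_notMem_carrier hx]
  have e2 : ∫ x, toFun T (pd T i p) x * b x = ∫ x in P.carrier, toFun T (pd T i p) x := by
    rw [← setIntegral_eq_integral_of_forall_compl_eq_zero (s := P.carrier)]
    · refine setIntegral_congr_fun P.isOpen.measurableSet fun x hx => ?_
      rw [b.one_of_mem_closedBall (Metric.ball_subset_closedBall (hball hx)), mul_one]
    · intro x hx
      rw [toFun_of_notMem_carrier hx, zero_mul]
  rw [e1, e2] at h
  linarith

end

/-! ### Local geometry of the boundary and connectivity of the mesh. -/

section

variable {P : Polygon} {T : Mesh P}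

/-! ### The boundary of a polygon -/

/-- The side of the polygon that starts at the given vertex. -/
def side (P : Polygon) (i : ZMod P.n) : Set Plane := segment ℝ (P.vertex i) (P.vertex (i + 1))

theorem isClosed_side (i : ZMod P.n) : IsClosed (side P i) := by
  rw [side, ← convexHull_pair]
  exact (Set.toFinite _).isClosed_convexHull ℝ

theorem mem_frontier_iff {x : Plane} : x ∈ frontier P.carrier ↔ ∃ i, x ∈ side P i := by
  rw [P.frontier_eq, Set.mem_iUnion]
  rfl

theorem vertex_ne (i : ZMod P.n) : P.vertex i ≠ P.vertex (i + 1) := by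
  have := (P.corner i).injective.ne (show (0 : Fin 3) ≠ 1 by decide)
  simpa using this

/-- Two sides meet at most in a corner. -/
theorem eq_vertex_of_mem_side {i j : ZMod P.n} (hij : i ≠ j) {x : Plane} (hi : x ∈ side P i)
    (hj : x ∈ side P j) : (j = i + 1 ∧ x = P.vertex j) ∨ (i = j + 1 ∧ x = P.vertex i) := by
  have hadj : ∀ {i : ZMod P.n}, x ∈ side P i → x ∈ side P (i + 1) → x = P.vertex (i + 1) := by
    intro i h1 h2
    have h3 := P.adjacent i
    have e : i + 1 + 1 = i + 2 := by ring
    rw [side, e] at h2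
    have : x ∈ ({P.vertex (i + 1)} : Set Plane) := h3 ▸ ⟨h1, h2⟩
    exact this
  by_cases h1 : j = i + 1
  · subst h1
    exact Or.inl ⟨rfl, hadj hi hj⟩
  by_cases h2 : i = j + 1
  · subst h2
    exact Or.inr ⟨rfl, hadj hj hi⟩
  exact absurd (P.nonadjacent i j hij.symm h1 h2) (Set.not_disjoint_iff.2 ⟨x, hi, hj⟩)

instance (P : Polygon) : NeZero P.n := ⟨by have := P.three_le; omega⟩

/-- Near a noncorner point of a side, the boundary coincides with that side. -/
theorem eventually_mem_side {a : Plane} (ha : ¬P.IsCorner a) {i : ZMod P.n} (hi : a ∈ side P i) :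
    ∀ᶠ x in 𝓝 a, x ∈ frontier P.carrier → x ∈ side P i := by
  have h : ∀ᶠ x in 𝓝 a, ∀ j : ZMod P.n, j ≠ i → x ∉ side P j := by
    rw [eventually_all]
    intro j
    by_cases hj : j = i
    · simp [hj]
    · have : a ∉ side P j := by
        intro h
        rcases eq_vertex_of_mem_side hj h hi with ⟨-, h⟩ | ⟨-, h⟩
        · exact ha ⟨_, h.symm⟩
        · exact ha ⟨_, h.symm⟩
      filter_upwards [(isClosed_side j).isOpen_compl.mem_nhds this] with x hx _ using hx
  filter_upwards [h] with x hx hxΓ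
  obtain ⟨j, hj⟩ := mem_frontier_iff.1 hxΓ
  by_cases hji : j = i
  · rwa [← hji]
  · exact absurd hj (hx j hji)

theorem exists_smul_of_mem_segment {a b x y : Plane} (hx : x ∈ segment ℝ a b)
    (hy : y ∈ segment ℝ a b) : ∃ s : ℝ, y - x = s • (b - a) := by
  obtain ⟨t, -, rfl⟩ := (segment_eq_image_lineMap ℝ a b) ▸ hx
  obtain ⟨t', -, rfl⟩ := (segment_eq_image_lineMap ℝ a b) ▸ hy
  refine ⟨t' - t, ?_⟩
  simp only [AffineMap.lineMap_apply, vsub_eq_sub, vadd_eq_add]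
  module

/-- At a noncorner point there is a direction orthogonal to all boundary segments. -/
theorem exists_normal {a : Plane} (ha : ¬P.IsCorner a) :
    ∃ g : Fin 2 → ℝ, 0 < g 0 * g 0 + g 1 * g 1 ∧ ∀ b, segment ℝ a b ⊆ frontier P.carrier →
      g 0 * (b 0 - a 0) + g 1 * (b 1 - a 1) = 0 := by
  by_cases haΓ : a ∈ frontier P.carrier
  · obtain ⟨i, hi⟩ := mem_frontier_iff.1 haΓ
    set d := P.vertex (i + 1) - P.vertex i with hd
    have hd0 : d ≠ 0 := sub_ne_zero.2 (vertex_ne i).symm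
    -- The direction of the side through a, rotated by a right angle.
    refine ⟨![-(d 1), d 0], ?_, fun b hb => ?_⟩
    · simp only [Matrix.cons_val_zero, Matrix.cons_val_one]
      by_contra hneg
      apply hd0
      have h0 : d 0 = 0 := by nlinarith [sq_nonneg (d 0), sq_nonneg (d 1)]
      have h1 : d 1 = 0 := by nlinarith [sq_nonneg (d 0), sq_nonneg (d 1)]
      ext j
      fin_cases j
      · exact h0
      · exact h1
    -- A short initial piece of the segment is close to a, hence lies on the same side of the
    -- polygon; one of its points fixes the direction of b - a.
    · have hc : Tendsto (fun t : ℝ => a + t • (b - a)) (𝓝[>] 0) (𝓝 a) := by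
        have : Continuous fun t : ℝ => a + t • (b - a) := by fun_prop
        have := (this.tendsto 0).mono_left (nhdsWithin_le_nhds (s := Set.Ioi 0))
        simpa using this
      have h1 : ∀ᶠ t in 𝓝[>] (0 : ℝ), t < 1 := (gt_mem_nhds one_pos).filter_mono nhdsWithin_le_nhds
      obtain ⟨t, ht, ht1, ht0⟩ := ((hc.eventually (eventually_mem_side ha hi)).and
        (h1.and self_mem_nhdsWithin)).exists
      have ht0 : 0 < t := ht0
      have hmem : a + t • (b - a) ∈ segment ℝ a b := by
        rw [segment_eq_image']
        exact ⟨t, ⟨ht0.le, ht1.le⟩, rfl⟩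
      obtain ⟨s, hs⟩ := exists_smul_of_mem_segment hi (ht (hb hmem))
      rw [add_sub_cancel_left, ← hd] at hs
      have e0 := congrArg (fun z : Plane => z 0) hs
      have e1 := congrArg (fun z : Plane => z 1) hs
      simp only [PiLp.smul_apply, PiLp.sub_apply, smul_eq_mul] at e0 e1
      simp only [Matrix.cons_val_zero, Matrix.cons_val_one]
      have : t * (-(d 1) * (b 0 - a 0) + d 0 * (b 1 - a 1)) = 0 := by
        linear_combination -(d 1) * e0 + d 0 * e1
      exact (mul_eq_zero.1 this).resolve_left ht0.ne'
  -- No boundary segment starts at a point off the boundary, so any nonzero vector serves.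
  · exact ⟨![1, 0], by simp, fun b hb => absurd (hb (left_mem_segment ℝ a b)) haΓ⟩

/-- Off the boundary the plane is the disjoint union of two open sets, the domain and the exterior,
and a connected set cannot meet both. -/
theorem subset_carrier_of_disjoint {S : Set Plane} (hS : IsPreconnected S)
    (h : S ∩ frontier P.carrier = ∅) (hne : (S ∩ P.carrier).Nonempty) : S ⊆ P.carrier := by
  intro x hx
  by_contra hx'
  have hcov : S ⊆ P.carrier ∪ (closure P.carrier)ᶜ := by
    intro y hy
    by_cases hyΩ : y ∈ P.carrier
    · exact Or.inl hyΩ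
    · refine Or.inr fun hy' => Set.eq_empty_iff_forall_notMem.1 h y ⟨hy, ?_⟩
      rw [frontier_carrier]
      exact ⟨hy', hyΩ⟩
  obtain ⟨y, -, hy1, hy2⟩ := hS _ _ P.isOpen isClosed_closure.isOpen_compl hcov hne
    ⟨x, hx, (hcov hx).resolve_left hx'⟩
  exact hy2 (subset_closure hy1)

theorem notMem_carrier_of_frontier {x : Plane} (hx : x ∈ frontier P.carrier) : x ∉ P.carrier := by
  rw [frontier_carrier] at hx
  exact hx.2

/-- Near a corner, the boundary consists of the two adjacent sides. -/
theorem eventually_mem_adjacent_sides (j : ZMod P.n) :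
    ∀ᶠ x in 𝓝 (P.vertex (j + 1)), x ∈ frontier P.carrier → x ∈ side P j ∨ x ∈ side P (j + 1) := by
  have hj : P.vertex (j + 1) ∈ side P j := right_mem_segment ℝ _ _
  have hj1 : P.vertex (j + 1) ∈ side P (j + 1) := left_mem_segment ℝ _ _
  have h : ∀ᶠ x in 𝓝 (P.vertex (j + 1)), ∀ l : ZMod P.n, l ≠ j → l ≠ j + 1 → x ∉ side P l := by
    rw [eventually_all]
    intro l
    by_cases hl : l = j
    · simp [hl]
    by_cases hl1 : l = j + 1
    · simp [hl1]
    have : P.vertex (j + 1) ∉ side P l := by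
      intro h
      rcases eq_vertex_of_mem_side hl h hj with ⟨-, h⟩ | ⟨h, -⟩
      · exact vertex_ne j h.symm
      · exact hl1 h
    filter_upwards [(isClosed_side l).isOpen_compl.mem_nhds this] with x hx _ _ using hx
  filter_upwards [h] with x hx hxΓ
  obtain ⟨l, hl⟩ := mem_frontier_iff.1 hxΓ
  by_cases h1 : l = j
  · exact Or.inl (h1 ▸ hl)
  by_cases h2 : l = j + 1
  · exact Or.inr (h2 ▸ hl)
  exact absurd hl (hx l h1 h2)

/-- Two linearly independent vectors define coordinates of the plane. -/
theorem exists_coordinates {u w : Plane} (h : u 0 * w 1 - u 1 * w 0 ≠ 0) :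
    ∃ σ τ : Plane →ₗ[ℝ] ℝ, (∀ y, y = σ y • u + τ y • w) ∧ σ u = 1 ∧ τ u = 0 ∧ σ w = 0 ∧ τ w = 1 := by
  let p (i : Fin 2) : Plane →ₗ[ℝ] ℝ := (EuclideanSpace.proj i : Plane →L[ℝ] ℝ).toLinearMap
  have hp : ∀ i y, p i y = y i := fun i y => rfl
  refine ⟨(u 0 * w 1 - u 1 * w 0)⁻¹ • (w 1 • p 0 - w 0 • p 1),
    (u 0 * w 1 - u 1 * w 0)⁻¹ • (u 0 • p 1 - u 1 • p 0), fun y => ?_, ?_, ?_, ?_, ?_⟩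
  · ext i
    simp only [LinearMap.smul_apply, LinearMap.sub_apply, hp, smul_eq_mul, PiLp.add_apply,
      PiLp.smul_apply]
    fin_cases i <;> simp only [Fin.zero_eta, Fin.mk_one] <;> field_simp <;> ring
  all_goals
    simp only [LinearMap.smul_apply, LinearMap.sub_apply, hp, smul_eq_mul]
    field_simp
    try ring

theorem det_ne_zero_of_affineIndependent {a b c : Plane} (h : AffineIndependent ℝ ![a, b, c]) :
    (a - b) 0 * (c - b) 1 - (a - b) 1 * (c - b) 0 ≠ 0 := by
  intro h0
  rw [affineIndependent_iff_linearIndependent_vsub ℝ _ (1 : Fin 3)] at h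
  have hli := Fintype.linearIndependent_iff.1 h
  by_cases hz : c - b = 0
  · have : LinearIndependent ℝ _ := h
    have h2 := this.ne_zero (⟨2, by decide⟩ : {x : Fin 3 // x ≠ 1})
    apply h2
    simpa using hz
  · have hcomb : ∀ s t : ℝ, s • (a - b) + t • (c - b) = 0 → t = 0 ∧ s = 0 := by
      intro s t hst
      have := hli (fun i => if i.1 = 0 then s else t) (by
        have huniv : (Finset.univ : Finset {x : Fin 3 // x ≠ 1}) =
          {⟨0, by decide⟩, ⟨2, by decide⟩} := by decide
        rw [huniv, Finset.sum_insert (by decide), Finset.sum_singleton]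
        simpa using hst)
      exact ⟨by simpa using this ⟨2, by decide⟩, by simpa using this ⟨0, by decide⟩⟩
    apply hz
    ext i
    have h1 := hcomb ((c - b) 1) (-(a - b) 1) (by
      ext i; fin_cases i <;> simp at h0 ⊢ <;> linarith)
    have h2 := hcomb ((c - b) 0) (-(a - b) 0) (by
      ext i; fin_cases i <;> simp at h0 ⊢ <;> linarith)
    fin_cases i
    · exact h2.2
    · exact h1.2

/-- The domain is locally connected at its corners. -/
theorem isPreconnected_near_corner {a : Plane} (ha : P.IsCorner a) :
    ∃ r₀ > 0, ∀ r, 0 < r → r ≤ r₀ → IsPreconnected (P.carrier ∩ Metric.ball a r) := by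
  obtain ⟨i, rfl⟩ := ha
  obtain ⟨j, rfl⟩ : ∃ j, i = j + 1 := ⟨i - 1, by ring⟩
  have e2 : j + 1 + 1 = j + 2 := by ring
  set a := P.vertex (j + 1) with haa
  set u := P.vertex j - a with hu
  set w := P.vertex (j + 2) - a with hw
  have hdet : u 0 * w 1 - u 1 * w 0 ≠ 0 := det_ne_zero_of_affineIndependent (P.corner j)
  obtain ⟨σ, τ, hστ, hσu, hτu, hσw, hτw⟩ := exists_coordinates hdet
  have hu0 : 0 < ‖u‖ := norm_pos_iff.2 (by rintro h; rw [h] at hdet; simp at hdet)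
  have hw0 : 0 < ‖w‖ := norm_pos_iff.2 (by rintro h; rw [h] at hdet; simp at hdet)
  obtain ⟨r₁, hr₁, hball⟩ := Metric.eventually_nhds_iff.1 (eventually_mem_adjacent_sides j)
  -- The radius keeps the ball away from the other sides and is at most the length of each of the
  -- two adjacent sides.
  refine ⟨min r₁ (min ‖u‖ ‖w‖), by positivity, fun r hr hr0 => ?_⟩
  have hσc : Continuous σ := σ.continuous_of_finiteDimensional
  have hτc : Continuous τ := τ.continuous_of_finiteDimensional
  -- In the coordinates along the two sides, the boundary inside the ball consists of the two
  -- nonnegative half-axes.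
  have hΓ : ∀ y ∈ Metric.ball a r, y ∈ frontier P.carrier ↔
      (0 ≤ σ (y - a) ∧ τ (y - a) = 0) ∨ (σ (y - a) = 0 ∧ 0 ≤ τ (y - a)) := by
    intro y hy
    rw [Metric.mem_ball] at hy
    constructor
    · intro hyΓ
      rcases hball (hy.trans_le (hr0.trans (min_le_left _ _))) hyΓ with h | h
      · rw [side, segment_symm, segment_eq_image'] at h
        obtain ⟨t, ht, rfl⟩ := h
        simp [← haa, ← hu, hσu, hτu, ht.1]
      · rw [side, e2, segment_eq_image'] at h
        obtain ⟨t, ht, rfl⟩ := h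
        simp [← haa, ← hw, hσw, hτw, ht.1]
    · have hy1 := hστ (y - a)
      have hyn : ‖y - a‖ < min ‖u‖ ‖w‖ := by
        rw [← dist_eq_norm]; exact hy.trans_le (hr0.trans (min_le_right _ _))
      rw [mem_frontier_iff]
      rintro (⟨h1, h2⟩ | ⟨h1, h2⟩)
      · refine ⟨j, ?_⟩
        rw [side, segment_symm, segment_eq_image']
        rw [h2, zero_smul, add_zero] at hy1
        refine ⟨σ (y - a), ⟨h1, ?_⟩, ?_⟩
        · rw [hy1, norm_smul, Real.norm_of_nonneg h1] at hyn
          have := hyn.trans_le (min_le_left _ _)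
          exact ((mul_lt_iff_lt_one_left hu0).1 this).le
        · change a + σ (y - a) • u = y
          rw [← hy1]; abel
      · refine ⟨j + 1, ?_⟩
        rw [side, e2, segment_eq_image']
        rw [h1, zero_smul, zero_add] at hy1
        refine ⟨τ (y - a), ⟨h2, ?_⟩, ?_⟩
        · rw [hy1, norm_smul, Real.norm_of_nonneg h2] at hyn
          have := hyn.trans_le (min_le_right _ _)
          exact ((mul_lt_iff_lt_one_left hw0).1 this).le
        · change a + τ (y - a) • w = y
          rw [← hy1]; abel
  have hconv : ∀ ρ : Plane →ₗ[ℝ] ℝ, Convex ℝ {y | 0 < ρ (y - a)} := by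
    intro ρ x hx y hy s t hs ht hst
    have e : s • x + t • y - a = s • (x - a) + t • (y - a) := by
      have : a = (s + t) • a := by rw [hst, one_smul]
      nth_rewrite 1 [this]
      module
    change 0 < ρ (s • x + t • y - a)
    rw [e, map_add, map_smul, map_smul, smul_eq_mul, smul_eq_mul]
    have hx : 0 < ρ (x - a) := hx
    have hy : 0 < ρ (y - a) := hy
    rcases hs.eq_or_lt with rfl | hs
    · have : t = 1 := by linarith
      rw [this]; linarith
    · have := mul_pos hs hx
      have := mul_nonneg ht hy.le
      linarith
  -- The two sectors cut out by the corner. The first is convex; the second is a union of two convex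
  -- pieces with a common point opposite to u + w.
  set S₁ := ({y | 0 < σ (y - a)} ∩ {y | 0 < τ (y - a)}) ∩ Metric.ball a r with hS₁
  set S₂ := ({y | 0 < (-σ) (y - a)} ∩ Metric.ball a r) ∪
    ({y | 0 < (-τ) (y - a)} ∩ Metric.ball a r) with hS₂
  have hp₁ : IsPreconnected S₁ :=
    (((hconv σ).inter (hconv τ)).inter (convex_ball a r)).isPreconnected
  have hp₂ : IsPreconnected S₂ := by
    have hlim : Tendsto (fun t : ℝ => a + t • (-(u + w))) (𝓝[>] 0) (𝓝 a) := by
      have : Continuous fun t : ℝ => a + t • (-(u + w)) := by fun_prop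
      have := (this.tendsto 0).mono_left (nhdsWithin_le_nhds (s := Set.Ioi 0))
      simpa using this
    obtain ⟨t, ht, ht0⟩ := ((hlim.eventually (Metric.ball_mem_nhds a hr)).and
      self_mem_nhdsWithin).exists
    have ht0 : 0 < t := ht0
    refine IsPreconnected.union (a + t • (-(u + w))) ⟨?_, ht⟩ ⟨?_, ht⟩
      ((hconv (-σ)).inter (convex_ball a r)).isPreconnected
      ((hconv (-τ)).inter (convex_ball a r)).isPreconnected
    · simp [hσu, hσw, ht0]
    · simp [hτu, hτw, ht0]
  have hd₁ : S₁ ∩ frontier P.carrier = ∅ := by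
    rw [Set.eq_empty_iff_forall_notMem]
    rintro y ⟨⟨⟨h1, h2⟩, hy⟩, h3⟩
    have h1 : 0 < σ (y - a) := h1
    have h2 : 0 < τ (y - a) := h2
    rcases (hΓ y hy).1 h3 with h | h
    · exact h2.ne' h.2
    · exact h1.ne' h.1
  have hd₂ : S₂ ∩ frontier P.carrier = ∅ := by
    rw [Set.eq_empty_iff_forall_notMem]
    rintro y ⟨⟨h1, hy⟩ | ⟨h1, hy⟩, h3⟩
    · have h1 : 0 < -σ (y - a) := h1
      rcases (hΓ y hy).1 h3 with h | h
      · linarith [h.1]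
      · linarith [h.1]
    · have h1 : 0 < -τ (y - a) := h1
      rcases (hΓ y hy).1 h3 with h | h
      · linarith [h.2]
      · linarith [h.2]
  have hcov : ∀ y ∈ Metric.ball a r, y ∉ frontier P.carrier → y ∈ S₁ ∨ y ∈ S₂ := by
    intro y hy hyΓ
    rw [hΓ y hy] at hyΓ
    push Not at hyΓ
    rcases lt_or_ge (σ (y - a)) 0 with h | h
    · exact Or.inr (Or.inl ⟨by simpa using h, hy⟩)
    rcases lt_or_ge (τ (y - a)) 0 with h' | h'
    · exact Or.inr (Or.inr ⟨by simpa using h', hy⟩)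
    refine Or.inl ⟨⟨lt_of_le_of_ne h fun h0 => ?_, lt_of_le_of_ne h' (hyΓ.1 h).symm⟩, hy⟩
    exact absurd h' (not_le.2 (hyΓ.2 h0.symm))
  have haΓ : a ∈ frontier P.carrier := by
    rw [hΓ a (Metric.mem_ball_self hr)]
    simp
  -- If both sectors were in the domain, the corner would be interior to the closure, hence in the
  -- domain. So near the corner the domain is at most one connected sector.
  have hnot : ¬(S₁ ⊆ P.carrier ∧ S₂ ⊆ P.carrier) := by
    rintro ⟨h1, h2⟩
    refine notMem_carrier_of_frontier haΓ ?_
    rw [← P.interior_closure, mem_interior_iff_mem_nhds]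
    filter_upwards [Metric.ball_mem_nhds a hr] with y hy
    by_cases hyΓ : y ∈ frontier P.carrier
    · exact frontier_subset_closure hyΓ
    · rcases hcov y hy hyΓ with h | h
      · exact subset_closure (h1 h)
      · exact subset_closure (h2 h)
  have hfin : ∀ S S' : Set Plane, IsPreconnected S → S ⊆ Metric.ball a r →
      S ∩ frontier P.carrier = ∅ → ¬(S' ∩ P.carrier).Nonempty →
      (∀ y ∈ Metric.ball a r, y ∉ frontier P.carrier → y ∈ S ∨ y ∈ S') →
      IsPreconnected (P.carrier ∩ Metric.ball a r) := by
    intro S S' hS hSb hSΓ hS' hcov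
    have hsub : P.carrier ∩ Metric.ball a r ⊆ S := by
      rintro y ⟨hy, hyb⟩
      refine (hcov y hyb fun h => notMem_carrier_of_frontier h hy).resolve_right fun h => ?_
      exact hS' ⟨y, h, hy⟩
    by_cases hne : (S ∩ P.carrier).Nonempty
    · have : P.carrier ∩ Metric.ball a r = S :=
        hsub.antisymm fun y hy => ⟨subset_carrier_of_disjoint hS hSΓ hne hy, hSb hy⟩
      rwa [this]
    · have : P.carrier ∩ Metric.ball a r = ∅ := by
        rw [Set.eq_empty_iff_forall_notMem]
        intro y hy
        exact hne ⟨y, hsub hy, hy.1⟩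
      rw [this]
      exact isPreconnected_empty
  by_cases h1 : (S₁ ∩ P.carrier).Nonempty
  · by_cases h2 : (S₂ ∩ P.carrier).Nonempty
    · exact absurd ⟨subset_carrier_of_disjoint hp₁ hd₁ h1, subset_carrier_of_disjoint hp₂ hd₂ h2⟩
        hnot
    · exact hfin S₁ S₂ hp₁ Set.inter_subset_right hd₁ h2 hcov
  · refine hfin S₂ S₁ hp₂ ?_ hd₂ h1 fun y hy hyΓ => (hcov y hy hyΓ).symm
    exact Set.union_subset Set.inter_subset_right Set.inter_subset_right

/-! ### Connectivity of the mesh -/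

theorem one_lt_rank_plane : 1 < Module.rank ℝ Plane := by
  rw [← Module.finrank_eq_rank]
  norm_cast
  simp

/-- Polar coordinates: the image of an interval times the unit circle. -/
theorem isPreconnected_punctured_ball (a : Plane) (r : ℝ) :
    IsPreconnected (Metric.ball a r \ {a}) := by
  have h : Metric.ball a r \ {a} =
      (fun z : ℝ × Plane => a + z.1 • z.2) '' (Set.Ioo 0 r ×ˢ Metric.sphere 0 1) := by
    ext y
    constructor
    · rintro ⟨hy, hya⟩
      have hpos : 0 < ‖y - a‖ := norm_pos_iff.2 (sub_ne_zero.2 hya)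
      refine ⟨(‖y - a‖, ‖y - a‖⁻¹ • (y - a)), ⟨⟨hpos, by simpa [dist_eq_norm] using hy⟩, ?_⟩, ?_⟩
      · simp [norm_smul, hpos.ne']
      · simp [smul_smul, hpos.ne']
    · rintro ⟨⟨t, u⟩, ⟨⟨ht0, htr⟩, hu⟩, rfl⟩
      simp only [mem_sphere_zero_iff_norm] at hu
      simp only at ht0 htr
      have hn : ‖t • u‖ = t := by rw [norm_smul, hu, mul_one, Real.norm_of_nonneg ht0.le]
      refine ⟨by simp [hn, htr], fun h => ?_⟩
      have : t • u = 0 := by simpa using h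
      rw [this, norm_zero] at hn
      exact ht0.ne hn
  rw [h]
  exact (isPreconnected_Ioo.prod (isPreconnected_sphere one_lt_rank_plane 0 1)).image _
    (by fun_prop)

/-- The coordinates sum to one, so if none but that of a were positive, x would be a. -/
theorem exists_ne_bary_pos {K : T.elems} {a x : Plane} (hx : x ∈ hull K) (hxa : x ≠ a) :
    ∃ b ∈ K.1, b ≠ a ∧ 0 < evalAt x (bary T K b) := by
  by_contra! h
  have h0 : ∀ b ∈ K.1, b ≠ a → evalAt x (bary T K b) = 0 := fun b hb hba =>
    le_antisymm (h b hb hba) (mem_hull_iff.1 hx b)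
  have h1 := sum_evalAt_bary K x
  have h2 := sum_evalAt_bary_smul K x
  by_cases ha : a ∈ K.1
  · rw [Finset.sum_eq_single_of_mem a ha h0] at h1
    rw [Finset.sum_eq_single_of_mem a ha (fun b hb hba => by rw [h0 b hb hba, zero_smul]), h1,
      one_smul] at h2
    exact hxa h2.symm
  · rw [Finset.sum_eq_zero fun b hb => h0 b hb fun h => ha (h ▸ hb)] at h1
    exact zero_ne_one h1

theorem vertex_notMem_interior {K : T.elems} {a : Plane} (ha : a ∈ K.1) :
    a ∉ interior (hull K) := by
  intro h
  obtain ⟨b, hb, hba⟩ := Finset.exists_mem_ne (by rw [T.card_eq K.1 K.2]; norm_num) a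
  have := mem_interior_hull_iff.1 h b hb
  rw [evalAt_bary_vertex ha, if_neg hba] at this
  exact this.false

theorem isClosed_iUnion_hull (R : T.elems → Prop) : IsClosed (⋃ K : {K // R K}, hull K.1) :=
  isClosed_iUnion_of_finite fun K => isClosed_hull K.1

/-- If the domain is connected near the vertex `a`, then a property of elements that is inherited
by neighbours with a common edge through `a` holds for all elements at `a` or for none. -/
theorem star_induction {a : Plane}
    (hconn : ∃ r₀ > 0, ∀ r, 0 < r → r ≤ r₀ → IsPreconnected ((P.carrier ∩ Metric.ball a r) \ {a}))
    (R : T.elems → Prop) (hR : ∀ (K L : T.elems) (b : Plane), b ≠ a → a ∈ K.1 → a ∈ L.1 → b ∈ K.1 →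
      b ∈ L.1 → R K → R L) {K₀ : T.elems} (haK₀ : a ∈ K₀.1) (hK₀ : R K₀) {K₁ : T.elems}
    (haK₁ : a ∈ K₁.1) : R K₁ := by
  by_contra hK₁
  obtain ⟨r₀, hr₀, hconn⟩ := hconn
  have hev : ∀ᶠ x in 𝓝 a, ∀ K : T.elems, (a ∉ K.1 → x ∉ hull K) ∧
      (a ∈ K.1 → 0 < evalAt x (bary T K a)) := by
    rw [eventually_all]
    intro K
    by_cases ha : a ∈ K.1
    · have := (continuous_evalAt (bary T K a)).continuousAt.eventually
        (lt_mem_nhds (show 0 < evalAt a (bary T K a) by simp [evalAt_bary_vertex ha]))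
      filter_upwards [this] with x hx
      exact ⟨fun h => absurd ha h, fun _ => hx⟩
    · have : a ∉ hull K := fun h => ha (vertex_mem_of_mem_hull haK₀ h)
      filter_upwards [(isClosed_hull K).isOpen_compl.mem_nhds this] with x hx
      exact ⟨fun _ => hx, fun h => absurd h ha⟩
  obtain ⟨r₁, hr₁, hball⟩ := Metric.eventually_nhds_iff.1 hev
  set r := min r₀ r₁ with hr
  have hr0 : 0 < r := lt_min hr₀ hr₁
  have hpre := hconn r hr0 (min_le_left _ _)
  have hmeet : ∀ K : T.elems, a ∈ K.1 →
      (((P.carrier ∩ Metric.ball a r) \ {a}) ∩ hull K).Nonempty := by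
    intro K ha
    obtain ⟨c, hc⟩ := interior_hull_nonempty K
    have hlim : Tendsto (fun t : ℝ => a + t • (c - a)) (𝓝[>] 0) (𝓝 a) := by
      have : Continuous fun t : ℝ => a + t • (c - a) := by fun_prop
      have := (this.tendsto 0).mono_left (nhdsWithin_le_nhds (s := Set.Ioi 0))
      simpa using this
    have h1 : ∀ᶠ t in 𝓝[>] (0 : ℝ), t < 1 := (gt_mem_nhds one_pos).filter_mono nhdsWithin_le_nhds
    obtain ⟨t, ht, ht1, ht0⟩ := ((hlim.eventually (Metric.ball_mem_nhds a hr0)).and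
      (h1.and self_mem_nhdsWithin)).exists
    have ht0 : 0 < t := ht0
    have hInt : a + t • (c - a) ∈ interior (hull K) := by
      refine (convex_convexHull ℝ _).openSegment_self_interior_subset_interior
        (vertex_mem_hull ha) hc ?_
      rw [openSegment_eq_image']
      exact ⟨t, ⟨ht0, ht1⟩, rfl⟩
    refine ⟨_, ⟨⟨interior_hull_subset K hInt, ht⟩, fun h => ?_⟩, interior_subset hInt⟩
    rw [Set.mem_singleton_iff.1 h] at hInt
    exact vertex_notMem_interior ha hInt
  have hcov : ∀ x ∈ (P.carrier ∩ Metric.ball a r) \ {a}, ∃ K : T.elems, a ∈ K.1 ∧ x ∈ hull K := by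
    intro x hx
    obtain ⟨K, hK⟩ := exists_mem_hull (T := T) (subset_closure hx.1.1)
    refine ⟨K, ?_, hK⟩
    by_contra ha
    exact (hball (lt_of_lt_of_le hx.1.2 (min_le_right _ _)) K).1 ha hK
  -- Elements with and without the property give two closed sets covering a connected punctured
  -- neighbourhood, so they meet at some x ≠ a. A vertex b ≠ a with positive coordinate at x is
  -- common to the two elements, so they share the edge ab.
  obtain ⟨x, hxD, hxA, hxB⟩ := isPreconnected_closed_iff.1 hpre
    (⋃ K : {K : T.elems // R K ∧ a ∈ K.1}, hull K.1)
    (⋃ K : {K : T.elems // ¬R K ∧ a ∈ K.1}, hull K.1)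
    (isClosed_iUnion_hull _) (isClosed_iUnion_hull _)
    (fun x hx => by
      obtain ⟨K, ha, hK⟩ := hcov x hx
      by_cases hRK : R K
      · exact Or.inl (Set.mem_iUnion.2 ⟨⟨K, hRK, ha⟩, hK⟩)
      · exact Or.inr (Set.mem_iUnion.2 ⟨⟨K, hRK, ha⟩, hK⟩))
    (by
      obtain ⟨x, hx, hxK⟩ := hmeet K₀ haK₀
      exact ⟨x, hx, Set.mem_iUnion.2 ⟨⟨K₀, hK₀, haK₀⟩, hxK⟩⟩)
    (by
      obtain ⟨x, hx, hxK⟩ := hmeet K₁ haK₁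
      exact ⟨x, hx, Set.mem_iUnion.2 ⟨⟨K₁, hK₁, haK₁⟩, hxK⟩⟩)
  obtain ⟨⟨K, hRK, haK⟩, hxK⟩ := Set.mem_iUnion.1 hxA
  obtain ⟨⟨L, hRL, haL⟩, hxL⟩ := Set.mem_iUnion.1 hxB
  obtain ⟨b, hb, hba, hpos⟩ := exists_ne_bary_pos hxK hxD.2
  exact hRL (hR K L b hba haK haL hb (mem_of_bary_pos hxK hxL hpos) hRK)

/-- A corner is not in the open domain, so puncturing changes nothing and local connectedness at the
corner applies. -/
theorem star_induction_of_isCorner {a : Plane} (ha : P.IsCorner a)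
    (R : T.elems → Prop) (hR : ∀ (K L : T.elems) (b : Plane), b ≠ a → a ∈ K.1 → a ∈ L.1 → b ∈ K.1 →
      b ∈ L.1 → R K → R L) {K₀ : T.elems} (haK₀ : a ∈ K₀.1) (hK₀ : R K₀) {K₁ : T.elems}
    (haK₁ : a ∈ K₁.1) : R K₁ := by
  refine star_induction ?_ R hR haK₀ hK₀ haK₁
  obtain ⟨r₀, hr₀, h⟩ := isPreconnected_near_corner ha
  refine ⟨r₀, hr₀, fun r h0 h1 => ?_⟩
  have hna : a ∉ P.carrier := by
    obtain ⟨i, rfl⟩ := ha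
    exact notMem_carrier_of_frontier (mem_frontier_iff.2 ⟨i, left_mem_segment ℝ _ _⟩)
  rw [Set.sdiff_singleton_eq_self fun h => hna h.1]
  exact h r h0 h1

theorem star_induction_of_mem_carrier {a : Plane} (ha : a ∈ P.carrier)
    (R : T.elems → Prop) (hR : ∀ (K L : T.elems) (b : Plane), b ≠ a → a ∈ K.1 → a ∈ L.1 → b ∈ K.1 →
      b ∈ L.1 → R K → R L) {K₀ : T.elems} (haK₀ : a ∈ K₀.1) (hK₀ : R K₀) {K₁ : T.elems}
    (haK₁ : a ∈ K₁.1) : R K₁ := by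
  refine star_induction ?_ R hR haK₀ hK₀ haK₁
  obtain ⟨r₀, hr₀, h⟩ := Metric.isOpen_iff.1 P.isOpen a ha
  refine ⟨r₀, hr₀, fun r h0 h1 => ?_⟩
  rw [Set.inter_eq_right.2 ((Metric.ball_subset_ball h1).trans h)]
  exact isPreconnected_punctured_ball a r

/-- A property of elements that is inherited by neighbours with a common edge holds for all
elements or for none. -/
theorem mesh_induction (R : T.elems → Prop) (hR : ∀ (K L : T.elems) (a b : Plane), a ≠ b →
      a ∈ K.1 → a ∈ L.1 → b ∈ K.1 → b ∈ L.1 → R K → R L) {K₀ : T.elems} (hK₀ : R K₀)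
    (K₁ : T.elems) : R K₁ := by
  by_contra hK₁
  have hmeet : ∀ K : T.elems, (P.carrier ∩ hull K).Nonempty := fun K => by
    obtain ⟨c, hc⟩ := interior_hull_nonempty K
    exact ⟨c, interior_hull_subset K hc, interior_subset hc⟩
  obtain ⟨x, hxD, hxA, hxB⟩ := isPreconnected_closed_iff.1 P.isConnected.isPreconnected
    (⋃ K : {K : T.elems // R K}, hull K.1)
    (⋃ K : {K : T.elems // ¬R K}, hull K.1)
    (isClosed_iUnion_hull _) (isClosed_iUnion_hull _)
    (fun x hx => by
      obtain ⟨K, hK⟩ := exists_mem_hull (T := T) (subset_closure hx)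
      by_cases hRK : R K
      · exact Or.inl (Set.mem_iUnion.2 ⟨⟨K, hRK⟩, hK⟩)
      · exact Or.inr (Set.mem_iUnion.2 ⟨⟨K, hRK⟩, hK⟩))
    (by
      obtain ⟨x, hx, hxK⟩ := hmeet K₀
      exact ⟨x, hx, Set.mem_iUnion.2 ⟨⟨K₀, hK₀⟩, hxK⟩⟩)
    (by
      obtain ⟨x, hx, hxK⟩ := hmeet K₁
      exact ⟨x, hx, Set.mem_iUnion.2 ⟨⟨K₁, hK₁⟩, hxK⟩⟩)
  obtain ⟨⟨K, hRK⟩, hxK⟩ := Set.mem_iUnion.1 hxA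
  obtain ⟨⟨L, hRL⟩, hxL⟩ := Set.mem_iUnion.1 hxB
  -- A common point in the domain is either a vertex, where one walks around its star through shared
  -- edges, or has two positive coordinates and exhibits a shared edge directly.
  by_cases hv : x ∈ K.1
  · exact hRL (star_induction_of_mem_carrier hxD R
      (fun K L b hb h1 h2 h3 h4 => hR K L x b hb.symm h1 h2 h3 h4) hv hRK
      (vertex_mem_of_mem_hull hv hxL))
  · obtain ⟨v, hv'⟩ := Finset.card_pos.1 (by rw [T.card_eq K.1 K.2]; norm_num : 0 < K.1.card)
    have hne : ∀ v ∈ K.1, x ≠ v := fun v h e => hv (e ▸ h)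
    obtain ⟨b, hb, -, hpos⟩ := exists_ne_bary_pos hxK (hne v hv')
    obtain ⟨c, hc, hcb, hpos'⟩ := exists_ne_bary_pos hxK (hne b hb)
    exact hRL (hR K L b c hcb.symm hb (mem_of_bary_pos hxK hxL hpos) hc
      (mem_of_bary_pos hxK hxL hpos') hRK)

end

/-! ### Global potentials of divergence-free fields. -/

section

variable {P : Polygon} {T : Mesh P}

/-! ### Potentials of divergence-free fields -/

/-- The linear form `y ↦ a y₁ - b y₀`: the differential of a function with curl `(a, b)`. -/
def curlForm (a b : ℝ) : Plane →L[ℝ] ℝ :=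
  a • EuclideanSpace.proj 1 - b • EuclideanSpace.proj 0

@[simp] theorem curlForm_apply (a b : ℝ) (y : Plane) : curlForm a b y = a * y 1 - b * y 0 := by
  simp [curlForm]

@[simp] theorem curlForm_zero : curlForm 0 0 = 0 := by
  ext; simp

theorem abs_coord_le_norm (w : Plane) (i : Fin 2) : |w i| ≤ ‖w‖ := by
  simpa using PiLp.norm_apply_le w i

theorem norm_curlForm_le (a b : ℝ) : ‖curlForm a b‖ ≤ |a| + |b| := by
  refine ContinuousLinearMap.opNorm_le_bound _ (by positivity) fun w => ?_
  rw [curlForm_apply, Real.norm_eq_abs]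
  refine (abs_sub _ _).trans ?_
  rw [abs_mul, abs_mul, add_mul]
  exact add_le_add (mul_le_mul_of_nonneg_left (abs_coord_le_norm w 1) (abs_nonneg _))
    (mul_le_mul_of_nonneg_left (abs_coord_le_norm w 0) (abs_nonneg _))

theorem curlForm_sub (a b c d : ℝ) : curlForm a b - curlForm c d = curlForm (a - c) (b - d) := by
  ext y; simp; ring

theorem clm_apply_eq (A : Plane →L[ℝ] ℝ) (y : Plane) :
    A y = y 0 * A (EuclideanSpace.single 0 1) + y 1 * A (EuclideanSpace.single 1 1) := by
  have hw : y = ∑ i, y i • EuclideanSpace.single i (1 : ℝ) := by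
    ext j; fin_cases j <;> simp
  conv_lhs => rw [hw]
  simp [Fin.sum_univ_two]

/-- A smooth divergence-free field on the plane is a curl. -/
theorem exists_hasFDerivAt_curlForm {u : Fin 2 → Plane → ℝ} (hu : ∀ j, ContDiff ℝ ∞ (u j))
    (h : ∀ x, partialDeriv 0 (u 0) x + partialDeriv 1 (u 1) x = 0) :
    ∃ f : Plane → ℝ, f 0 = 0 ∧ ∀ x, HasFDerivAt f (curlForm (u 0 x) (u 1 x)) x := by
  have hd : ∀ j x, DifferentiableAt ℝ (u j) x := fun j x => (hu j).differentiable (by simp) x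
  have hω : ∀ x, HasFDerivAt (fun x => curlForm (u 0 x) (u 1 x))
      ((fderiv ℝ (u 0) x).smulRight (EuclideanSpace.proj 1 : Plane →L[ℝ] ℝ) -
        (fderiv ℝ (u 1) x).smulRight (EuclideanSpace.proj 0 : Plane →L[ℝ] ℝ)) x := by
    intro x
    have h0 := (hd 0 x).hasFDerivAt.smul_const (EuclideanSpace.proj 1 : Plane →L[ℝ] ℝ)
    have h1 := (hd 1 x).hasFDerivAt.smul_const (EuclideanSpace.proj 0 : Plane →L[ℝ] ℝ)
    exact h0.sub h1
  -- The Poincaré lemma: the form u₀ dy - u₁ dx is closed exactly when the divergence vanishes.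
  obtain ⟨f, hf⟩ := convex_univ.exists_forall_hasFDerivAt_of_fderiv_symmetric isOpen_univ
    (fun x _ => (hω x).differentiableAt.differentiableWithinAt) (fun a _ x y => by
      rw [(hω a).fderiv]
      change fderiv ℝ (u 0) a x * y 1 - fderiv ℝ (u 1) a x * y 0 =
        fderiv ℝ (u 0) a y * x 1 - fderiv ℝ (u 1) a y * x 0
      have := h a
      simp only [partialDeriv] at this
      rw [clm_apply_eq (fderiv ℝ (u 0) a) x, clm_apply_eq (fderiv ℝ (u 1) a) x,
        clm_apply_eq (fderiv ℝ (u 0) a) y, clm_apply_eq (fderiv ℝ (u 1) a) y]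
      linear_combination (x 0 * y 1 - x 1 * y 0) * this)
  exact ⟨fun x => f x - f 0, sub_self _, fun x => (hf x (Set.mem_univ x)).sub_const _⟩

/-- A Lipschitz field on the plane whose weak divergence vanishes is a curl. -/
theorem exists_hasFDerivAt_curlForm_of_lipschitz {F : Fin 2 → Plane → ℝ} {C : NNReal}
    (hF : ∀ j, LipschitzWith C (F j)) {g : Plane → ℝ} (h0 : HasWeakPartial Set.univ 0 (F 0) g)
    (h1 : HasWeakPartial Set.univ 1 (F 1) (-g)) :
    ∃ f : Plane → ℝ, ∀ x, HasFDerivAt f (curlForm (F 0 x) (F 1 x)) x := by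
  set ε : ℕ → ℝ := fun n => 1 / ((n : ℝ) + 1) with hεdef
  have hε : ∀ n, 0 < ε n := fun n => by positivity
  have hloc : ∀ j, LocallyIntegrable (F j) := fun j => (hF j).continuous.locallyIntegrable
  set u : ℕ → Fin 2 → Plane → ℝ := fun n j => conv (mollifier (ε n)) (F j) with hu
  -- Mollification preserves the vanishing of the divergence. Normalising the potentials at 0 makes
  -- them converge at one point.
  have hpot : ∀ n, ∃ f : Plane → ℝ, f 0 = 0 ∧
      ∀ x, HasFDerivAt f (curlForm (u n 0 x) (u n 1 x)) x := by
    intro n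
    have hm := isTest_mollifier (hε n)
    refine exists_hasFDerivAt_curlForm (fun j => hm.contDiff_conv (hloc j)) fun x => ?_
    rw [hm.partialDeriv_conv (hloc 0), hm.partialDeriv_conv (hloc 1), h0.conv_partialDeriv hm,
      h1.conv_partialDeriv hm, conv_apply_swap, conv_apply_swap]
    simp only [Pi.neg_apply, mul_neg, integral_neg, add_neg_cancel]
  choose f hf0 hf using hpot
  have hclose : ∀ n j x, |u n j x - F j x| ≤ C * ε n := fun n j x =>
    abs_conv_mollifier_sub_le (hε n) (hloc j).aestronglyMeasurable fun y hy => by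
      have := (hF j).dist_le_mul y x
      rw [Real.dist_eq] at this
      exact this.trans (mul_le_mul_of_nonneg_left hy C.2)
  have hunif : TendstoUniformly (fun n x => curlForm (u n 0 x) (u n 1 x))
      (fun x => curlForm (F 0 x) (F 1 x)) atTop := by
    rw [Metric.tendstoUniformly_iff]
    intro δ hδ
    have hlim : Tendsto (fun n => 2 * C * ε n) atTop (𝓝 0) := by
      simpa only [mul_zero] using (tendsto_one_div_add_atTop_nhds_zero_nat (𝕜 := ℝ)).const_mul (2 * (C : ℝ))
    filter_upwards [hlim.eventually (gt_mem_nhds hδ)] with n hn x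
    rw [dist_comm, dist_eq_norm, curlForm_sub]
    refine (norm_curlForm_le _ _).trans_lt ?_
    linarith [hclose n 0 x, hclose n 1 x]
  -- Uniform convergence of the derivatives and convergence at 0 give local uniform convergence, and
  -- the limit is differentiable with the limiting derivative.
  have hcauchy : ∀ x, ∃ y, Tendsto (fun n => f n x) atTop (𝓝 y) := by
    intro x
    have h2 : UniformCauchySeqOn f atTop (Metric.ball 0 (‖x‖ + 1)) :=
      uniformCauchySeqOn_ball_of_fderiv (𝕜 := ℝ)
        (hunif.tendstoUniformlyOn.uniformCauchySeqOn (s := Metric.ball 0 (‖x‖ + 1)))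
        (fun n y _ => hf n y) (by
          simp only [hf0]
          exact (tendsto_const_nhds (x := (0 : ℝ))).cauchy_map)
    exact cauchySeq_tendsto_of_complete (h2.cauchy_map (by simp))
  choose φ hφ using hcauchy
  exact ⟨φ, fun x => hasFDerivAt_of_tendstoUniformly hunif hf hφ x⟩

theorem eq_of_hasFDerivAt_zero {f : Plane → ℝ} {s : Set Plane} (hs : Convex ℝ s)
    (h : ∀ x ∈ s, HasFDerivAt f (0 : Plane →L[ℝ] ℝ) x) {x y : Plane} (hx : x ∈ s) (hy : y ∈ s) :
    f x = f y := by
  have := hs.norm_image_sub_le_of_norm_hasFDerivWithin_le (C := 0)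
    (fun z hz => (h z hz).hasFDerivWithinAt) (fun z _ => by simp) hy hx
  rw [zero_mul, norm_le_zero_iff, sub_eq_zero] at this
  exact this

theorem hasFDerivAt_evalAt (p : Poly) (x : Plane) : HasFDerivAt (fun x => evalAt x p)
    (curlForm (evalAt x (MvPolynomial.pderiv 1 p)) (evalAt x (-MvPolynomial.pderiv 0 p))) x := by
  have h : ∀ i, fderiv ℝ (fun x => evalAt x p) x (EuclideanSpace.single i 1) =
      evalAt x (MvPolynomial.pderiv i p) := fun i => congrFun (partialDeriv_evalAt p i) x
  have e : curlForm (evalAt x (MvPolynomial.pderiv 1 p)) (evalAt x (-MvPolynomial.pderiv 0 p)) =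
      fderiv ℝ (fun x => evalAt x p) x := by
    refine ContinuousLinearMap.ext fun y => ?_
    rw [clm_apply_eq (fderiv ℝ _ x), h 0, h 1, curlForm_apply, evalAt_neg]
    ring
  rw [e]
  exact ((contDiff_evalAt p).differentiable (by simp) x).hasFDerivAt

/-- A function with vanishing derivative is constant along each side, and consecutive sides share a
vertex. Here it matters that the boundary is one closed curve, that is, that the domain has no
holes. -/
theorem exists_eq_of_mem_frontier {φ : Plane → ℝ}
    (h : ∀ x ∈ frontier P.carrier, HasFDerivAt φ (0 : Plane →L[ℝ] ℝ) x) :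
    ∃ c, ∀ x ∈ frontier P.carrier, φ x = c := by
  have hside : ∀ i, ∀ x ∈ side P i, ∀ y ∈ side P i, φ x = φ y := fun i x hx y hy =>
    eq_of_hasFDerivAt_zero (convex_segment _ _)
      (fun z hz => h z (mem_frontier_iff.2 ⟨i, hz⟩)) hx hy
  have hnat : ∀ n : ℕ, φ (P.vertex n) = φ (P.vertex 0) := by
    intro n
    induction n with
    | zero => simp
    | succ n ih =>
      rw [← ih, Nat.cast_succ]
      exact (hside n _ (left_mem_segment ℝ _ _) _ (right_mem_segment ℝ _ _)).symm
  have : NeZero P.n := ⟨by have := P.three_le; omega⟩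
  refine ⟨φ (P.vertex 0), fun x hx => ?_⟩
  obtain ⟨i, hi⟩ := mem_frontier_iff.1 hx
  rw [hside i x hi _ (left_mem_segment ℝ _ _), ← hnat i.val, ZMod.natCast_zmod_val]

theorem pd_apply (i : Fin 2) (p : Broken T) (K : T.elems) :
    pd T i p K = MvPolynomial.pderiv i (p K) := rfl

theorem curl_apply_zero (φ : Broken T) : curl T φ 0 = pd T 1 φ := rfl

theorem curl_apply_one (φ : Broken T) : curl T φ 1 = -pd T 0 φ := rfl

theorem dive_apply (v : Fin 2 → Broken T) : dive T v = pd T 0 (v 0) + pd T 1 (v 1) := by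
  simp [dive, Fin.sum_univ_two]

/-- A conforming divergence-free field is the curl of a conforming piecewise polynomial. -/
theorem exists_isConf_curl_eq {v : Fin 2 → Broken T} (hv : ∀ j, IsConf (v j)) {d : ℕ}
    (hd : ∀ j K, (v j K).totalDegree ≤ d) (h : dive T v = 0) :
    ∃ φ : Broken T, IsConf φ ∧ (∀ K, (φ K).totalDegree ≤ d + 1) ∧ curl T φ = v := by
  choose C hC using fun j => (hv j).exists_lipschitz
  have hdiv : pd T 1 (v 1) = -pd T 0 (v 0) := by
    rw [dive_apply] at h
    exact eq_neg_of_add_eq_zero_right h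
  have hwp : ∀ i, HasWeakPartial Set.univ i (confFun (v i)) (toFun T (pd T i (v i))) := fun i =>
    ((hv i).hasWeakPartial i).congr_ae (by simpa using (hv i).confFun_ae_eq.symm) (by rfl)
  -- The potential of the field extended by zero. On the boundary the field vanishes, so f equals a
  -- constant c there, and f - c is the function sought.
  obtain ⟨f, hf⟩ := exists_hasFDerivAt_curlForm_of_lipschitz (F := fun j => confFun (v j))
    (C := max (C 0) (C 1)) (fun j => (hC j).weaken (by fin_cases j <;> simp))
    (hwp 0) (by have := hwp 1; rwa [hdiv, map_neg] at this)
  obtain ⟨c, hc⟩ := exists_eq_of_mem_frontier (P := P) (φ := f) fun x hx => by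
    have := hf x
    rwa [(hv 0).confFun_of_notMem (notMem_carrier_of_frontier hx),
      (hv 1).confFun_of_notMem (notMem_carrier_of_frontier hx), curlForm_zero] at this
  have hloc : ∀ K : T.elems, ∃ p : Poly, p.totalDegree ≤ d + 1 ∧
      MvPolynomial.pderiv 1 p = v 0 K ∧ -MvPolynomial.pderiv 0 p = v 1 K ∧
      ∀ x ∈ hull K, evalAt x p = f x - c := by
    intro K
    obtain ⟨p, hpd, hp1, hp0⟩ := exists_potential (v := fun j => v j K) (fun j => hd j K) (by
      have := congrFun h K
      rw [dive_apply] at this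
      exact this)
    obtain ⟨z, hz⟩ := interior_hull_nonempty K
    -- The polynomial potential on K differs from f by a constant, since both have the same
    -- derivative on a convex set; the constant is adjusted at one point z.
    refine ⟨p + MvPolynomial.C (f z - c - evalAt z p), ?_, ?_, ?_, fun x hx => ?_⟩
    · refine (MvPolynomial.totalDegree_add _ _).trans (max_le hpd ?_)
      rw [MvPolynomial.totalDegree_C]
      exact Nat.zero_le _
    · simpa using hp1
    · simpa using hp0
    · have := eq_of_hasFDerivAt_zero (f := fun x => f x - evalAt x p)
        (convex_convexHull ℝ (K.1 : Set Plane)) (fun x hx => by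
          have h1 := hf x
          have h2 := hasFDerivAt_evalAt p x
          rw [hp1, hp0] at h2
          rw [(hv 0).confFun_of_mem hx, (hv 1).confFun_of_mem hx] at h1
          have h3 := h1.sub h2
          rw [sub_self] at h3
          exact h3)
        hx (interior_subset hz)
      rw [evalAt_add, evalAt_C]
      linarith
  choose φ hφd hφ1 hφ0 hφ using hloc
  refine ⟨φ, ⟨fun K L x hK hL => by rw [hφ K x hK, hφ L x hL], fun K x hK hx => by
    rw [hφ K x hK, hc x hx, sub_self]⟩, hφd, ?_⟩
  ext1 j
  fin_cases j
  · exact funext hφ1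
  · exact funext hφ0

end

/-! ### Bubble functions and integrals on a single element. -/

section

variable {P : Polygon} {T : Mesh P}

/-! ### Gradients of barycentric coordinates -/

/-- The constant gradient of a barycentric coordinate. -/
def baryGrad (T : Mesh P) (K : T.elems) (a : Plane) (i : Fin 2) : ℝ :=
  evalAt 0 (MvPolynomial.pderiv i (bary T K a))

theorem pderiv_affinePoly (f : Plane →ᵃ[ℝ] ℝ) (i : Fin 2) : MvPolynomial.pderiv i (affinePoly f) =
    MvPolynomial.C (f.linear (EuclideanSpace.single i 1)) := by
  rw [affinePoly, map_add, map_sum, MvPolynomial.pderiv_C, zero_add, Finset.sum_eq_single i]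
  · simp
  · intro j _ hj
    simp [MvPolynomial.pderiv_X_of_ne hj]
  · simp

theorem pderiv_bary (K : T.elems) (a : Plane) (i : Fin 2) :
    MvPolynomial.pderiv i (bary T K a) = MvPolynomial.C (baryGrad T K a i) := by
  rw [baryGrad]
  by_cases h : a ∈ K.1
  · rw [bary, dif_pos h, pderiv_affinePoly, evalAt_C]
  · simp [bary_of_notMem h]

theorem evalAt_bary_sub (K : T.elems) (a x y : Plane) :
    baryGrad T K a 0 * (y 0 - x 0) + baryGrad T K a 1 * (y 1 - x 1) =
      evalAt y (bary T K a) - evalAt x (bary T K a) := by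
  obtain ⟨f, hf⟩ : ∃ f : Plane →ᵃ[ℝ] ℝ, bary T K a = affinePoly f := by
    by_cases h : a ∈ K.1
    · exact ⟨_, by rw [bary, dif_pos h]⟩
    · refine ⟨0, evalAt_ext fun x => ?_⟩
      simp [bary_of_notMem h]
  simp only [baryGrad, hf, pderiv_affinePoly, evalAt_C, evalAt_affinePoly]
  have h1 : f y - f x = f.linear (y - x) := by
    rw [← vsub_eq_sub (f y), ← vsub_eq_sub y, AffineMap.linearMap_vsub]
  have h2 := clm_apply_eq f.linear.toContinuousLinearMap (y - x)
  simp only [LinearMap.coe_toContinuousLinearMap', PiLp.sub_apply] at h2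
  rw [h1, h2]
  ring

theorem dirDeriv_bary (K : T.elems) (a x y : Plane) :
    dirDeriv (fun i => y i - x i) (bary T K a) =
      MvPolynomial.C (evalAt y (bary T K a) - evalAt x (bary T K a)) := by
  rw [dirDeriv_apply, pderiv_bary, pderiv_bary, ← evalAt_bary_sub]
  simp only [MvPolynomial.smul_eq_C_mul, ← map_mul, ← map_add]
  congr 1
  ring

/-- The gradients of the coordinates of b and c are dual to the edge vectors b - a and c - a, so the
two determinants multiply to one. -/
theorem det_ne_zero {K : T.elems} {a b c : Plane} (ha : a ∈ K.1) (hb : b ∈ K.1) (hc : c ∈ K.1)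
    (hab : a ≠ b) (hca : c ≠ a) (hcb : c ≠ b) :
    (b 0 - a 0) * (c 1 - a 1) - (b 1 - a 1) * (c 0 - a 0) ≠ 0 := by
  have h1 := evalAt_bary_sub K b a b
  have h2 := evalAt_bary_sub K b a c
  have h3 := evalAt_bary_sub K c a b
  have h4 := evalAt_bary_sub K c a c
  simp only [evalAt_bary_vertex ha, evalAt_bary_vertex hb, evalAt_bary_vertex hc, hab.symm, hca, hcb,
    hcb.symm, if_true, if_false, sub_zero] at h1 h2 h3 h4
  intro h
  have : (1 : ℝ) = (baryGrad T K b 0 * baryGrad T K c 1 - baryGrad T K b 1 * baryGrad T K c 0) *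
      ((b 0 - a 0) * (c 1 - a 1) - (b 1 - a 1) * (c 0 - a 0)) := by
    linear_combination (-1 : ℝ) * h1 -
      (baryGrad T K b 0 * (b 0 - a 0) + baryGrad T K b 1 * (b 1 - a 1)) * h4 +
      (baryGrad T K b 0 * (c 0 - a 0) + baryGrad T K b 1 * (c 1 - a 1)) * h3
  rw [h, mul_zero] at this
  exact one_ne_zero this

theorem isBarycentric_bary {K : T.elems} {a b c : Plane} (ha : a ∈ K.1) (hb : b ∈ K.1)
    (hc : c ∈ K.1) (hab : a ≠ b) (hca : c ≠ a) (hcb : c ≠ b)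
    (hK : ∀ v ∈ K.1, v = a ∨ v = b ∨ v = c) :
    IsBarycentric (bary T K a) (bary T K b) (bary T K c) where
  deg_x := totalDegree_bary_le K a
  deg_y := totalDegree_bary_le K b
  deg_z := totalDegree_bary_le K c
  sum := by rw [← sum_vertices ha hb hc hab hca hcb hK, sum_bary]
  X_mem i := ⟨a i, b i, c i, evalAt_ext fun x => by
    have := congrArg (fun y : Plane => y i) (sum_evalAt_bary_smul K x)
    simp only [sum_vertices ha hb hc hab hca hcb hK, PiLp.add_apply, PiLp.smul_apply,
      smul_eq_mul] at this
    simp only [evalAt_X, evalAt_add, evalAt_smul]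
    linarith⟩
  dir_xy := ⟨fun i => a i - b i, by
    simp [dirDeriv_bary, evalAt_bary_vertex ha, evalAt_bary_vertex hb, hab, hab.symm, hca, hcb]⟩
  dir_xz := ⟨fun i => a i - c i, by
    simp [dirDeriv_bary, evalAt_bary_vertex ha, evalAt_bary_vertex hc, hab.symm, hca, hca.symm,
      hcb.symm]⟩

/-! ### Polynomials that vanish on the boundary of an element -/

/-- The polynomial vanishes on the edges of the element `K`. -/
def VanishesOnEdges (K : T.elems) (p : Poly) : Prop :=
  ∀ b ∈ K.1, ∀ c ∈ K.1, b ≠ c → ∀ x ∈ segment ℝ b c, evalAt x p = 0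

theorem evalAt_bary_of_mem_segment {K : T.elems} {a b c x : Plane} (hb : b ∈ K.1) (hc : c ∈ K.1)
    (hba : b ≠ a) (hca : c ≠ a) (hx : x ∈ segment ℝ b c) : evalAt x (bary T K a) = 0 := by
  obtain ⟨s, t, -, -, hst, rfl⟩ := hx
  rw [evalAt_bary_combo _ _ _ _ hst, evalAt_bary_vertex hb, evalAt_bary_vertex hc, if_neg hba.symm,
    if_neg hca.symm]
  simp

theorem exists_mem_segment {K : T.elems} {a x : Plane} (ha : a ∈ K.1) (hx : x ∈ hull K)
    (h : evalAt x (bary T K a) = 0) :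
    ∃ b ∈ K.1, ∃ c ∈ K.1, b ≠ c ∧ b ≠ a ∧ c ≠ a ∧ x ∈ segment ℝ b c := by
  obtain ⟨b, hb, hba⟩ := Finset.exists_mem_ne (by rw [T.card_eq K.1 K.2]; norm_num) a
  obtain ⟨c, hc, hca, hcb, hK⟩ := exists_third ha hb hba.symm
  refine ⟨b, hb, c, hc, hcb.symm, hba, hca, evalAt x (bary T K b), evalAt x (bary T K c),
    mem_hull_iff.1 hx b, mem_hull_iff.1 hx c, ?_, ?_⟩
  · have := sum_evalAt_bary K x
    rwa [sum_vertices ha hb hc hba.symm hca hcb hK, h, zero_add] at this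
  · have := sum_evalAt_bary_smul K x
    rwa [sum_vertices ha hb hc hba.symm hca hcb hK, h, zero_smul, zero_add] at this

theorem exists_edge_of_notMem_interior {K : T.elems} {x : Plane} (hx : x ∈ hull K)
    (h : x ∉ interior (hull K)) : ∃ b ∈ K.1, ∃ c ∈ K.1, b ≠ c ∧ x ∈ segment ℝ b c := by
  rw [mem_interior_hull_iff] at h
  push Not at h
  obtain ⟨a, ha, h0⟩ := h
  obtain ⟨b, hb, c, hc, hbc, -, -, hs⟩ :=
    exists_mem_segment ha hx (le_antisymm h0 (mem_hull_iff.1 hx a))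
  exact ⟨b, hb, c, hc, hbc, hs⟩

theorem VanishesOnEdges.eq_zero {K : T.elems} {p : Poly} (hp : VanishesOnEdges K p) {x : Plane}
    (hx : x ∈ hull K) (h : x ∉ interior (hull K)) : evalAt x p = 0 := by
  obtain ⟨b, hb, c, hc, hbc, hs⟩ := exists_edge_of_notMem_interior hx h
  exact hp b hb c hc hbc x hs

theorem vanishesOnEdges_of_dvd {K : T.elems} {a b c : Plane} (ha : a ∈ K.1) (hb : b ∈ K.1)
    (hc : c ∈ K.1) (hab : a ≠ b) (hca : c ≠ a) (hcb : c ≠ b) {p : Poly}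
    (h : bary T K a * bary T K b * bary T K c ∣ p) : VanishesOnEdges K p := by
  intro d hd e he hde x hx
  obtain ⟨r, rfl⟩ := h
  have key : ∃ f, (f = a ∨ f = b ∨ f = c) ∧ d ≠ f ∧ e ≠ f := by
    by_contra! hcon
    have h1 := hcon a (by simp)
    have h2 := hcon b (by simp)
    have h3 := hcon c (by simp)
    grind
  obtain ⟨f, hf, hdf, hef⟩ := key
  have h0 := evalAt_bary_of_mem_segment (T := T) hd he hdf hef hx
  rcases hf with rfl | rfl | rfl <;> simp [h0]

/-- The restriction to the parametrised segment is the zero function. Derivatives are taken within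
[0, 1], so that the endpoints are covered too; they are what is needed at vertices. -/
theorem tangential_eq_zero {p : Poly} {b c : Plane} (h : ∀ x ∈ segment ℝ b c, evalAt x p = 0)
    {x : Plane} (hx : x ∈ segment ℝ b c) :
    (c 0 - b 0) * evalAt x (MvPolynomial.pderiv 0 p) +
      (c 1 - b 1) * evalAt x (MvPolynomial.pderiv 1 p) = 0 := by
  rw [segment_eq_image'] at hx
  obtain ⟨t, ht, rfl⟩ := hx
  have hd : HasDerivAt (fun t : ℝ => b + t • (c - b)) (c - b) t := by
    simpa using ((hasDerivAt_id t).smul_const (c - b)).const_add b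
  have h1 := (hasFDerivAt_evalAt p (b + t • (c - b))).comp_hasDerivAt t hd
  have h2 : HasDerivWithinAt (fun t : ℝ => evalAt (b + t • (c - b)) p) 0 (Set.Icc 0 1) t :=
    (hasDerivWithinAt_const t _ (0 : ℝ)).congr_of_mem (fun s hs => h _ (by
      rw [segment_eq_image']
      exact ⟨s, hs, rfl⟩)) ht
  have h3 := (uniqueDiffOn_Icc zero_lt_one t ht).eq_deriv _ h1.hasDerivWithinAt h2
  rw [curlForm_apply, evalAt_neg] at h3
  simp only [PiLp.sub_apply] at h3
  linarith

theorem eq_zero_of_det_ne_zero {u w g : Fin 2 → ℝ} (hd : u 0 * w 1 - u 1 * w 0 ≠ 0)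
    (hu : u 0 * g 0 + u 1 * g 1 = 0) (hw : w 0 * g 0 + w 1 * g 1 = 0) (i : Fin 2) : g i = 0 := by
  have h0 : (u 0 * w 1 - u 1 * w 0) * g 0 = 0 := by linear_combination w 1 * hu - u 1 * hw
  have h1 : (u 0 * w 1 - u 1 * w 0) * g 1 = 0 := by linear_combination u 0 * hw - w 0 * hu
  fin_cases i
  · exact (mul_eq_zero.1 h0).resolve_left hd
  · exact (mul_eq_zero.1 h1).resolve_left hd

/-- At a vertex the derivatives along two independent edges vanish. Hence a function that vanishes
on all edges is automatically C¹ at every vertex. -/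
theorem VanishesOnEdges.pderiv_vertex {K : T.elems} {p : Poly} (hp : VanishesOnEdges K p)
    {a : Plane} (ha : a ∈ K.1) (i : Fin 2) : evalAt a (MvPolynomial.pderiv i p) = 0 := by
  obtain ⟨b, hb, hba⟩ := Finset.exists_mem_ne (by rw [T.card_eq K.1 K.2]; norm_num) a
  obtain ⟨c, hc, hca, hcb, -⟩ := exists_third ha hb hba.symm
  exact eq_zero_of_det_ne_zero (u := fun i => b i - a i) (w := fun i => c i - a i)
    (g := fun i => evalAt a (MvPolynomial.pderiv i p)) (det_ne_zero ha hb hc hba.symm hca hcb)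
    (tangential_eq_zero (hp a ha b hb hba.symm) (left_mem_segment ℝ _ _))
    (tangential_eq_zero (hp a ha c hc hca.symm) (left_mem_segment ℝ _ _)) i

theorem isConf_of_vanishesOnEdges {p : Broken T} (hp : ∀ K, VanishesOnEdges K (p K)) : IsConf p where
  eq K L x hK hL := by
    by_cases hKL : K = L
    · rw [hKL]
    · rw [(hp K).eq_zero hK fun h => hKL (eq_of_mem_interior h hL),
        (hp L).eq_zero hL fun h => hKL (eq_of_mem_interior h hK).symm]
  zero K x hK hx := (hp K).eq_zero hK fun h =>
    notMem_carrier_of_frontier hx (interior_hull_subset K h)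

/-! ### Integrals over elements -/

theorem integrableOn_evalAt (K : T.elems) (p : Poly) :
    IntegrableOn (fun x => evalAt x p) (interior (hull K)) :=
  ((continuous_evalAt p).continuousOn.integrableOn_compact (isCompact_hull K)).mono_set
    interior_subset

/-- The integral of a polynomial over the element `K`. -/
def elemIntegral (K : T.elems) : Poly →ₗ[ℝ] ℝ where
  toFun p := ∫ x in interior (hull K), evalAt x p
  map_add' p q := by
    simp only [evalAt_add]
    exact integral_add (integrableOn_evalAt K p) (integrableOn_evalAt K q)
  map_smul' c p := by
    simp only [evalAt_smul, integral_const_mul, RingHom.id_apply, smul_eq_mul]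

theorem elemIntegral_apply (K : T.elems) (p : Poly) :
    elemIntegral K p = ∫ x in interior (hull K), evalAt x p := rfl

theorem elemIntegral_pos {K : T.elems} {p : Poly} (h : ∀ x ∈ interior (hull K), 0 < evalAt x p) :
    0 < elemIntegral K p := by
  rw [elemIntegral_apply, setIntegral_pos_iff_support_of_nonneg_ae]
  · refine lt_of_lt_of_le (isOpen_interior.measure_pos volume (interior_hull_nonempty K))
      (measure_mono fun x hx => ⟨(h x hx).ne', hx⟩)
  · filter_upwards [ae_restrict_mem isOpen_interior.measurableSet] with x hx using (h x hx).le
  · exact integrableOn_evalAt K p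

theorem elemIntegral_mul_self_nonneg (K : T.elems) (p : Poly) : 0 ≤ elemIntegral K (p * p) :=
  setIntegral_nonneg isOpen_interior.measurableSet fun x _ => by
    rw [evalAt_mul]; exact mul_self_nonneg _

theorem eq_zero_of_elemIntegral_mul_self {K : T.elems} {p : Poly} (h : elemIntegral K (p * p) = 0) :
    p = 0 := by
  have h0 : ∀ x ∈ interior (hull K), 0 ≤ evalAt x (p * p) := fun x _ => by
    rw [evalAt_mul]; exact mul_self_nonneg _
  rw [elemIntegral_apply, setIntegral_eq_zero_iff_of_nonneg_ae
    ((ae_restrict_mem isOpen_interior.measurableSet).mono h0) (integrableOn_evalAt K _)] at h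
  have h1 : Set.EqOn (fun x => evalAt x (p * p)) (fun _ => 0) (interior (hull K)) :=
    Measure.eqOn_open_of_ae_eq h isOpen_interior (continuous_evalAt _).continuousOn
      continuousOn_const
  refine poly_eq_zero_of_isOpen isOpen_interior (interior_hull_nonempty K) fun x hx => ?_
  have := h1 hx
  simp only [evalAt_mul, mul_self_eq_zero] at this
  exact this

theorem integral_toFun_inter (q : Broken T) {S : Set Plane}
    (R : T.elems → Prop) [DecidablePred R] (hR : ∀ K, R K → interior (hull K) ⊆ S)
    (hR' : ∀ K, ¬R K → Disjoint (interior (hull K)) S) :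
    ∫ x in S, toFun T q x = ∑ K : T.elems with R K, elemIntegral K (q K) := by
  have hInt : ∀ K : T.elems, Integrable ((interior (hull K)).indicator fun x => evalAt x (q K))
      (volume.restrict S) := fun K =>
    ((integrable_indicator_iff isOpen_interior.measurableSet).2 (integrableOn_evalAt K _)).restrict
  have h : ∀ x, toFun T q x = ∑ K : T.elems, (interior (hull K)).indicator
      (fun x => evalAt x (q K)) x := fun x => Finset.sum_apply _ _ _
  simp only [h]
  rw [integral_finsetSum _ fun K _ => hInt K, Finset.sum_filter]
  refine Finset.sum_congr rfl fun K _ => ?_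
  rw [setIntegral_indicator isOpen_interior.measurableSet]
  split_ifs with hK
  · rw [Set.inter_eq_right.2 (hR K hK), elemIntegral_apply]
  · rw [Set.inter_comm, Set.disjoint_iff_inter_eq_empty.1 (hR' K hK)]
    simp

theorem integral_toFun (q : Broken T) :
    ∫ x in P.carrier, toFun T q x = ∑ K : T.elems, elemIntegral K (q K) := by
  rw [integral_toFun_inter q (fun _ => True) (fun K _ => interior_hull_subset K)
    (by simp)]
  simp

theorem integralOn_hull (K : T.elems) (q : Broken T) :
    integralOn T (convexHull ℝ (K.1 : Set Plane)) q = elemIntegral K (q K) := by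
  classical
  rw [integralOn, integral_toFun_inter q (fun L => L = K)]
  · rw [Finset.filter_eq' Finset.univ K]
    simp
  · rintro _ rfl
    exact Set.subset_inter interior_subset (interior_hull_subset _)
  · intro L hL
    rw [Set.disjoint_left]
    exact fun x hx hx' => hL (eq_of_mem_interior hx hx'.1)

theorem integralOn_carrier (q : Broken T) :
    integralOn T P.carrier q = ∑ K : T.elems, elemIntegral K (q K) := by
  rw [integralOn, Set.inter_self, integral_toFun]

theorem toFun_mul (p q : Broken T) (x : Plane) :
    toFun T p x * toFun T q x = toFun T (p * q) x := by
  by_cases h : ∃ K : T.elems, x ∈ interior (hull K)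
  · obtain ⟨K, hK⟩ := h
    rw [toFun_of_mem hK, toFun_of_mem hK, toFun_of_mem hK, Pi.mul_apply, evalAt_mul]
  · simp only [toFun_of_forall_notMem (not_exists.1 h), zero_mul]

theorem l2_eq_sum (p q : Broken T) : l2 T p q = ∑ K : T.elems, elemIntegral K (p K * q K) := by
  simp only [l2, toFun_mul, integral_toFun, Pi.mul_apply]

theorem IsConf.sum_elemIntegral_pderiv {p : Broken T} (hp : IsConf p) (i : Fin 2) :
    ∑ K : T.elems, elemIntegral K (MvPolynomial.pderiv i (p K)) = 0 := by
  rw [← hp.integral_pd i, integral_toFun]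
  rfl

/-- Extended by zero to the other elements the polynomial is conforming, so the global statement
applies with a single nonzero term. -/
theorem VanishesOnEdges.elemIntegral_pderiv {K : T.elems} {p : Poly} (hp : VanishesOnEdges K p)
    (i : Fin 2) : elemIntegral K (MvPolynomial.pderiv i p) = 0 := by
  classical
  have hc : IsConf (Pi.single K p : Broken T) := isConf_of_vanishesOnEdges fun L => by
    by_cases h : L = K
    · subst h
      simpa using hp
    · rw [Pi.single_eq_of_ne h]
      intro b _ c _ _ x _
      simp
  have := hc.sum_elemIntegral_pderiv i
  rwa [Finset.sum_eq_single_of_mem K (Finset.mem_univ K) fun L _ h => by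
    rw [Pi.single_eq_of_ne h, map_zero, map_zero], Pi.single_eq_same] at this

/-- The divergence maps the polynomial bubble fields of an element onto the polynomials with mean
value zero that vanish at the vertices. -/
theorem exists_bubble_field (K : T.elems) {k : ℕ} (hk : 3 ≤ k) {q : Poly}
    (hq : q.totalDegree ≤ k - 1) (hv : ∀ a ∈ K.1, evalAt a q = 0) (hI : elemIntegral K q = 0) :
    ∃ v : Fin 2 → Poly, (∀ j, (v j).totalDegree ≤ k) ∧ (∀ j, VanishesOnEdges K (v j)) ∧
      MvPolynomial.pderiv 0 (v 0) + MvPolynomial.pderiv 1 (v 1) = q := by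
  obtain ⟨s, rfl⟩ := Nat.exists_eq_add_of_le' hk
  obtain ⟨a, ha⟩ := Finset.card_pos.1 (by rw [T.card_eq K.1 K.2]; norm_num : 0 < K.1.card)
  obtain ⟨b, hb, hba⟩ := Finset.exists_mem_ne (by rw [T.card_eq K.1 K.2]; norm_num) a
  obtain ⟨c, hc, hca, hcb, hK⟩ := exists_third ha hb hba.symm
  have h := isBarycentric_bary ha hb hc hba.symm hca hcb hK
  obtain ⟨v, hvd, hvw, hdiv⟩ := h.exists_bubble (s := s) hq (hv a ha) (hv b hb) (hv c hc)
    (by simp [evalAt_bary_vertex ha]) (by simp [evalAt_bary_vertex ha, hba])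
    (by simp [evalAt_bary_vertex ha, hca]) (by simp [evalAt_bary_vertex hb, hba.symm])
    (by simp [evalAt_bary_vertex hb]) (by simp [evalAt_bary_vertex hb, hcb])
    (by simp [evalAt_bary_vertex hc, hca.symm]) (by simp [evalAt_bary_vertex hc, hcb.symm])
    (by simp [evalAt_bary_vertex hc]) (elemIntegral K) (by
      rintro p ⟨v, -, hw, rfl⟩
      rw [map_add, (vanishesOnEdges_of_dvd ha hb hc hba.symm hca hcb (hw 0)).elemIntegral_pderiv,
        (vanishesOnEdges_of_dvd ha hb hc hba.symm hca hcb (hw 1)).elemIntegral_pderiv, add_zero])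
    (elemIntegral_pos fun x hx => by
      have := mem_interior_hull_iff.1 hx
      simp only [evalAt_mul, evalAt_pow]
      exact mul_pos (mul_pos (pow_pos (this a ha) s) (this b hb)) (this c hc)).ne' hI
  exact ⟨v, hvd, fun j => vanishesOnEdges_of_dvd ha hb hc hba.symm hca hcb (hvw j), hdiv⟩

end

/-! ### The spaces in pointwise terms, the complex, and the interior row. -/

section

variable {P : Polygon} {T : Mesh P}

/-! ### Membership in the finite element spaces -/

theorem mem_brokenPoly {d : ℕ} {p : Broken T} :
    p ∈ brokenPoly T d ↔ ∀ K, (p K).totalDegree ≤ d := by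
  simp [brokenPoly, Submodule.mem_pi, MvPolynomial.mem_restrictTotalDegree]

theorem mem_Sigma0 {k : ℕ} {φ : Broken T} : φ ∈ Sigma0 T k ↔ (∀ K, (φ K).totalDegree ≤ k + 1) ∧
    (IsConf φ ∧ ∀ i, IsConf (pd T i φ)) ∧ φ ∈ smoothAtNoncorner T 2 := by
  rw [Sigma0, Submodule.mem_inf, Submodule.mem_inf, mem_brokenPoly, Submodule.mem_comap,
    ← memSobolevZero_two_iff, and_assoc]
  rfl

/-- Membership in H¹₀(Ω) already contains membership in H¹(Ω) and, for piecewise polynomials,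
amounts to conformity. -/
theorem mem_V0 {k : ℕ} {v : Fin 2 → Broken T} : v ∈ V0 T k ↔ ∀ j, (∀ K, (v j K).totalDegree ≤ k) ∧
    IsConf (v j) ∧ v j ∈ smoothAtNoncorner T 1 := by
  simp only [V0, Submodule.mem_pi, Set.mem_univ, true_imp_iff, VScalar, Submodule.mem_inf,
    mem_brokenPoly, Submodule.mem_comap]
  refine forall_congr' fun j => ⟨fun h => ⟨h.1.1.1, memSobolevZero_one_iff.1 h.2, h.1.2⟩, fun h => ?_⟩
  have h0 := memSobolevZero_one_iff.2 h.2.1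
  exact ⟨⟨⟨h.1, h0.memSobolev⟩, h.2.2⟩, h0⟩

theorem mem_Q0 {k : ℕ} {q : Broken T} : q ∈ Q0 T k ↔ (∀ K, (q K).totalDegree ≤ k - 1) ∧
    q ∈ smoothAtNoncorner T 0 ∧ ∑ K : T.elems, elemIntegral K (q K) = 0 := by
  rw [← integralOn_carrier, ← mem_brokenPoly]
  constructor
  · rintro ⟨⟨⟨h1, -⟩, h2⟩, h3⟩
    exact ⟨h1, h2, h3⟩
  · rintro ⟨h1, h2, h3⟩
    exact ⟨⟨⟨h1, memLp_toFun T q⟩, h2⟩, h3⟩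

theorem mem_smoothAtNoncorner_zero {q : Broken T} : q ∈ smoothAtNoncorner T 0 ↔
    ∀ a, ¬P.IsCorner a → ∀ K L : T.elems, a ∈ K.1 → a ∈ L.1 → evalAt a (q K) = evalAt a (q L) := by
  constructor
  · intro h a ha K L hK hL
    exact h a ha K L hK hL [] le_rfl
  · intro h a ha K L hK hL l hl
    rw [List.length_eq_zero_iff.1 (Nat.le_zero.1 hl)]
    exact h a ha K L hK hL

theorem iterPd_append_singleton (l : List (Fin 2)) (i : Fin 2) (p : Poly) :
    iterPd (l ++ [i]) p = iterPd l (MvPolynomial.pderiv i p) := by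
  induction l with
  | nil => rfl
  | cons j l ih => exact congrArg (MvPolynomial.pderiv j) ih

theorem mem_smoothAtNoncorner_succ {r : ℕ} {q : Broken T} : q ∈ smoothAtNoncorner T (r + 1) ↔
    q ∈ smoothAtNoncorner T 0 ∧ ∀ i, pd T i q ∈ smoothAtNoncorner T r := by
  constructor
  · intro h
    refine ⟨fun a ha K L hK hL l hl => h a ha K L hK hL l (hl.trans (Nat.zero_le _)),
      fun i a ha K L hK hL l hl => ?_⟩
    have := h a ha K L hK hL (l ++ [i]) (by simpa using hl)
    rwa [iterPd_append_singleton, iterPd_append_singleton] at this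
  · rintro ⟨h0, h⟩ a ha K L hK hL l hl
    rcases l.eq_nil_or_concat with rfl | ⟨l, i, rfl⟩
    · exact h0 a ha K L hK hL [] le_rfl
    · rw [List.concat_eq_append, iterPd_append_singleton, iterPd_append_singleton]
      exact h i a ha K L hK hL l (by simpa using hl)

theorem IsConf.smooth_zero {q : Broken T} (hq : IsConf q) : q ∈ smoothAtNoncorner T 0 :=
  mem_smoothAtNoncorner_zero.2 fun a _ K L hK hL =>
    hq.eq K L a (vertex_mem_hull hK) (vertex_mem_hull hL)

theorem IsConf.neg {q : Broken T} (hq : IsConf q) : IsConf (-q) where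
  eq K L x hK hL := by simp [hq.eq K L x hK hL]
  zero K x hK hx := by simp [hq.zero K x hK hx]

/-! ### The complex -/

theorem dive_apply_apply (v : Fin 2 → Broken T) (K : T.elems) :
    dive T v K = MvPolynomial.pderiv 0 (v 0 K) + MvPolynomial.pderiv 1 (v 1 K) := by
  rw [dive_apply]; rfl

theorem dive_curl (φ : Broken T) : dive T (curl T φ) = 0 := by
  rw [dive_apply, curl_apply_zero, curl_apply_one, map_neg, pd_comm, add_neg_cancel]

theorem curl_mem_V0 {k : ℕ} {φ : Broken T} (h : φ ∈ Sigma0 T k) : curl T φ ∈ V0 T k := by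
  obtain ⟨hd, ⟨-, hc⟩, hs⟩ := mem_Sigma0.1 h
  have hs' := (mem_smoothAtNoncorner_succ.1 hs).2
  rw [mem_V0]
  intro j
  fin_cases j
  · exact ⟨fun K => totalDegree_pderiv_le (hd K) 1, hc 1, hs' 1⟩
  · refine ⟨fun K => ?_, (hc 0).neg, neg_mem (hs' 0)⟩
    change (-MvPolynomial.pderiv 0 (φ K)).totalDegree ≤ k
    rw [MvPolynomial.totalDegree_neg]
    exact totalDegree_pderiv_le (hd K) 0

/-- Zero mean comes from the vanishing trace. The bound 1 ≤ k makes the truncated subtraction `k -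
1` harmless. -/
theorem dive_mem_Q0 {k : ℕ} (hk : 1 ≤ k) {v : Fin 2 → Broken T} (h : v ∈ V0 T k) :
    dive T v ∈ Q0 T k := by
  rw [mem_V0] at h
  rw [mem_Q0]
  have hs : ∀ j, pd T j (v j) ∈ smoothAtNoncorner T 0 := fun j =>
    (mem_smoothAtNoncorner_succ.1 (h j).2.2).2 j
  refine ⟨fun K => ?_, ?_, ?_⟩
  · rw [dive_apply_apply]
    refine (MvPolynomial.totalDegree_add _ _).trans (max_le ?_ ?_)
    · exact totalDegree_pderiv_le (d := k - 1) (((h 0).1 K).trans (by omega)) 0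
    · exact totalDegree_pderiv_le (d := k - 1) (((h 1).1 K).trans (by omega)) 1
  · rw [dive_apply]
    exact add_mem (hs 0) (hs 1)
  · simp only [dive_apply_apply, map_add, Finset.sum_add_distrib,
      (h 0).2.1.sum_elemIntegral_pderiv, (h 1).2.1.sum_elemIntegral_pderiv, add_zero]

theorem curl_eq_zero {k : ℕ} {φ : Broken T} (h : φ ∈ Sigma0 T k) (h0 : curl T φ = 0) : φ = 0 := by
  have h1 : pd T 1 φ = 0 := congrFun h0 0
  have h2 : -pd T 0 φ = 0 := congrFun h0 1
  refine (mem_Sigma0.1 h).2.1.1.eq_zero_of_pd_eq_zero fun i => ?_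
  fin_cases i
  · exact neg_eq_zero.1 h2
  · exact h1

/-- The potential is continuous and its gradient is, up to order and sign, the given field; so C² at
noncorner vertices and membership in H²₀(Ω) are inherited from the components of the field. -/
theorem exists_curl_eq {k : ℕ} {v : Fin 2 → Broken T} (h : v ∈ V0 T k) (h0 : dive T v = 0) :
    ∃ φ ∈ Sigma0 T k, curl T φ = v := by
  rw [mem_V0] at h
  obtain ⟨φ, hc, hd, rfl⟩ := exists_isConf_curl_eq (fun j => (h j).2.1) (fun j => (h j).1) h0
  have h1 := (h 0).2
  have h2 := (h 1).2
  rw [curl_apply_zero] at h1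
  rw [curl_apply_one] at h2
  have h3 : IsConf (pd T 0 φ) := neg_neg (pd T 0 φ) ▸ h2.1.neg
  have h4 : pd T 0 φ ∈ smoothAtNoncorner T 1 := neg_mem_iff.1 h2.2
  refine ⟨φ, mem_Sigma0.2 ⟨hd, ⟨hc, fun i => ?_⟩, mem_smoothAtNoncorner_succ.2
    ⟨hc.smooth_zero, fun i => ?_⟩⟩, rfl⟩
  · fin_cases i
    exacts [h3, h1.1]
  · fin_cases i
    exacts [h4, h1.2]

/-! ### Interior spaces -/

theorem mem_VI {k : ℕ} {v : Fin 2 → Broken T} :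
    v ∈ VI T k ↔ v ∈ V0 T k ∧ ∀ K j, VanishesOnEdges K (v j K) :=
  and_congr_right fun _ => forall_congr' fun _ => ⟨fun h j b hb c hc hbc x hx => h b hb c hc hbc x hx j,
    fun h b hb c hc hbc x hx j => h j b hb c hc hbc x hx⟩

/-- Vanishing on all edges yields conformity and, since gradients vanish at the vertices, the C¹
condition for free. -/
theorem mem_VI_of_vanishes {k : ℕ} {v : Fin 2 → Broken T} (hd : ∀ j K, (v j K).totalDegree ≤ k)
    (h : ∀ K j, VanishesOnEdges K (v j K)) : v ∈ VI T k := by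
  refine mem_VI.2 ⟨mem_V0.2 fun j => ?_, h⟩
  have hc := isConf_of_vanishesOnEdges fun K => h K j
  refine ⟨hd j, hc, mem_smoothAtNoncorner_succ.2 ⟨hc.smooth_zero, fun i => ?_⟩⟩
  refine mem_smoothAtNoncorner_zero.2 fun a _ K L hK hL => ?_
  rw [pd_apply, pd_apply, (h K j).pderiv_vertex hK, (h L j).pderiv_vertex hL]

theorem mem_QI {k : ℕ} {q : Broken T} : q ∈ QI T k ↔ (∀ K, (q K).totalDegree ≤ k - 1) ∧
    ∀ K : T.elems, elemIntegral K (q K) = 0 ∧ ∀ a ∈ K.1, evalAt a (q K) = 0 := by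
  constructor
  · rintro ⟨h, h'⟩
    exact ⟨(mem_Q0.1 h).1, fun K => integralOn_hull K q ▸ h' K⟩
  · rintro ⟨h, h'⟩
    refine ⟨mem_Q0.2 ⟨h, ?_, ?_⟩, fun K => (integralOn_hull K q).symm ▸ h' K⟩
    · refine mem_smoothAtNoncorner_zero.2 fun a _ K L hK hL => ?_
      rw [(h' K).2 a hK, (h' L).2 a hL]
    · exact Finset.sum_eq_zero fun K _ => (h' K).1

theorem curl_mem_VI {k : ℕ} {φ : Broken T} (h : φ ∈ SigmaI T k) : curl T φ ∈ VI T k := by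
  refine mem_VI.2 ⟨curl_mem_V0 h.1, ?_⟩
  have key : ∀ K : T.elems, ∀ b ∈ K.1, ∀ c ∈ K.1, b ≠ c → ∀ x ∈ segment ℝ b c, ∀ i,
      evalAt x (MvPolynomial.pderiv i (φ K)) = 0 := by
    intro K b hb c hc hbc x hx
    have h1 := tangential_eq_zero (fun x hx => (h.2 K b hb c hc hbc x hx).1) hx
    -- The edge vector rotated by a right angle is a normal; with the tangential derivative it
    -- determines the gradient.
    have h2 := (h.2 K b hb c hc hbc x hx).2 (!₂[-(c 1 - b 1), c 0 - b 0]) (by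
      simp [PiLp.inner_apply, Fin.sum_univ_two]
      ring)
    simp only [Fin.sum_univ_two, pd_apply] at h2
    refine eq_zero_of_det_ne_zero (u := fun i => c i - b i)
      (w := !₂[-(c 1 - b 1), c 0 - b 0]) (g := fun i => evalAt x (MvPolynomial.pderiv i (φ K)))
      ?_ h1 h2
    simp only [Matrix.cons_val_zero, Matrix.cons_val_one]
    intro h0
    refine hbc ?_
    have h3 : c 0 - b 0 = 0 := by nlinarith [sq_nonneg (c 0 - b 0), sq_nonneg (c 1 - b 1)]
    have h4 : c 1 - b 1 = 0 := by nlinarith [sq_nonneg (c 0 - b 0), sq_nonneg (c 1 - b 1)]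
    ext i
    fin_cases i
    · exact (sub_eq_zero.1 h3).symm
    · exact (sub_eq_zero.1 h4).symm
  intro K j
  fin_cases j
  · exact fun b hb c hc hbc x hx => key K b hb c hc hbc x hx 1
  · intro b hb c hc hbc x hx
    change evalAt x (-MvPolynomial.pderiv 0 (φ K)) = 0
    rw [evalAt_neg, key K b hb c hc hbc x hx 0, neg_zero]

theorem dive_mem_QI {k : ℕ} (hk : 1 ≤ k) {v : Fin 2 → Broken T} (h : v ∈ VI T k) :
    dive T v ∈ QI T k := by
  obtain ⟨h0, hv⟩ := mem_VI.1 h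
  refine mem_QI.2 ⟨(mem_Q0.1 (dive_mem_Q0 hk h0)).1, fun K => ⟨?_, fun a ha => ?_⟩⟩
  · rw [dive_apply_apply, map_add, (hv K 0).elemIntegral_pderiv, (hv K 1).elemIntegral_pderiv,
      add_zero]
  · rw [dive_apply_apply, evalAt_add, (hv K 0).pderiv_vertex ha, (hv K 1).pderiv_vertex ha, add_zero]

theorem exists_dive_eq_of_mem_QI {k : ℕ} (hk : 3 ≤ k) {q : Broken T} (h : q ∈ QI T k) :
    ∃ v ∈ VI T k, dive T v = q := by
  obtain ⟨hd, hq⟩ := mem_QI.1 h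
  choose v hvd hve hdiv using fun K => exists_bubble_field K hk (hd K) (hq K).2 (hq K).1
  refine ⟨fun j K => v K j, mem_VI_of_vanishes (fun j K => hvd K j) hve, ?_⟩
  ext1 K
  rw [dive_apply_apply, hdiv K]

theorem exists_mem_hull_frontier (T : Mesh P) :
    ∃ K : T.elems, ∃ x ∈ hull K, x ∈ frontier P.carrier := by
  have hx : P.vertex 0 ∈ frontier P.carrier := mem_frontier_iff.2 ⟨0, left_mem_segment ℝ _ _⟩
  obtain ⟨K, hK⟩ := exists_mem_hull (T := T) (frontier_subset_closure hx)
  exact ⟨K, _, hK, hx⟩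

/-- The gradient vanishes on every edge, so φ is constant on each element boundary. The constants
agree across shared vertices, and one of them is zero because some element touches the boundary of
the polygon; connectivity of the mesh spreads this to all elements. -/
theorem mem_SigmaI_of_curl_mem_VI {k : ℕ} {φ : Broken T} (h : φ ∈ Sigma0 T k)
    (hv : curl T φ ∈ VI T k) : φ ∈ SigmaI T k := by
  have hv1 : ∀ K, VanishesOnEdges K (MvPolynomial.pderiv 1 (φ K)) := fun K => (mem_VI.1 hv).2 K 0
  have hv0 : ∀ K, VanishesOnEdges K (-MvPolynomial.pderiv 0 (φ K)) := fun K => (mem_VI.1 hv).2 K 1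
  have hconf := (mem_Sigma0.1 h).2.1.1
  have hconst : ∀ K : T.elems, ∀ b ∈ K.1, ∀ c ∈ K.1, ∀ x ∈ segment ℝ b c,
      evalAt x (φ K) = evalAt b (φ K) := by
    intro K b hb c hc x hx
    by_cases hbc : b = c
    · subst hbc
      rw [segment_same] at hx
      rw [Set.mem_singleton_iff.1 hx]
    refine eq_of_hasFDerivAt_zero (f := fun x => evalAt x (φ K)) (convex_segment b c) (fun y hy => ?_) hx (left_mem_segment ℝ _ _)
    have := hasFDerivAt_evalAt (φ K) y
    rwa [hv1 K b hb c hc hbc y hy, hv0 K b hb c hc hbc y hy, curlForm_zero] at this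
  have hvert : ∀ K : T.elems, ∀ b ∈ K.1, ∀ c ∈ K.1, evalAt c (φ K) = evalAt b (φ K) :=
    fun K b hb c hc => hconst K b hb c hc c (right_mem_segment ℝ _ _)
  obtain ⟨K₀, x, hx, hxΓ⟩ := exists_mem_hull_frontier T
  have hzero : ∀ K : T.elems, ∀ b ∈ K.1, evalAt b (φ K) = 0 := by
    refine mesh_induction (fun K : T.elems => ∀ b ∈ K.1, evalAt b (φ K) = 0) ?_ (K₀ := K₀) ?_
    · intro K L a b _ haK haL _ _ hK c hc
      rw [hvert L a haL c hc, ← hconf.eq K L a (vertex_mem_hull haK) (vertex_mem_hull haL), hK a haK]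
    · intro b hb
      obtain ⟨c, hc, d, hd, -, hs⟩ := exists_edge_of_notMem_interior hx fun hi =>
        notMem_carrier_of_frontier hxΓ (interior_hull_subset K₀ hi)
      rw [hvert K₀ c hc b hb, ← hconst K₀ c hc d hd x hs, hconf.zero K₀ x hx hxΓ]
  refine ⟨h, fun K b hb c hc hbc x hx => ⟨by rw [hconst K b hb c hc x hx, hzero K b hb],
    fun n _ => ?_⟩⟩
  have h0 := hv0 K b hb c hc hbc x hx
  rw [evalAt_neg, neg_eq_zero] at h0
  rw [Fin.sum_univ_two, pd_apply, pd_apply, h0, hv1 K b hb c hc hbc x hx, mul_zero, mul_zero,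
    add_zero]

end

/-! ### Orthogonal splittings and exactness of the rows. -/

section

variable {P : Polygon} {T : Mesh P}

/-! ### Orthogonal decompositions -/

/-- A definite form on a finite-dimensional space embeds it injectively, hence bijectively, into its
dual. -/
theorem exists_representative {E : Type*} [AddCommGroup E] [Module ℝ E] (B : E →ₗ[ℝ] E →ₗ[ℝ] ℝ)
    (Y : Submodule ℝ E) [FiniteDimensional ℝ Y] (hB : ∀ y ∈ Y, B y y = 0 → y = 0) (f : E →ₗ[ℝ] ℝ) :
    ∃ y ∈ Y, ∀ z ∈ Y, B y z = f z := by
  let A : Y →ₗ[ℝ] Module.Dual ℝ Y := (B.domRestrict Y).compl₂ Y.subtype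
  have hA : Function.Injective A := by
    rw [injective_iff_map_eq_zero]
    intro y hy
    have := LinearMap.congr_fun hy y
    exact Subtype.ext (hB y y.2 this)
  have hsurj := (LinearMap.injective_iff_surjective_of_finrank_eq_finrank
    Subspace.dual_finrank_eq.symm).1 hA
  obtain ⟨y, hy⟩ := hsurj (f.domRestrict Y)
  exact ⟨y, y.2, fun z hz => LinearMap.congr_fun hy ⟨z, hz⟩⟩

/-- The representative in Y of B(x, ·) is the orthogonal projection of x, and definiteness makes the
intersection trivial. The ambient space need not be finite-dimensional. -/
theorem isDirectSum_of_definite {E : Type*} [AddCommGroup E] [Module ℝ E]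
    (B : E →ₗ[ℝ] E →ₗ[ℝ] ℝ) {X Y Z : Submodule ℝ E} [FiniteDimensional ℝ Y] (hYX : Y ≤ X)
    (hZ : ∀ z, z ∈ Z ↔ z ∈ X ∧ ∀ y ∈ Y, B z y = 0) (hB : ∀ y ∈ Y, B y y = 0 → y = 0) :
    IsDirectSum X Y Z := by
  constructor
  · refine le_antisymm (sup_le hYX fun z hz => ((hZ z).1 hz).1) fun x hx => ?_
    obtain ⟨y, hy, hyz⟩ := exists_representative B Y hB (B x)
    refine Submodule.mem_sup.2 ⟨y, hy, x - y, (hZ _).2 ⟨sub_mem hx (hYX hy), fun z hz => ?_⟩,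
      add_sub_cancel y x⟩
    rw [map_sub, LinearMap.sub_apply, hyz z hz, sub_self]
  · rw [eq_bot_iff]
    rintro y ⟨hy, hyZ⟩
    exact hB y hy (((hZ y).1 hyZ).2 y hy)

theorem l2_comm (p q : Broken T) : l2 T p q = l2 T q p := by
  simp only [l2, mul_comm]

/-- The `L²` inner product as a bilinear form. -/
def l2Form (T : Mesh P) : Broken T →ₗ[ℝ] Broken T →ₗ[ℝ] ℝ :=
  LinearMap.mk₂ ℝ (l2 T) (l2_add T) (l2_smul T)
    (fun p q q' => by rw [l2_comm, l2_add, l2_comm q, l2_comm q'])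
    (fun c p q => by rw [l2_comm, l2_smul, l2_comm q]; rfl)

theorem l2_self_nonneg (p : Broken T) : 0 ≤ l2 T p p := by
  rw [l2_eq_sum]
  exact Finset.sum_nonneg fun K _ => elemIntegral_mul_self_nonneg K (p K)

theorem eq_zero_of_l2_self {p : Broken T} (h : l2 T p p = 0) : p = 0 := by
  rw [l2_eq_sum, Finset.sum_eq_zero_iff_of_nonneg
    fun K _ => elemIntegral_mul_self_nonneg K (p K)] at h
  exact funext fun K => eq_zero_of_elemIntegral_mul_self (h K (Finset.mem_univ K))

theorem aForm_comm (ν : ℝ) (u v : Fin 2 → Broken T) : aForm T ν u v = aForm T ν v u := by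
  simp only [aForm, l2_comm]

/-- The form `a` as a bilinear form. -/
def aBilin (T : Mesh P) (ν : ℝ) : (Fin 2 → Broken T) →ₗ[ℝ] (Fin 2 → Broken T) →ₗ[ℝ] ℝ :=
  LinearMap.mk₂ ℝ (aForm T ν) (aForm_add T ν) (fun c u v => aForm_smul T ν c u v)
    (fun p q q' => by rw [aForm_comm, aForm_add, aForm_comm ν q, aForm_comm ν q'])
    (fun c p q => by rw [aForm_comm, aForm_smul, aForm_comm ν q]; rfl)

theorem aBilin_apply (ν : ℝ) (u v : Fin 2 → Broken T) : aBilin T ν u v = aForm T ν u v := rfl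

/-- All gradients vanish elementwise, and a conforming function with zero gradient is zero because
of its boundary values. -/
theorem eq_zero_of_aForm_self {ν : ℝ} (hν : 0 < ν) {k : ℕ} {v : Fin 2 → Broken T}
    (hv : v ∈ V0 T k) (h : aForm T ν v v = 0) : v = 0 := by
  rw [aForm, mul_eq_zero, or_iff_right hν.ne', Finset.sum_eq_zero_iff_of_nonneg
    fun j _ => Finset.sum_nonneg fun i _ => l2_self_nonneg _] at h
  refine funext fun j => (mem_V0.1 hv j).2.1.eq_zero_of_pd_eq_zero fun i => ?_
  have h1 := h j (Finset.mem_univ j)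
  rw [Finset.sum_eq_zero_iff_of_nonneg fun i _ => l2_self_nonneg _] at h1
  exact eq_zero_of_l2_self (h1 i (Finset.mem_univ i))

instance (d : ℕ) : FiniteDimensional ℝ (brokenPoly T d) := by
  let f : brokenPoly T d →ₗ[ℝ] (T.elems → MvPolynomial.restrictTotalDegree (Fin 2) ℝ d) :=
    LinearMap.pi fun K => ((LinearMap.proj K).comp (Submodule.subtype _)).codRestrict _
      fun p => p.2 K (Set.mem_univ K)
  refine FiniteDimensional.of_injective f fun p q h => Subtype.ext (funext fun K => ?_)
  exact congrArg Subtype.val (congrFun h K)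

theorem finiteDimensional_of_degree_le {S : Submodule ℝ (Broken T)} {d : ℕ}
    (h : ∀ p ∈ S, ∀ K, (p K).totalDegree ≤ d) : FiniteDimensional ℝ S :=
  Submodule.finiteDimensional_of_le (S₂ := brokenPoly T d) fun p hp => mem_brokenPoly.2 (h p hp)

instance (k : ℕ) : FiniteDimensional ℝ (QI T k) :=
  finiteDimensional_of_degree_le fun _ h => (mem_QI.1 h).1

instance (k : ℕ) : FiniteDimensional ℝ (SigmaI T k) :=
  finiteDimensional_of_degree_le fun _ h => (mem_Sigma0.1 h.1).1

/-- The form `a(curl φ, curl ψ)`. -/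
def curlBilin (T : Mesh P) (ν : ℝ) : Broken T →ₗ[ℝ] Broken T →ₗ[ℝ] ℝ :=
  (aBilin T ν).compl₁₂ (curl T) (curl T)

theorem curlBilin_definite {ν : ℝ} (hν : 0 < ν) {k : ℕ} :
    ∀ φ ∈ SigmaI T k, curlBilin T ν φ φ = 0 → φ = 0 := fun _ h h0 =>
  curl_eq_zero h.1 (eq_zero_of_aForm_self hν (curl_mem_V0 h.1) h0)

theorem isDirectSum_Q (T : Mesh P) (k : ℕ) : IsDirectSum (Q0 T k) (QI T k) (QE T k) :=
  isDirectSum_of_definite (l2Form T) (fun _ h => h.1) (fun _ => Iff.rfl)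
    fun _ _ h => eq_zero_of_l2_self h

theorem isDirectSum_Sigma (T : Mesh P) {ν : ℝ} (hν : 0 < ν) (k : ℕ) :
    IsDirectSum (Sigma0 T k) (SigmaI T k) (SigmaE T ν k) :=
  isDirectSum_of_definite (curlBilin T ν) (fun _ h => h.1) (fun _ => Iff.rfl)
    (curlBilin_definite hν)

/-- Existence: the Q_I part of div v is the divergence of some w in 𝐕_I, and v - w is made
orthogonal to curls from Σ_I by subtracting such a curl, which leaves its divergence unchanged.
Uniqueness: a field in both summands has divergence in Q_I ∩ Q̃_E = 0, so it is the curl of a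
function in Σ_I and orthogonal to itself. -/
theorem isDirectSum_V (T : Mesh P) {ν : ℝ} (hν : 0 < ν) {k : ℕ} (hk : 3 ≤ k) :
    IsDirectSum (V0 T k) (VI T k) (VE T ν k) := by
  constructor
  · refine le_antisymm (sup_le (fun _ h => h.1) fun _ h => h.1) fun v hv => ?_
    have hdiv : dive T v ∈ Q0 T k := dive_mem_Q0 (by omega) hv
    rw [← (isDirectSum_Q T k).1] at hdiv
    obtain ⟨q, hq, r, hr, hqr⟩ := Submodule.mem_sup.1 hdiv
    obtain ⟨w, hw, rfl⟩ := exists_dive_eq_of_mem_QI hk hq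
    obtain ⟨φ, hφ, hφψ⟩ := exists_representative (curlBilin T ν) (SigmaI T k)
      (curlBilin_definite hν) ((aBilin T ν (v - w)).comp (curl T))
    refine Submodule.mem_sup.2 ⟨w + curl T φ, add_mem hw (curl_mem_VI hφ), v - w - curl T φ,
      ⟨sub_mem (sub_mem hv hw.1) (curl_mem_V0 hφ.1), ?_, fun ψ hψ => ?_⟩, by abel⟩
    · rw [map_sub, map_sub, dive_curl, sub_zero, ← hqr, add_sub_cancel_left]
      exact hr
    · rw [← aBilin_apply, map_sub, LinearMap.sub_apply]
      exact sub_eq_zero.2 (hφψ ψ hψ).symm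
  · rw [eq_bot_iff]
    rintro v ⟨hv, hvE⟩
    have h0 : dive T v ∈ QI T k ⊓ QE T k := ⟨dive_mem_QI (by omega) hv, hvE.2.1⟩
    rw [(isDirectSum_Q T k).2] at h0
    obtain ⟨φ, hφ, rfl⟩ := exists_curl_eq hv.1 h0
    exact eq_zero_of_aForm_self hν hv.1 (hvE.2.2 φ (mem_SigmaI_of_curl_mem_VI hφ hv))

/-! ### Exact rows -/

theorem isExactRow_of {S : Submodule ℝ (Broken T)} {W : Submodule ℝ (Fin 2 → Broken T)}
    {R : Submodule ℝ (Broken T)} (hc : ∀ φ ∈ S, curl T φ ∈ W) (hd : ∀ v ∈ W, dive T v ∈ R)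
    (hinj : ∀ φ ∈ S, curl T φ = 0 → φ = 0)
    (hex : ∀ v ∈ W, dive T v = 0 → ∃ φ ∈ S, curl T φ = v)
    (hsurj : ∀ q ∈ R, ∃ v ∈ W, dive T v = q) : IsExactRow T S W R := by
  refine ⟨hc, hd, ?_, ?_, ?_⟩
  · rw [injective_iff_map_eq_zero]
    exact fun φ h => Subtype.ext (hinj φ φ.2 (congrArg Subtype.val h))
  · intro v
    constructor
    · intro h
      obtain ⟨φ, hφ, h'⟩ := hex v v.2 (congrArg Subtype.val h)
      exact ⟨⟨φ, hφ⟩, Subtype.ext h'⟩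
    · rintro ⟨φ, rfl⟩
      exact Subtype.ext (dive_curl φ.1)
  · rintro ⟨q, hq⟩
    obtain ⟨v, hv, h⟩ := hsurj q hq
    exact ⟨⟨v, hv⟩, Subtype.ext h⟩

theorem isExactRow_interior (T : Mesh P) {k : ℕ} (hk : 3 ≤ k) :
    IsExactRow T (SigmaI T k) (VI T k) (QI T k) := by
  refine isExactRow_of (fun _ => curl_mem_VI) (fun _ => dive_mem_QI (by omega))
    (fun φ hφ => curl_eq_zero hφ.1) (fun v hv h => ?_) (fun q => exists_dive_eq_of_mem_QI hk)
  obtain ⟨φ, hφ, rfl⟩ := exists_curl_eq hv.1 h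
  exact ⟨φ, mem_SigmaI_of_curl_mem_VI hφ hv, rfl⟩

theorem isExactRow_full {k : ℕ} (hk : 3 ≤ k) (hsurj : ∀ q ∈ Q0 T k, ∃ v ∈ V0 T k, dive T v = q) :
    IsExactRow T (Sigma0 T k) (V0 T k) (Q0 T k) :=
  isExactRow_of (fun _ => curl_mem_V0) (fun _ => dive_mem_Q0 (by omega))
    (fun _ => curl_eq_zero) (fun _ => exists_curl_eq) hsurj

/-- For surjectivity, q is lifted to 𝐕₀ and the interior component of the lift is dropped; the
divergence of that component lies in Q_I ∩ Q̃_E, hence is zero. The potential of a divergence-free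
exterior field is exterior by the orthogonality condition itself. -/
theorem isExactRow_exterior {k : ℕ} (hk : 3 ≤ k) {ν : ℝ} (hν : 0 < ν)
    (hsurj : ∀ q ∈ Q0 T k, ∃ v ∈ V0 T k, dive T v = q) :
    IsExactRow T (SigmaE T ν k) (VE T ν k) (QE T k) := by
  refine isExactRow_of (fun φ hφ => ⟨curl_mem_V0 hφ.1, ?_, hφ.2⟩) (fun v hv => hv.2.1)
    (fun φ hφ => curl_eq_zero hφ.1) (fun v hv h => ?_) (fun q hq => ?_)
  · rw [dive_curl]
    exact zero_mem _
  · obtain ⟨φ, hφ, rfl⟩ := exists_curl_eq hv.1 h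
    exact ⟨φ, ⟨hφ, hv.2.2⟩, rfl⟩
  · obtain ⟨v, hv, rfl⟩ := hsurj q hq.1
    rw [← (isDirectSum_V T hν hk).1] at hv
    obtain ⟨w, hw, z, hz, rfl⟩ := Submodule.mem_sup.1 hv
    refine ⟨z, hz, ?_⟩
    have h0 : dive T w ∈ QI T k ⊓ QE T k := by
      refine ⟨dive_mem_QI (by omega) hw, ?_⟩
      have := sub_mem hq hz.2.1
      rwa [map_add, add_sub_cancel_right] at this
    rw [(isDirectSum_Q T k).2, Submodule.mem_bot] at h0
    rw [map_add, h0, zero_add]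

end

/-! ### Surjectivity of the divergence from 𝐕₀ onto Q₀. -/

section

variable {P : Polygon} {T : Mesh P}

/-! ### Fields concentrated at vertices and edges -/

theorem IsConf.smul {q : Broken T} (hq : IsConf q) (c : ℝ) : IsConf (c • q) where
  eq K L x hK hL := by simp [hq.eq K L x hK hL]
  zero K x hK hx := by simp [hq.zero K x hK hx]

theorem smul_mem_V0 {k : ℕ} {p : Broken T} (hd : ∀ K, (p K).totalDegree ≤ k) (hc : IsConf p)
    (hs : p ∈ smoothAtNoncorner T 1) (w : Fin 2 → ℝ) : (fun j => w j • p) ∈ V0 T k :=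
  mem_V0.2 fun j => ⟨fun K => (MvPolynomial.totalDegree_smul_le _ _).trans (hd K), hc.smul (w j),
    Submodule.smul_mem _ _ hs⟩

theorem dive_smul_apply (w : Fin 2 → ℝ) (p : Broken T) (K : T.elems) :
    dive T (fun j => w j • p) K =
      w 0 • MvPolynomial.pderiv 0 (p K) + w 1 • MvPolynomial.pderiv 1 (p K) := by
  rw [dive_apply_apply]
  simp only [Pi.smul_apply, Derivation.map_smul]

/-- The square λ_a² vanishes to second order at the other vertices, and G kills its derivative at a,
so among the vertex gradients only that of G at a survives. -/
theorem evalAt_pderiv_mul_sq {K : T.elems} {a : Plane} {G : Poly} (hG : evalAt a G = 0)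
    {x : Plane} (hx : x ∈ K.1) (i : Fin 2) :
    evalAt x (MvPolynomial.pderiv i (G * bary T K a ^ 2)) =
      if a = x then evalAt a (MvPolynomial.pderiv i G) else 0 := by
  have h : MvPolynomial.pderiv i (G * bary T K a ^ 2) = MvPolynomial.pderiv i G * bary T K a ^ 2 +
      MvPolynomial.C (2 * baryGrad T K a i) * G * bary T K a := by
    rw [Derivation.leibniz, Derivation.leibniz_pow, pderiv_bary]
    simp only [smul_eq_mul, nsmul_eq_mul, map_mul, map_ofNat]
    push_cast
    ring
  rw [h]
  simp only [evalAt_add, evalAt_mul, evalAt_pow, evalAt_C, evalAt_bary_vertex hx]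
  split_ifs with hax
  · rw [← hax, hG]
    ring
  · ring

theorem totalDegree_mul_sq_le {K : T.elems} {a : Plane} {G : Poly} {d : ℕ}
    (hG : G.totalDegree ≤ d) : (G * bary T K a ^ 2).totalDegree ≤ d + 2 := by
  refine (MvPolynomial.totalDegree_mul _ _).trans (add_le_add hG ?_)
  refine (MvPolynomial.totalDegree_pow _ _).trans ?_
  have := totalDegree_bary_le K a
  omega

/-- Where the product is nonzero, the element contains both a and b, and the point has positive
coordinates at both ends of an interior edge, so it lies in the open domain. -/
theorem isConf_edge {K L : T.elems} (hKL : K ≠ L) {a b : Plane} (hab : a ≠ b) (haK : a ∈ K.1)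
    (hbK : b ∈ K.1) (haL : a ∈ L.1) (hbL : b ∈ L.1) {m : ℕ} (hm : m ≠ 0) :
    IsConf (fun M : T.elems => bary T M b ^ m * bary T M a ^ 2) where
  eq M N x hM hN := by simp [evalAt_bary_eq hM hN]
  zero M x hM hx := by
    by_contra h
    simp only [evalAt_mul, evalAt_pow, mul_eq_zero, not_or, pow_eq_zero_iff two_ne_zero,
      pow_eq_zero_iff hm] at h
    have hb := (mem_hull_iff.1 hM b).lt_of_ne' h.1
    have ha := (mem_hull_iff.1 hM a).lt_of_ne' h.2
    have haM := mem_of_bary_pos hM hM ha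
    have hbM := mem_of_bary_pos hM hM hb
    refine notMem_carrier_of_frontier hx ?_
    by_cases hMK : M = K
    · exact mem_carrier_of_common_edge (hMK ▸ hKL) hab haM hbM haL hbL hM ha hb
    · exact mem_carrier_of_common_edge hMK hab haM hbM haK hbK hM ha hb

/-- The fields in `𝐕₀` whose divergence vanishes at all vertices outside `S`. -/
def divFlat (T : Mesh P) (k : ℕ) (S : Set Plane) : Submodule ℝ (Fin 2 → Broken T) where
  carrier := {v | v ∈ V0 T k ∧ ∀ K : T.elems, ∀ b ∈ K.1, b ∉ S → evalAt b (dive T v K) = 0}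
  zero_mem' := ⟨zero_mem _, by simp⟩
  add_mem' := fun hu hv => ⟨add_mem hu.1 hv.1, fun K b hb hS => by
    simp [hu.2 K b hb hS, hv.2 K b hb hS]⟩
  smul_mem' := fun c v hv => ⟨Submodule.smul_mem _ c hv.1, fun K b hb hS => by
    simp [hv.2 K b hb hS]⟩

/-! ### Vertex values of divergences -/

/-- All boundary edges at a noncorner vertex lie on one line, so some affine G with nonzero gradient
vanishes on them. G λ_a² is conforming, of degree 3, and has the same gradient at a from all
elements because G does not depend on the element; it is directed along that gradient. -/
theorem exists_field_noncorner {a : Plane} (ha : ¬P.IsCorner a) {k : ℕ} (hk : 3 ≤ k) (r : ℝ) :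
    ∃ v ∈ divFlat T k {a}, ∀ K : T.elems, a ∈ K.1 → evalAt a (dive T v K) = r := by
  obtain ⟨g, hg, hΓ⟩ := exists_normal ha
  set G : Poly := g 0 • (MvPolynomial.X 0 - MvPolynomial.C (a 0)) +
    g 1 • (MvPolynomial.X 1 - MvPolynomial.C (a 1)) with hGdef
  have hGe : ∀ x : Plane, evalAt x G = g 0 * (x 0 - a 0) + g 1 * (x 1 - a 1) := fun x => by
    simp [hGdef]
  have hGa : evalAt a G = 0 := by simp [hGe]
  have hGd : ∀ i, MvPolynomial.pderiv i G = MvPolynomial.C (g i) := by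
    intro i
    fin_cases i <;> simp [hGdef, MvPolynomial.smul_eq_C_mul, MvPolynomial.pderiv_X]
  have hdeg : G.totalDegree ≤ 1 := by
    have h1 : ∀ i, (g i • (MvPolynomial.X i - MvPolynomial.C (a i)) : Poly).totalDegree ≤ 1 := by
      intro i
      refine (MvPolynomial.totalDegree_smul_le _ _).trans ?_
      exact (MvPolynomial.totalDegree_sub_C_le _ _).trans (MvPolynomial.totalDegree_X i).le
    exact (MvPolynomial.totalDegree_add _ _).trans (max_le (h1 0) (h1 1))
  set p : Broken T := fun K => G * bary T K a ^ 2 with hp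
  have hconf : IsConf p := by
    refine ⟨fun K L x hK hL => by simp [hp, evalAt_bary_eq hK hL], fun K x hK hx => ?_⟩
    rw [hp]
    simp only [evalAt_mul, evalAt_pow]
    by_cases h0 : evalAt x (bary T K a) = 0
    · simp [h0]
    have hpos := (mem_hull_iff.1 hK a).lt_of_ne' h0
    have haK := mem_of_bary_pos hK hK hpos
    suffices evalAt x G = 0 by rw [this, zero_mul]
    have h1 := fun i : Fin 2 => congrArg (fun y : Plane => y i) (sum_evalAt_bary_smul K x)
    have h2 := sum_evalAt_bary K x
    -- G is the average of its vertex values. If b ≠ a has a positive coordinate at the boundary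
    -- point x, the edge ab lies on the boundary and G vanishes at b.
    have h3 : evalAt x G = ∑ b ∈ K.1, evalAt x (bary T K b) *
        (g 0 * (b 0 - a 0) + g 1 * (b 1 - a 1)) := by
      have e : ∀ i : Fin 2, x i - a i = ∑ b ∈ K.1, evalAt x (bary T K b) * (b i - a i) := by
        intro i
        simp only [mul_sub, Finset.sum_sub_distrib, ← Finset.sum_mul, h2, one_mul]
        have := h1 i
        simp only [WithLp.ofLp_sum, Finset.sum_apply, PiLp.smul_apply, smul_eq_mul] at this
        rw [this]
      rw [hGe, e 0, e 1, Finset.mul_sum, Finset.mul_sum, ← Finset.sum_add_distrib]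
      exact Finset.sum_congr rfl fun b _ => by ring
    rw [h3]
    refine Finset.sum_eq_zero fun b hb => ?_
    by_cases hb0 : evalAt x (bary T K b) = 0
    · rw [hb0, zero_mul]
    by_cases hab : a = b
    · rw [hab]; ring
    rw [hΓ b (segment_subset_frontier_of_mem hab haK hb hK hx hpos
      ((mem_hull_iff.1 hK b).lt_of_ne' hb0)), mul_zero]
  have hpd : ∀ (K : T.elems) (x : Plane), x ∈ K.1 → ∀ i,
      evalAt x (MvPolynomial.pderiv i (p K)) = if a = x then g i else 0 := fun K x hx i => by
    rw [hp, evalAt_pderiv_mul_sq hGa hx, hGd, evalAt_C]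
  have hsm : p ∈ smoothAtNoncorner T 1 := by
    refine mem_smoothAtNoncorner_succ.2 ⟨hconf.smooth_zero, fun i =>
      mem_smoothAtNoncorner_zero.2 fun x _ K L hK hL => ?_⟩
    rw [pd_apply, pd_apply, hpd K x hK, hpd L x hL]
  -- The divergence at a of the field s g G λ_a² is s |g|².
  set s := r / (g 0 * g 0 + g 1 * g 1)
  refine ⟨fun j => (s * g j) • p, ⟨smul_mem_V0 (fun K =>
    (totalDegree_mul_sq_le hdeg).trans hk) hconf hsm fun j => s * g j, fun K b hb hba => ?_⟩,
    fun K haK => ?_⟩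
  · rw [dive_smul_apply (fun j => s * g j)]
    simp only [evalAt_add, evalAt_smul, hpd K b hb, if_neg (Ne.symm hba)]
    ring
  · rw [dive_smul_apply (fun j => s * g j)]
    simp only [evalAt_add, evalAt_smul, hpd K a haK, if_true]
    have : s * (g 0 * g 0 + g 1 * g 1) = r := div_mul_cancel₀ r hg.ne'
    linarith

/-- The field w λ_b λ_a² on an interior edge ab. Its gradients vanish at all vertices except the
corner a, where no smoothness is demanded, so different divergences on the two sides of the edge are
allowed. -/
theorem edge_field_mem_divFlat {K L : T.elems} (hKL : K ≠ L) {a b : Plane} (ha : P.IsCorner a)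
    (hab : a ≠ b) (haK : a ∈ K.1) (hbK : b ∈ K.1) (haL : a ∈ L.1) (hbL : b ∈ L.1) {k : ℕ}
    (hk : 3 ≤ k) (w : Fin 2 → ℝ) :
    ∃ v ∈ divFlat T k {a}, ∀ M : T.elems, a ∈ M.1 → evalAt a (dive T v M) =
      w 0 * baryGrad T M b 0 + w 1 * baryGrad T M b 1 := by
  set p : Broken T := fun M => bary T M b ^ 1 * bary T M a ^ 2 with hp
  have hconf : IsConf p := isConf_edge hKL hab haK hbK haL hbL one_ne_zero
  have hpd : ∀ (M : T.elems) (x : Plane), a ∈ M.1 → x ∈ M.1 → ∀ i,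
      evalAt x (MvPolynomial.pderiv i (p M)) = if a = x then baryGrad T M b i else 0 := by
    intro M x haM hx i
    simp only [hp, pow_one]
    rw [evalAt_pderiv_mul_sq (by rw [evalAt_bary_vertex haM, if_neg hab.symm]) hx, pderiv_bary,
      evalAt_C]
  have hpd0 : ∀ (M : T.elems) (x : Plane), x ∈ M.1 → x ≠ a → ∀ i,
      evalAt x (MvPolynomial.pderiv i (p M)) = 0 := by
    intro M x hx hxa i
    by_cases haM : a ∈ M.1
    · rw [hpd M x haM hx, if_neg hxa.symm]
    · simp [hp, bary_of_notMem haM]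
  have hsm : p ∈ smoothAtNoncorner T 1 := by
    refine mem_smoothAtNoncorner_succ.2 ⟨hconf.smooth_zero, fun i =>
      mem_smoothAtNoncorner_zero.2 fun x hx K L hK hL => ?_⟩
    have hxa : x ≠ a := fun h => hx (h ▸ ha)
    rw [pd_apply, pd_apply, hpd0 K x hK hxa, hpd0 L x hL hxa]
  refine ⟨fun j => w j • p, ⟨smul_mem_V0 (fun M => ?_) hconf hsm w, fun M x hx hxa => ?_⟩,
    fun M haM => ?_⟩
  · refine (totalDegree_mul_sq_le (d := 1) ?_).trans hk
    rw [pow_one]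
    exact totalDegree_bary_le M b
  · rw [dive_smul_apply]
    simp only [evalAt_add, evalAt_smul, hpd0 M x hx hxa]
    ring
  · rw [dive_smul_apply]
    simp only [evalAt_add, evalAt_smul, hpd M a haM haM, if_true]

/-- A functional on the vertex values at a corner that annihilates the divergences of all edge
fields either vanishes or makes the corner singular. -/
theorem isSingular_of_annihilator {a : Plane} (ha : P.IsCorner a) (μ : T.elems → ℝ)
    (hμ : ∀ (K L : T.elems) (b : Plane), K ≠ L → b ≠ a → a ∈ K.1 → a ∈ L.1 → b ∈ K.1 → b ∈ L.1 →
      ∀ i, μ K * baryGrad T K b i + μ L * baryGrad T L b i = 0)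
    {K₀ : T.elems} (haK₀ : a ∈ K₀.1) (h0 : μ K₀ ≠ 0) : T.IsSingular a := by
  -- Pairing the condition with b - a, along which both coordinates of b have derivative 1: the
  -- weights of neighbours are opposite.
  have hsum : ∀ (K L : T.elems) (b : Plane), K ≠ L → b ≠ a → a ∈ K.1 → a ∈ L.1 → b ∈ K.1 →
      b ∈ L.1 → μ K + μ L = 0 := by
    intro K L b hKL hba haK haL hbK hbL
    have h1 := evalAt_bary_sub K b a b
    have h2 := evalAt_bary_sub L b a b
    rw [evalAt_bary_vertex hbK, evalAt_bary_vertex haK, if_pos rfl, if_neg hba] at h1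
    rw [evalAt_bary_vertex hbL, evalAt_bary_vertex haL, if_pos rfl, if_neg hba] at h2
    have h3 := hμ K L b hKL hba haK haL hbK hbL
    linear_combination (b 0 - a 0) * h3 0 + (b 1 - a 1) * h3 1 - μ K * h1 - μ L * h2
  have hne : ∀ K : T.elems, a ∈ K.1 → μ K ≠ 0 := fun K haK =>
    star_induction_of_isCorner ha (fun K => μ K ≠ 0) (fun K L b hba haK haL hbK hbL hK => by
      by_cases hKL : K = L
      · exact hKL ▸ hK
      · intro hL
        have := hsum K L b hKL hba haK haL hbK hbL
        rw [hL, add_zero] at this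
        exact hK this) haK₀ h0 haK
  obtain ⟨b₀, hb₀, hb₀a⟩ := Finset.exists_mem_ne (by rw [T.card_eq K₀.1 K₀.2]; norm_num) a
  obtain ⟨c₀, hc₀, hc₀a, hc₀b, hK₀⟩ := exists_third haK₀ hb₀ hb₀a.symm
  -- The two lines are those of the edges of `K₀` at a; the property of having all edges on them
  -- passes to neighbours around the corner.
  refine ⟨b₀ - a, c₀ - a, fun K hK haK => ?_⟩
  refine star_induction_of_isCorner ha (fun K : T.elems => ∀ b ∈ K.1,
    (∃ t : ℝ, b - a = t • (b₀ - a)) ∨ ∃ t : ℝ, b - a = t • (c₀ - a)) ?_ haK₀ ?_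
    (K₁ := ⟨K, hK⟩) haK
  · intro K L b hba haK haL hbK hbL hRK d hd
    by_cases hKL : K = L
    · exact hRK d (hKL ▸ hd)
    by_cases hdK : d ∈ K.1
    · exact hRK d hdK
    have hda : d ≠ a := fun h => hdK (h ▸ haK)
    have hdb : d ≠ b := fun h => hdK (h ▸ hbK)
    obtain ⟨c, hc, hca, hcb, hKv⟩ := exists_third haK hbK hba.symm
    -- Opposite nonzero weights force equal gradients. Hence the coordinate of b in K vanishes at
    -- the new vertex d of L, which puts d on the line through a and c.
    have hgrad : ∀ i, baryGrad T K b i = baryGrad T L b i := by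
      intro i
      have h1 := hμ K L b hKL hba haK haL hbK hbL i
      have h2 := hsum K L b hKL hba haK haL hbK hbL
      have h3 : μ K * (baryGrad T K b i - baryGrad T L b i) = 0 := by
        linear_combination h1 - baryGrad T L b i * h2
      exact sub_eq_zero.1 ((mul_eq_zero.1 h3).resolve_left (hne K haK))
    have hd0 : evalAt d (bary T K b) = 0 := by
      have h1 := evalAt_bary_sub K b a d
      have h2 := evalAt_bary_sub L b a d
      rw [hgrad, hgrad, h2, evalAt_bary_vertex hd, evalAt_bary_vertex haL, evalAt_bary_vertex haK,
        if_neg hdb.symm, if_neg hba] at h1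
      linarith
    have h1 := sum_evalAt_bary K d
    have h2 := sum_evalAt_bary_smul K d
    rw [sum_vertices haK hbK hc hba.symm hca hcb hKv, hd0, add_zero] at h1
    rw [sum_vertices haK hbK hc hba.symm hca hcb hKv, hd0, zero_smul, add_zero] at h2
    have h3 : d - a = evalAt d (bary T K c) • (c - a) := by
      rw [← eq_sub_iff_add_eq] at h1
      rw [h1] at h2
      conv_lhs => rw [← h2]
      module
    rcases hRK c hc with ⟨t, ht⟩ | ⟨t, ht⟩
    · exact Or.inl ⟨evalAt d (bary T K c) * t, by rw [h3, ht, smul_smul]⟩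
    · exact Or.inr ⟨evalAt d (bary T K c) * t, by rw [h3, ht, smul_smul]⟩
  · intro b hb
    rcases hK₀ b hb with rfl | rfl | rfl
    · exact Or.inl ⟨0, by simp⟩
    · exact Or.inl ⟨1, by simp⟩
    · exact Or.inr ⟨1, by simp⟩

/-- Duality: if the prescribed values were not attained, some functional would separate them from
the divergences of all admissible fields. It would annihilate those of the edge fields while being
nonzero at the corner, which makes the corner singular. -/
theorem exists_field_corner {a : Plane} (ha : P.IsCorner a) (hs : ¬T.IsSingular a) {k : ℕ}
    (hk : 3 ≤ k) (r : T.elems → ℝ) :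
    ∃ v ∈ divFlat T k {a}, ∀ K : T.elems, a ∈ K.1 → evalAt a (dive T v K) = r K := by
  classical
  let E : (Fin 2 → Broken T) →ₗ[ℝ] (T.elems → ℝ) :=
    { toFun := fun v K => if a ∈ K.1 then evalAt a (dive T v K) else 0
      map_add' := fun u v => by
        ext K
        by_cases h : a ∈ K.1 <;> simp [h]
      map_smul' := fun c v => by
        ext K
        by_cases h : a ∈ K.1 <;> simp [h] }
  have hE : ∀ v K, E v K = if a ∈ K.1 then evalAt a (dive T v K) else 0 := fun v K => rfl
  -- Setting the values to zero on elements away from a ensures that the separating functional has a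
  -- nonzero weight at an element containing a.
  set r' : T.elems → ℝ := fun K => if a ∈ K.1 then r K else 0 with hr'
  suffices r' ∈ (divFlat T k {a}).map E by
    obtain ⟨v, hv, h⟩ := this
    refine ⟨v, hv, fun K hK => ?_⟩
    have := congrFun h K
    simpa only [hE, hr', if_pos hK] using this
  by_contra hcon
  obtain ⟨f, hf0, hf⟩ := Submodule.exists_le_ker_of_notMem hcon
  set μ : T.elems → ℝ := fun K => f (Pi.single K 1) with hμ
  have hfs : ∀ u : T.elems → ℝ, f u = ∑ K, u K * μ K := by
    intro u
    conv_lhs => rw [← Finset.univ_sum_single u]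
    rw [map_sum]
    refine Finset.sum_congr rfl fun K _ => ?_
    have : Pi.single K (u K) = u K • (Pi.single K 1 : T.elems → ℝ) := by
      rw [← Pi.single_smul', smul_eq_mul, mul_one]
    rw [this, map_smul, smul_eq_mul]
  obtain ⟨K₀, -, hK₀⟩ := Finset.exists_ne_zero_of_sum_ne_zero (hfs r' ▸ hf0)
  have haK₀ : a ∈ K₀.1 := by
    by_contra h
    exact hK₀ (by simp only [hr', if_neg h, zero_mul])
  refine hs (isSingular_of_annihilator ha μ ?_ haK₀ (right_ne_zero_of_mul hK₀))
  intro K L b hKL hba haK haL hbK hbL i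
  obtain ⟨v, hv, hdiv⟩ := edge_field_mem_divFlat hKL ha hba.symm haK hbK haL hbL hk
    (Pi.single i 1)
  have h1 : f (E v) = 0 := hf ⟨v, hv, rfl⟩
  rw [hfs, ← Finset.sum_subset (Finset.subset_univ {K, L}) (fun M _ hM => ?_),
    Finset.sum_pair hKL, hE, hE, if_pos haK, if_pos haL, hdiv K haK, hdiv L haL] at h1
  · fin_cases i
    · simp only [Fin.zero_eta, Pi.single_eq_same] at h1
      rw [Pi.single_eq_of_ne (by decide)] at h1
      simp only [Fin.zero_eta]
      linarith
    · simp only [Fin.mk_one, Pi.single_eq_same] at h1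
      rw [Pi.single_eq_of_ne (by decide)] at h1
      simp only [Fin.mk_one]
      linarith
  · rw [hE]
    split_ifs with haM
    · have hbM : b ∉ M.1 := fun hbM => by
        rcases eq_or_eq_of_common_edge hba.symm hKL haK hbK haL hbL haM hbM with h | h <;>
          simp [h] at hM
      rw [hdiv M haM]
      simp [baryGrad, bary_of_notMem hbM]
    · rw [zero_mul]

/-- Every function in `Q₀` agrees at the vertices with the divergence of a field in `𝐕₀`. -/
theorem exists_vertex_values (hT : T.IsCornerSplit) {k : ℕ} (hk : 3 ≤ k) {q : Broken T}
    (hq : q ∈ smoothAtNoncorner T 0) :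
    ∃ v ∈ V0 T k, ∀ K : T.elems, ∀ a ∈ K.1, evalAt a (dive T v K) = evalAt a (q K) := by
  classical
  have hloc : ∀ a : Plane, ∃ v ∈ divFlat T k {a}, ∀ K : T.elems, a ∈ K.1 →
      evalAt a (dive T v K) = evalAt a (q K) := by
    intro a
    by_cases ha : P.IsCorner a
    · exact exists_field_corner ha (hT.nonsingular a ha) hk fun K => evalAt a (q K)
    · by_cases hK : ∃ K : T.elems, a ∈ K.1
      · obtain ⟨K, hK⟩ := hK
        obtain ⟨v, hv, h⟩ := exists_field_noncorner (T := T) ha hk (evalAt a (q K))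
        exact ⟨v, hv, fun L hL => (h L hL).trans
          (mem_smoothAtNoncorner_zero.1 hq a ha K L hK hL)⟩
      · exact ⟨0, zero_mem _, fun K h => absurd ⟨K, h⟩ hK⟩
  choose v hv hdiv using hloc
  -- The local fields do not interfere: the divergence of each vanishes at every vertex but its own.
  refine ⟨∑ a ∈ T.elems.biUnion id, v a, sum_mem fun a _ => (hv a).1, fun K a ha => ?_⟩
  have hmem : a ∈ T.elems.biUnion id := Finset.mem_biUnion.2 ⟨K.1, K.2, ha⟩
  rw [map_sum, Finset.sum_apply, evalAt_sum, Finset.sum_eq_single_of_mem a hmem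
    fun b _ hb => (hv b).2 K a ha (Ne.symm hb), hdiv a K ha]

/-! ### Element means of divergences -/

/-- The function λ_a² λ_b² on an interior edge has zero gradient at every vertex, so it transports
mean value across the edge without changing vertex values. Its degree four is where 4 ≤ k is needed.
-/
theorem exists_flux_field {K L : T.elems} (hKL : K ≠ L) {a b : Plane} (hab : a ≠ b)
    (haK : a ∈ K.1) (hbK : b ∈ K.1) (haL : a ∈ L.1) (hbL : b ∈ L.1) {k : ℕ} (hk : 4 ≤ k) :
    ∃ v ∈ divFlat T k ∅, elemIntegral K (dive T v K) = 1 ∧ elemIntegral L (dive T v L) = -1 ∧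
      ∀ M, M ≠ K → M ≠ L → elemIntegral M (dive T v M) = 0 := by
  classical
  set p : Broken T := fun M => bary T M b ^ 2 * bary T M a ^ 2 with hp
  have hconf : IsConf p := isConf_edge hKL hab haK hbK haL hbL two_ne_zero
  have hpd : ∀ (M : T.elems) (x : Plane), x ∈ M.1 → ∀ i,
      evalAt x (MvPolynomial.pderiv i (p M)) = 0 := by
    intro M x hx i
    by_cases haM : a ∈ M.1
    · have hba : evalAt a (bary T M b) = 0 := by rw [evalAt_bary_vertex haM, if_neg hab.symm]
      rw [hp, evalAt_pderiv_mul_sq (by rw [evalAt_pow, hba]; norm_num) hx]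
      split_ifs
      · rw [Derivation.leibniz_pow]
        simp [hba]
      · rfl
    · simp [hp, bary_of_notMem haM]
  have hsm : p ∈ smoothAtNoncorner T 1 := by
    refine mem_smoothAtNoncorner_succ.2 ⟨hconf.smooth_zero, fun i =>
      mem_smoothAtNoncorner_zero.2 fun x hx K L hK hL => ?_⟩
    rw [pd_apply, pd_apply, hpd K x hK, hpd L x hL]
  have hdeg : ∀ M, (p M).totalDegree ≤ k := fun M => by
    refine (totalDegree_mul_sq_le (d := 2) ?_).trans hk
    refine (MvPolynomial.totalDegree_pow _ _).trans ?_
    have := totalDegree_bary_le M b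
    omega
  have hmem : ∀ w : Fin 2 → ℝ, (fun j => w j • p) ∈ divFlat T k ∅ := fun w =>
    ⟨smul_mem_V0 hdeg hconf hsm w, fun M x hx _ => by
      rw [dive_smul_apply]
      simp [hpd M x hx]⟩
  obtain ⟨c, hc, hca, hcb, -⟩ := exists_third haK hbK hab
  -- This direction points from c across the edge ab. Both λ_a and λ_b have derivative 1 along it,
  -- so the divergence is 2 λ_a λ_b (λ_a + λ_b), which is positive inside K.
  set n : Fin 2 → ℝ := fun j => (a j - c j) + (b j - c j) with hn
  have hpos : 0 < elemIntegral K (dive T (fun j => n j • p) K) := by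
    refine elemIntegral_pos fun x hx => ?_
    have h1 := evalAt_bary_sub K a c a
    have h2 := evalAt_bary_sub K a c b
    have h3 := evalAt_bary_sub K b c a
    have h4 := evalAt_bary_sub K b c b
    simp only [evalAt_bary_vertex haK, evalAt_bary_vertex hbK, evalAt_bary_vertex hc, hab,
      hab.symm, hca.symm, hcb.symm, if_true, if_false, sub_zero] at h1 h2 h3 h4
    have hxa := mem_interior_hull_iff.1 hx a haK
    have hxb := mem_interior_hull_iff.1 hx b hbK
    have key : evalAt x (dive T (fun j => n j • p) K) = 2 * (evalAt x (bary T K a) *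
        evalAt x (bary T K b) * (evalAt x (bary T K a) + evalAt x (bary T K b))) := by
      rw [dive_smul_apply]
      simp only [hp, Derivation.leibniz, Derivation.leibniz_pow, pderiv_bary, smul_eq_mul,
        nsmul_eq_mul, evalAt_add, evalAt_mul, evalAt_smul, evalAt_pow, evalAt_C, hn]
      simp only [Nat.add_one_sub_one, pow_one]
      have h2e : evalAt x ((2 : ℕ) : Poly) = 2 := by
        exact map_natCast (MvPolynomial.eval fun i => x i) 2
      rw [h2e]
      set A := evalAt x (bary T K a)
      set B := evalAt x (bary T K b)
      linear_combination 2 * A * B ^ 2 * (h1 + h2) + 2 * A ^ 2 * B * (h3 + h4)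
    rw [key]
    positivity
  set m := elemIntegral K (dive T (fun j => n j • p) K) with hm
  have hv := hmem fun j => n j
  have hother : ∀ M, M ≠ K → M ≠ L → dive T (fun j => n j • p) M = 0 := by
    intro M hMK hML
    have : p M = 0 := by
      by_cases haM : a ∈ M.1
      · have hbM : b ∉ M.1 := fun hbM => by
          rcases eq_or_eq_of_common_edge hab hKL haK hbK haL hbL haM hbM with h | h
          exacts [hMK h, hML h]
        simp [hp, bary_of_notMem hbM]
      · simp [hp, bary_of_notMem haM]
    rw [dive_smul_apply, this]
    simp
  -- The total integral is zero and only K and L contribute, so L loses what K gains.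
  have hsum := (mem_Q0.1 (dive_mem_Q0 (by omega) hv.1)).2.2
  rw [← Finset.sum_subset (Finset.subset_univ {K, L}) (fun M _ hM => by
    simp only [Finset.mem_insert, Finset.mem_singleton, not_or] at hM
    rw [hother M hM.1 hM.2, map_zero]), Finset.sum_pair hKL, ← hm] at hsum
  refine ⟨m⁻¹ • fun j => n j • p, Submodule.smul_mem _ _ hv, ?_, ?_, fun M hMK hML => ?_⟩
  · rw [map_smul, Pi.smul_apply, map_smul, ← hm, smul_eq_mul, inv_mul_cancel₀ hpos.ne']
  · rw [map_smul, Pi.smul_apply, map_smul, eq_neg_of_add_eq_zero_right hsum, smul_eq_mul, mul_neg,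
      inv_mul_cancel₀ hpos.ne']
  · rw [map_smul, Pi.smul_apply, hother M hMK hML, smul_zero, map_zero]

/-- Flux fields realise differences of unit vectors for neighbouring elements. By connectivity all
differences with a fixed element are attained, and these span the vectors with sum zero. -/
theorem exists_element_means {k : ℕ} (hk : 4 ≤ k) {r : T.elems → ℝ} (hr : ∑ K, r K = 0) :
    ∃ v ∈ divFlat T k ∅, ∀ K : T.elems, elemIntegral K (dive T v K) = r K := by
  classical
  let E : (Fin 2 → Broken T) →ₗ[ℝ] (T.elems → ℝ) :=
    LinearMap.pi fun K => elemIntegral K ∘ₗ LinearMap.proj K ∘ₗ dive T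
  have hE : ∀ v K, E v K = elemIntegral K (dive T v K) := fun v K => rfl
  obtain ⟨K₀, -⟩ := exists_mem_hull_frontier T
  have hdiff : ∀ K, (Pi.single K 1 - Pi.single K₀ 1 : T.elems → ℝ) ∈ (divFlat T k ∅).map E := by
    refine mesh_induction _ ?_ (K₀ := K₀) (by simp)
    intro K L a b hab haK haL hbK hbL hK
    by_cases hKL : K = L
    · exact hKL ▸ hK
    obtain ⟨v, hv, h1, h2, h3⟩ := exists_flux_field hKL hab haK hbK haL hbL hk
    have hEv : E v = Pi.single K 1 - Pi.single L 1 := by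
      ext M
      rw [hE, Pi.sub_apply]
      by_cases hMK : M = K
      · subst hMK
        rw [h1, Pi.single_eq_same, Pi.single_eq_of_ne hKL, sub_zero]
      by_cases hML : M = L
      · subst hML
        rw [h2, Pi.single_eq_same, Pi.single_eq_of_ne hMK, zero_sub]
      · rw [h3 M hMK hML, Pi.single_eq_of_ne hMK, Pi.single_eq_of_ne hML, sub_zero]
    have := sub_mem hK (hEv ▸ Submodule.mem_map_of_mem hv)
    simpa using this
  have hmem : r ∈ (divFlat T k ∅).map E := by
    have e : r = ∑ K, r K • (Pi.single K 1 - Pi.single K₀ 1 : T.elems → ℝ) := by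
      simp only [smul_sub, Finset.sum_sub_distrib, ← Finset.sum_smul, hr, zero_smul, sub_zero]
      ext M
      simp [Finset.sum_apply, Pi.single_apply]
    rw [e]
    exact sum_mem fun K _ => Submodule.smul_mem _ _ (hdiff K)
  obtain ⟨v, hv, h⟩ := hmem
  exact ⟨v, hv, fun K => congrFun h K⟩

/-- The divergence maps `𝐕₀` onto `Q₀`. -/
theorem exists_dive_eq (hT : T.IsCornerSplit) {k : ℕ} (hk : 4 ≤ k) {q : Broken T}
    (hq : q ∈ Q0 T k) : ∃ v ∈ V0 T k, dive T v = q := by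
  obtain ⟨v₁, hv₁, h₁⟩ := exists_vertex_values hT (k := k) (by omega) (mem_Q0.1 hq).2.1
  have hq₁ := mem_Q0.1 (sub_mem hq (dive_mem_Q0 (by omega) hv₁))
  obtain ⟨v₂, hv₂, h₂⟩ := exists_element_means hk hq₁.2.2
  -- The second correction fixes the means and leaves the vertex values already achieved untouched.
  have hq₂ : q - dive T v₁ - dive T v₂ ∈ QI T k := by
    refine mem_QI.2 ⟨(mem_Q0.1 (sub_mem (sub_mem hq (dive_mem_Q0 (by omega) hv₁))
      (dive_mem_Q0 (by omega) hv₂.1))).1, fun K => ⟨?_, fun a ha => ?_⟩⟩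
    · rw [Pi.sub_apply, map_sub, h₂, sub_self]
    · rw [Pi.sub_apply, Pi.sub_apply, evalAt_sub, evalAt_sub, h₁ K a ha, sub_self,
        hv₂.2 K a ha (Set.notMem_empty a), sub_zero]
  obtain ⟨v₃, hv₃, h₃⟩ := exists_dive_eq_of_mem_QI (by omega) hq₂
  refine ⟨v₁ + v₂ + v₃, add_mem (add_mem hv₁ hv₂.1) hv₃.1, ?_⟩
  rw [map_add, map_add, h₃]
  abel

end

end StokesFE

end

/-! ### The theorem. -/

open StokesFE in
theorem mainTheorem4 (P : Polygon) (T : Mesh P) (hT : T.IsCornerSplit) (k : ℕ) (hk : 4 ≤ k)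
    (ν : ℝ) (hν : 0 < ν) :
    IsExactRow T (Sigma0 T k) (V0 T k) (Q0 T k) ∧
    IsExactRow T (SigmaI T k) (VI T k) (QI T k) ∧
    IsExactRow T (SigmaE T ν k) (VE T ν k) (QE T k) ∧
    IsDirectSum (Sigma0 T k) (SigmaI T k) (SigmaE T ν k) ∧
    IsDirectSum (V0 T k) (VI T k) (VE T ν k) ∧
    IsDirectSum (Q0 T k) (QI T k) (QE T k) := by
  have hsurj : ∀ q ∈ Q0 T k, ∃ v ∈ V0 T k, dive T v = q := fun _ => exists_dive_eq hT hk
  have hk3 : 3 ≤ k := by omega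
  exact ⟨isExactRow_full hk3 hsurj, isExactRow_interior T hk3, isExactRow_exterior hk3 hν hsurj,
    isDirectSum_Sigma T hν k, isDirectSum_V T hν hk3, isDirectSum_Q T k⟩
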